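/- Let $A$ be a unital C$^*$-algebra and $B$ a C$^*$-algebra. An $A$-$B$ C$^*$-correspondence is a (right) Hilbert $B$-module $X$ together with a (not necessarily unital) $*$-homomorphism $\pi_X$ from $A$ into the adjointable operators on $X$. For $\xi\in X$ put $\Omega_\xi(a)=\langle\xi,\pi_X(a)\xi\rangle$ ($a\in A$), and let $\mathcal F_X$ be the convex hull of $\{\Omega_\xi:\xi\in X\}$ in the set of completely positive maps $A\to B$. For a $*$-representation $(H,\pi_H)$ of $B$ let $X\otimes_B H$ be the Hilbert space obtained from $X\odot H$ by separation and completion with respect to $\langle\xi\otimes h,\xi'\otimes h'\rangle=\langle h,\pi_H(\langle\xi,\xi'\rangle)h'\rangle$, and let $\theta_X^H: A\otimes_{\max}\pi_H(B)'\to\mathbb B(X\otimes_B H)$ be the $*$-representation with $\theta_X^H(a\otimes x)=\pi_X(a)\otimes x$. For $A$-$B$ C$^*$-correspondences $X,Y$ write $X\prec_H Y$ if $\ker\theta_Y^H\subseteq\ker\theta_X^H$. For a von Neumann algebra $M$ and $A$-$M$ C$^*$-correspondences $X, Y$ write $X\prec Y$ if $X\prec_K Y$ for every faithful normal (nondegenerate)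 representation $K$ of $M$. Let $X,Y$ be $A$-$B$ C$^*$-correspondences, let $(H,\pi_H)$ be a nondegenerate $*$-representation of $B$, and set $M=\pi_H(B)''$. Then the following are equivalent: 1. $X\prec_H Y$. 2. For every $\xi\in X$ there is a net $(\psi_i)_i$ in $\mathcal F_Y$ such that $\pi_H(\psi_i(a))\to\pi_H(\Omega_\xi(a))$ $\sigma$-weakly for every $a\in A$. 3. For every $\xi\in X$ there is a net $(\psi_i)_i$ in $\mathcal F_Y$ such that $\psi_i(1_A)\le\Omega_\xi(1_A)$ for all $i$ and $\pi_H(\psi_i(a))\to\pi_H(\Omega_\xi(a))$ $\sigma$-weakly for every $a\in A$. 4. $X\otimes_B M\prec Y\otimes_B M$, where $X\otimes_B M$ is the $A$-$M$ C$^*$-correspondence obtained from $X\odot M$ by separation and completion with respect to $\langle\xi\otimes m,\xi'\otimes m'\rangle=m^*\pi_H(\langle\xi,\xi'\rangle)m'$, with left action $\pi_X\otimes 1$. 5. $X\otimes_B M\prec_K Y\otimes_B M$ for some faithful normal (nondegenerate) representation $K$ of $M$. Moreover, if $(H_u,\pi_u)$ denotes the universal representation of $B$ (the direct sum of the GNS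 representations of all states of $B$), then the following are equivalent: 1. $X\prec_{H_u}Y$. 2. For every $\xi\in X$ the map $\Omega_\xi$ belongs to the point-norm closure of $\mathcal F_Y$. 3. For every $\xi\in X$ there is a net $(\psi_i)_i$ in $\mathcal F_Y$ such that $\psi_i(1_A)\le\Omega_\xi(1_A)$ for all $i$ and $\lim_i\|\Omega_\xi(a)-\psi_i(a)\|=0$ for every $a\in A$. -/

import Mathlib

universe u v w x y

noncomputable section

namespace CStarCorr

open scoped TensorProduct ComplexOrder InnerProductSpace

set_option linter.unusedSectionVars false

section Aux

variable {D : Type*} [NonUnitalCStarAlgebra D] [PartialOrder D] [StarOrderedRing D]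

lemma exists_neg_witness (a : D) (ha : IsSelfAdjoint a) :
    ∃ n e : D, star n * a * n = -(star e * e) ∧ (e = 0 → 0 ≤ a) := by
  have h0 : 0 ≤ a⁻ * a⁻ * a⁻ := by
    have := star_left_conjugate_nonneg (CFC.negPart_nonneg a) (a⁻)
    rwa [(IsSelfAdjoint.of_nonneg (CFC.negPart_nonneg a)).star_eq] at this
  obtain ⟨e, he⟩ := CStarAlgebra.nonneg_iff_eq_star_mul_self.mp h0
  refine ⟨a⁻, e, ?_, fun h => ?_⟩
  · rw [← he, (IsSelfAdjoint.of_nonneg (CFC.negPart_nonneg a)).star_eq]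
    nth_rewrite 2 [← CFC.posPart_sub_negPart a ha]
    rw [mul_sub, CFC.negPart_mul_posPart, zero_sub, neg_mul]
  · have h3 : a⁻ * a⁻ * a⁻ = 0 := by rw [he, h]; simp
    have hs := (IsSelfAdjoint.of_nonneg (CFC.negPart_nonneg a)).star_eq
    have h2 : a⁻ * a⁻ = 0 := by
      have : star (a⁻ * a⁻) * (a⁻ * a⁻) = 0 := by
        rw [star_mul, hs, ← mul_assoc, h3, zero_mul]
      exact CStarRing.star_mul_self_eq_zero_iff _ |>.mp this
    have h1 : a⁻ = 0 := by
      have : star (a⁻) * a⁻ = 0 := by rw [hs, h2]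
      exact CStarRing.star_mul_self_eq_zero_iff _ |>.mp this
    exact (CFC.negPart_eq_zero_iff a ha).mp h1

lemma exists_eq_star_mul_self {a : D} (ha : 0 ≤ a) : ∃ d : D, a = star d * d :=
  CStarAlgebra.nonneg_iff_eq_star_mul_self.mp ha

end Aux

section HilbertModule

variable {B : Type v} {X : Type w} [NonUnitalCStarAlgebra B] [PartialOrder B] [StarOrderedRing B]
  [NormedAddCommGroup X] [NormedSpace ℂ X] [SMul Bᵐᵒᵖ X] [CStarModule Bᵐᵒᵖ X]

variable (B) in
/-- The `B`-valued inner product of a right Hilbert `B`-module. Mathlib's `CStarModule` is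
written for left actions, so a right Hilbert `B`-module is a `CStarModule` over `Bᵐᵒᵖ`, the
right action `ξ b` being `MulOpposite.op b • ξ`. -/
def rinner (ξ η : X) : B := (inner Bᵐᵒᵖ ξ η).unop

lemma rinner_add_right (ξ η ζ : X) : rinner B ξ (η + ζ) = rinner B ξ η + rinner B ξ ζ := by
  simp [rinner]

lemma rinner_add_left (ξ η ζ : X) : rinner B (ξ + η) ζ = rinner B ξ ζ + rinner B η ζ := by
  simp [rinner]

lemma rinner_smul_right (c : ℂ) (ξ η : X) : rinner B ξ (c • η) = c • rinner B ξ η := by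
  simp [rinner]

lemma rinner_smul_left (c : ℂ) (ξ η : X) : rinner B (c • ξ) η = star c • rinner B ξ η := by
  simp [rinner]

lemma rinner_star (ξ η : X) : star (rinner B ξ η) = rinner B η ξ := by
  simp only [rinner, ← MulOpposite.unop_star, CStarModule.star_inner]

lemma rinner_op_smul_right (b : B) (ξ η : X) :
    rinner B ξ (MulOpposite.op b • η) = rinner B ξ η * b := by
  simp [rinner]

lemma rinner_op_smul_left (b : B) (ξ η : X) :
    rinner B (MulOpposite.op b • ξ) η = star b * rinner B ξ η := by
  rw [← rinner_star, rinner_op_smul_right, star_mul, rinner_star]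

lemma rinner_self_nonneg (ξ : X) : 0 ≤ rinner B ξ ξ :=
  MulOpposite.unop_nonneg.2 CStarModule.inner_self_nonneg

lemma rinner_sum_right {ι : Type*} (s : Finset ι) (ξ : X) (η : ι → X) :
    rinner B ξ (∑ i ∈ s, η i) = ∑ i ∈ s, rinner B ξ (η i) := by
  simp [rinner]

lemma rinner_sum_left {ι : Type*} (s : Finset ι) (ξ : ι → X) (η : X) :
    rinner B (∑ i ∈ s, ξ i) η = ∑ i ∈ s, rinner B (ξ i) η := by
  simp [rinner]

/-- A Gram matrix of a Hilbert module is positive, hence of the form `d* d`. -/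
lemma exists_gram {ι : Type*} [Fintype ι] (ξ : ι → X) :
    ∃ d : ι → ι → B, ∀ i j, rinner B (ξ i) (ξ j) = ∑ k, star (d k i) * d k j := by
  classical
  let a : CStarMatrix ι ι B := CStarMatrix.ofMatrix (Matrix.of fun i j => rinner B (ξ i) (ξ j))
  have ha : IsSelfAdjoint a := by
    ext i j
    simp [a, CStarMatrix.star_apply, rinner_star]
  have hdiag : ∀ (c : CStarMatrix ι ι B) (i : ι), 0 ≤ (star c * a * c) i i := by
    intro c i
    have : (star c * a * c) i i = rinner B (∑ k, MulOpposite.op (c k i) • ξ k)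
        (∑ k, MulOpposite.op (c k i) • ξ k) := by
      simp only [rinner_sum_right, rinner_sum_left, rinner_op_smul_right, rinner_op_smul_left,
        CStarMatrix.mul_apply, CStarMatrix.star_apply, a, Finset.sum_mul]
      rfl
    rw [this]
    exact rinner_self_nonneg _
  have hsq : ∀ (c : CStarMatrix ι ι B) (i : ι),
      (star c * c) i i = ∑ k, star (c k i) * c k i := by
    intro c i
    simp [CStarMatrix.mul_apply, CStarMatrix.star_apply]
  have hpos : 0 ≤ a := by
    obtain ⟨n, e, hne, he⟩ := exists_neg_witness a ha
    refine he ?_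
    have hz : ∀ i k, e k i = 0 := by
      intro i k
      have h1 := hdiag n i
      rw [hne] at h1
      have h2 : (star e * e) i i ≤ 0 := by
        have : (-(star e * e)) i i = -((star e * e) i i) := rfl
        rw [this] at h1
        exact neg_nonneg.mp h1
      rw [hsq] at h2
      have h3 := (Finset.sum_eq_zero_iff_of_nonneg
        (fun k _ => star_mul_self_nonneg (e k i))).mp
        (le_antisymm h2 (Finset.sum_nonneg fun k _ => star_mul_self_nonneg (e k i)))
      exact CStarRing.star_mul_self_eq_zero_iff _ |>.mp (h3 k (Finset.mem_univ k))
    ext i j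
    exact hz j i
  obtain ⟨d, hd⟩ := exists_eq_star_mul_self hpos
  refine ⟨fun i j => d i j, fun i j => ?_⟩
  have := congr_fun (congr_fun hd i) j
  simpa [a, CStarMatrix.mul_apply, CStarMatrix.star_apply] using this

end HilbertModule

section Form

variable {B : Type v} {X : Type w} [NonUnitalCStarAlgebra B] [PartialOrder B] [StarOrderedRing B]
  [NormedAddCommGroup X] [NormedSpace ℂ X] [SMul Bᵐᵒᵖ X] [CStarModule Bᵐᵒᵖ X]
  {C : Type*} [NonUnitalCStarAlgebra C] [PartialOrder C] [StarOrderedRing C]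
  {Y : Type*} [AddCommGroup Y] [Module ℂ Y]

/-- The sesquilinear form `⟨ξ ⊗ y, ξ' ⊗ y'⟩ = ⟨y, ρ(⟨ξ, ξ'⟩) y'⟩` on the algebraic tensor product
`X ⊙ Y`, for a `C`-valued form `g` on `Y` and an action `ρ` of `B` on `Y`. -/
def intForm (g : Y →ₗ⋆[ℂ] Y →ₗ[ℂ] C) (ρ : B →ₙₐ[ℂ] Module.End ℂ Y) :
    X ⊗[ℂ] Y →ₗ⋆[ℂ] X ⊗[ℂ] Y →ₗ[ℂ] C :=
  TensorProduct.lift <| LinearMap.mk₂'ₛₗ (starRingEnd ℂ) (starRingEnd ℂ)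
    (fun (ξ : X) (y : Y) => TensorProduct.lift <| LinearMap.mk₂ ℂ
      (fun (ξ' : X) (y' : Y) => g y (ρ (rinner B ξ ξ') y'))
      (fun m₁ m₂ n => by simp [rinner_add_right])
      (fun c m n => by simp [rinner_smul_right])
      (fun m n₁ n₂ => by simp)
      (fun c m n => by simp))
    (fun m₁ m₂ n => by ext; simp [rinner_add_left])
    (fun c m n => by ext; simp [rinner_smul_left])
    (fun m n₁ n₂ => by ext; simp)
    (fun c m n => by ext; simp)

variable {g : Y →ₗ⋆[ℂ] Y →ₗ[ℂ] C} {ρ : B →ₙₐ[ℂ] Module.End ℂ Y}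

lemma intForm_tmul (ξ ξ' : X) (y y' : Y) :
    intForm g ρ (ξ ⊗ₜ[ℂ] y) (ξ' ⊗ₜ[ℂ] y') = g y (ρ (rinner B ξ ξ') y') := rfl

lemma intForm_star (hs : ∀ y z, star (g y z) = g z y)
    (hρ : ∀ b y z, g y (ρ b z) = g (ρ (star b) y) z) (s t : X ⊗[ℂ] Y) :
    star (intForm g ρ s t) = intForm g ρ t s := by
  induction s with
  | zero => simp
  | add s₁ s₂ h₁ h₂ => simp [h₁, h₂]
  | tmul ξ y =>
    induction t with
    | zero => simp
    | add t₁ t₂ h₁ h₂ => simp [h₁, h₂]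
    | tmul ξ' y' => rw [intForm_tmul, intForm_tmul, hs, hρ (rinner B ξ' ξ), rinner_star]

/-- Adjoints for the form. -/
lemma intForm_adj {S S' : Module.End ℂ X} {T T' : Module.End ℂ Y}
    (hS : ∀ ξ η, rinner B ξ (S η) = rinner B (S' ξ) η)
    (hT : ∀ y z, g y (T z) = g (T' y) z)
    (hc : ∀ b y, T (ρ b y) = ρ b (T y)) (s t : X ⊗[ℂ] Y) :
    intForm g ρ s (TensorProduct.map S T t) = intForm g ρ (TensorProduct.map S' T' s) t := by
  induction s with
  | zero => simp
  | add s₁ s₂ h₁ h₂ => simp [h₁, h₂]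
  | tmul ξ y =>
    induction t with
    | zero => simp
    | add t₁ t₂ h₁ h₂ => simp [h₁, h₂]
    | tmul ξ' y' =>
      rw [TensorProduct.map_tmul, TensorProduct.map_tmul, intForm_tmul, intForm_tmul, hS, ← hc, hT]

/-- The form is a finite sum of squares, uniformly over operators commuting with `ρ`. -/
lemma intForm_sq (hρ : ∀ b y z, g y (ρ b z) = g (ρ (star b) y) z) (s : X ⊗[ℂ] Y) :
    ∃ (F : Finset (X × Y)) (z : F → Y), ∀ T : Module.End ℂ Y,
      (∀ b y, T (ρ b y) = ρ b (T y)) →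
      intForm g ρ (TensorProduct.map LinearMap.id T s) (TensorProduct.map LinearMap.id T s)
        = ∑ k, g (T (z k)) (T (z k)) := by
  obtain ⟨F, rfl⟩ := TensorProduct.exists_finset s
  obtain ⟨d, hd⟩ := exists_gram (B := B) (fun i : F => i.1.1)
  refine ⟨F, fun k => ∑ i : F, ρ (d k i) i.1.2, fun T hT => ?_⟩
  have h0 : TensorProduct.map LinearMap.id T (∑ i ∈ F, i.1 ⊗ₜ[ℂ] i.2)
      = ∑ i : F, i.1.1 ⊗ₜ[ℂ] T i.1.2 := by
    rw [map_sum, ← Finset.sum_coe_sort F]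
    simp
  rw [h0]
  simp only [map_sum, LinearMap.sum_apply, intForm_tmul, hd, hT]
  have h1 : ∀ i j k : F, g (T i.1.2) (ρ (star (d k i) * d k j) (T j.1.2)) =
      g (ρ (d k i) (T i.1.2)) (ρ (d k j) (T j.1.2)) := by
    intro i j k
    rw [map_mul, Module.End.mul_apply, hρ, star_star]
  simp only [h1]
  conv_rhs => rw [Finset.sum_comm]
  exact Finset.sum_congr rfl fun j _ => Finset.sum_comm

lemma intForm_nonneg (hg : ∀ y, 0 ≤ g y y)
    (hρ : ∀ b y z, g y (ρ b z) = g (ρ (star b) y) z) (s : X ⊗[ℂ] Y) :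
    0 ≤ intForm g ρ s s := by
  obtain ⟨F, z, h⟩ := intForm_sq hρ s
  have := h LinearMap.id (fun _ _ => rfl)
  simp only [TensorProduct.map_id, LinearMap.id_apply] at this
  rw [this]
  exact Finset.sum_nonneg fun k _ => hg _

/-- A left action by a unital C⋆-algebra is contractive for the form. -/
lemma intForm_act_le {A : Type*} [CStarAlgebra A] {φ : A →ₙₐ[ℂ] Module.End ℂ X}
    (hφ : ∀ a ξ η, rinner B ξ (φ a η) = rinner B (φ (star a) ξ) η)
    (hg : ∀ y, 0 ≤ g y y)
    (hρ : ∀ b y z, g y (ρ b z) = g (ρ (star b) y) z) (a : A) (s : X ⊗[ℂ] Y) :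
    intForm g ρ (TensorProduct.map (φ a) LinearMap.id s) (TensorProduct.map (φ a) LinearMap.id s)
      ≤ ((‖a‖ ^ 2 : ℝ) : ℂ) • intForm g ρ s s := by
  let L : A →ₗ[ℂ] Module.End ℂ (X ⊗[ℂ] Y) :=
    { toFun := fun a => TensorProduct.map (φ a) LinearMap.id
      map_add' := fun a b => by rw [map_add, TensorProduct.map_add_left]
      map_smul' := fun c a => by rw [map_smul, TensorProduct.map_smul_left]; rfl }
  have hmul : ∀ a b s, L a (L b s) = L (a * b) s := by
    intro a b s
    simp only [L, LinearMap.coe_mk, AddHom.coe_mk, map_mul]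
    rw [← LinearMap.comp_apply, ← TensorProduct.map_comp]
    rfl
  have hadj : ∀ a s t, intForm g ρ s (L a t) = intForm g ρ (L (star a) s) t := fun a s t =>
    intForm_adj (hφ a) (fun _ _ => rfl) (fun _ _ => rfl) s t
  have hsq : ∀ a s, intForm g ρ (L a s) (L a s) = intForm g ρ s (L (star a * a) s) := by
    intro a s
    rw [← hmul, hadj (star a), star_star]
  have hnn := intForm_nonneg (X := X) hg hρ
  obtain ⟨c, hc⟩ : ∃ c : A, star a * a + star c * c = ((‖a‖ ^ 2 : ℝ) : ℂ) • (1 : A) := by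
    let _ : PartialOrder A := CStarAlgebra.spectralOrder A
    have _ : StarOrderedRing A := CStarAlgebra.spectralOrderedRing A
    have h : star a * a ≤ algebraMap ℝ A (‖a‖ ^ 2) := CStarAlgebra.star_mul_le_algebraMap_norm_sq
    obtain ⟨c, hc⟩ := exists_eq_star_mul_self (sub_nonneg.mpr h)
    refine ⟨c, ?_⟩
    rw [← hc, Algebra.algebraMap_eq_smul_one, Complex.coe_smul]
    abel
  have h1 : intForm g ρ (L a s) (L a s) + intForm g ρ (L c s) (L c s)
      = ((‖a‖ ^ 2 : ℝ) : ℂ) • intForm g ρ (L 1 s) (L 1 s) := by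
    rw [hsq, hsq, hsq, ← map_add, ← LinearMap.add_apply, ← map_add, hc]
    simp
  have h2 : intForm g ρ s s = intForm g ρ (L 1 s) (L 1 s)
      + intForm g ρ (s - L 1 s) (s - L 1 s) := by
    have e1 : intForm g ρ (L 1 s) (L 1 s) = intForm g ρ s (L 1 s) := by rw [hsq]; simp
    have e2 : intForm g ρ (L 1 s) s = intForm g ρ s (L 1 s) := by rw [hadj]; simp
    simp only [map_sub, LinearMap.sub_apply, e1, e2]
    abel
  calc intForm g ρ (L a s) (L a s)
      ≤ intForm g ρ (L a s) (L a s) + intForm g ρ (L c s) (L c s) :=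
        le_add_of_nonneg_right (hnn _)
    _ = ((‖a‖ ^ 2 : ℝ) : ℂ) • intForm g ρ (L 1 s) (L 1 s) := h1
    _ ≤ ((‖a‖ ^ 2 : ℝ) : ℂ) • intForm g ρ s s := by
        rw [Complex.coe_smul, Complex.coe_smul]
        refine smul_le_smul_of_nonneg_left ?_ (by positivity)
        rw [h2]
        exact le_add_of_nonneg_right (hnn _)

end Form

/-- An `A`-`B` C⋆-correspondence, for a unital C⋆-algebra `A`: a right Hilbert `B`-module
`carrier` (complete for the norm `‖⟨ξ, ξ⟩‖^(1/2)`) together with a (not necessarily unital)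
⋆-homomorphism from `A` to the adjointable operators. That `act` takes values in the adjointable
operators and preserves the involution is the single condition `rinner_act`. -/
structure Corr (A : Type u) (B : Type v) [CStarAlgebra A] [NonUnitalCStarAlgebra B]
    [PartialOrder B] [StarOrderedRing B] where
  carrier : Type w
  [normedAddCommGroup : NormedAddCommGroup carrier]
  [normedSpace : NormedSpace ℂ carrier]
  [completeSpace : CompleteSpace carrier]
  [smul : SMul Bᵐᵒᵖ carrier]
  [cstarModule : CStarModule Bᵐᵒᵖ carrier]
  act : A →ₙₐ[ℂ] Module.End ℂ carrier
  rinner_act : ∀ (a : A) (ξ η : carrier), rinner B ξ (act a η) = rinner B (act (star a) ξ) η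

attribute [instance] Corr.normedAddCommGroup Corr.normedSpace Corr.completeSpace Corr.smul
  Corr.cstarModule

section Representations

variable {B : Type v} [NonUnitalCStarAlgebra B]
  {H : Type x} [NormedAddCommGroup H] [InnerProductSpace ℂ H] [CompleteSpace H]

/-- A ⋆-representation on `H` is nondegenerate if the span of `π(B)H` is dense. -/
def Nondegenerate (π : B →⋆ₙₐ[ℂ] (H →L[ℂ] H)) : Prop :=
  Dense (Submodule.span ℂ {h : H | ∃ (b : B) (k : H), π b k = h} : Set H)

/-- The commutant `π(B)'`. -/
def commutant (π : B →⋆ₙₐ[ℂ] (H →L[ℂ] H)) : StarSubalgebra ℂ (H →L[ℂ] H) :=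
  StarSubalgebra.centralizer ℂ (Set.range π)

lemma mem_commutant {π : B →⋆ₙₐ[ℂ] (H →L[ℂ] H)} {T : H →L[ℂ] H} :
    T ∈ commutant π ↔ ∀ b, π b * T = T * π b := by
  rw [commutant, StarSubalgebra.mem_centralizer_iff]
  constructor
  · intro h b
    exact (h _ ⟨b, rfl⟩).1
  · rintro h _ ⟨b, rfl⟩
    refine ⟨h b, ?_⟩
    rw [← map_star]
    exact h _

instance (π : B →⋆ₙₐ[ℂ] (H →L[ℂ] H)) : IsClosed (commutant π : Set (H →L[ℂ] H)) := by
  have : (commutant π : Set (H →L[ℂ] H)) = ⋂ b, {T | π b * T = T * π b} := by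
    ext T
    simp [mem_commutant]
  rw [this]
  exact isClosed_iInter fun b => isClosed_eq (by fun_prop) (by fun_prop)

/-- `π` as an action by linear maps. -/
def repEnd (π : B →⋆ₙₐ[ℂ] (H →L[ℂ] H)) : B →ₙₐ[ℂ] Module.End ℂ H where
  toFun b := (π b : H →ₗ[ℂ] H)
  map_smul' c b := by ext; simp
  map_zero' := by ext; simp
  map_add' b c := by ext; simp
  map_mul' b c := by ext; simp

lemma repEnd_apply (π : B →⋆ₙₐ[ℂ] (H →L[ℂ] H)) (b : B) (h : H) : repEnd π b h = π b h := rfl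

lemma repEnd_adj (π : B →⋆ₙₐ[ℂ] (H →L[ℂ] H)) (b : B) (y z : H) :
    innerₛₗ ℂ y (repEnd π b z) = innerₛₗ ℂ (repEnd π (star b) y) z := by
  simp only [repEnd_apply, innerₛₗ_apply_apply, map_star, ContinuousLinearMap.star_eq_adjoint,
    ContinuousLinearMap.adjoint_inner_left]

end Representations

section IntTensor

lemma map_map_apply {E F : Type*} [AddCommGroup E] [Module ℂ E] [AddCommGroup F] [Module ℂ F]
    (S : Module.End ℂ E) (T : Module.End ℂ F) (S' : Module.End ℂ E) (T' : Module.End ℂ F)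
    (s : E ⊗[ℂ] F) :
    TensorProduct.map S T (TensorProduct.map S' T' s)
      = TensorProduct.map (S ∘ₗ S') (T ∘ₗ T') s := by
  rw [TensorProduct.map_comp]
  rfl

variable {A : Type u} {B : Type v} [CStarAlgebra A] [NonUnitalCStarAlgebra B]
  [PartialOrder B] [StarOrderedRing B]
  {H : Type x} [NormedAddCommGroup H] [InnerProductSpace ℂ H] [CompleteSpace H]

/-- The algebraic tensor product `X ⊙ H`, carrying the semi-inner product of `X ⊗_B H`. -/
def PreIntTensor (X : Corr.{u, v, w} A B) (_π : B →⋆ₙₐ[ℂ] (H →L[ℂ] H)) : Type (max w x) :=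
  X.carrier ⊗[ℂ] H

variable (X : Corr.{u, v, w} A B) (π : B →⋆ₙₐ[ℂ] (H →L[ℂ] H))

instance : AddCommGroup (PreIntTensor X π) := inferInstanceAs (AddCommGroup (X.carrier ⊗[ℂ] H))
instance : Module ℂ (PreIntTensor X π) := inferInstanceAs (Module ℂ (X.carrier ⊗[ℂ] H))

/-- The semi-inner product `⟨ξ ⊗ h, ξ' ⊗ h'⟩ = ⟨h, π(⟨ξ, ξ'⟩) h'⟩`. -/
abbrev intCore : PreInnerProductSpace.Core ℂ (PreIntTensor X π) where
  inner s t := intForm (X := X.carrier) (innerₛₗ ℂ) (repEnd π) s t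
  conj_inner_symm s t := intForm_star (X := X.carrier)
    (fun y z => by simp) (repEnd_adj π) t s
  re_inner_nonneg s := (Complex.nonneg_iff.mp
    (intForm_nonneg (X := X.carrier) (g := innerₛₗ ℂ) (fun y => by simp) (repEnd_adj π) s)).1
  add_left s t r := by
    exact LinearMap.map_add₂ (intForm (X := X.carrier) (innerₛₗ ℂ) (repEnd π)) s t r
  smul_left s t c := by
    exact LinearMap.map_smulₛₗ₂ (intForm (X := X.carrier) (innerₛₗ ℂ) (repEnd π)) c s t

instance : SeminormedAddCommGroup (PreIntTensor X π) :=
  InnerProductSpace.Core.toSeminormedAddCommGroup (c := intCore X π)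

instance : InnerProductSpace ℂ (PreIntTensor X π) := InnerProductSpace.ofCore (intCore X π)

/-- The Hilbert space `X ⊗_B H`: separation and completion of `X ⊙ H`. -/
abbrev IntTensor : Type (max w x) := UniformSpace.Completion (PreIntTensor X π)

lemma preInt_inner (s t : PreIntTensor X π) :
    inner ℂ s t = intForm (X := X.carrier) (innerₛₗ ℂ) (repEnd π) s t := rfl

lemma preInt_norm_sq (s : PreIntTensor X π) :
    intForm (X := X.carrier) (innerₛₗ ℂ) (repEnd π) s s = ((‖s‖ ^ 2 : ℝ) : ℂ) := by
  rw [← preInt_inner, inner_self_eq_norm_sq_to_K]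
  simp

lemma preInt_bound (a : A) (T : commutant π) (s : PreIntTensor X π) :
    ‖(show PreIntTensor X π from TensorProduct.map (X.act a) (T.1 : H →ₗ[ℂ] H) s)‖
      ≤ ‖a‖ * ‖T‖ * ‖s‖ := by
  have hT : ∀ b (y : H), (T.1 : H →ₗ[ℂ] H) (repEnd π b y) = repEnd π b ((T.1 : H →ₗ[ℂ] H) y) :=
    fun b y => (congr($(mem_commutant.mp T.2 b) y)).symm
  let t : PreIntTensor X π := TensorProduct.map LinearMap.id (T.1 : H →ₗ[ℂ] H) s
  have h1 : ‖t‖ ≤ ‖T‖ * ‖s‖ := by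
    obtain ⟨F, z, hz⟩ := intForm_sq (X := X.carrier) (repEnd_adj π) s
    have e1 := hz _ hT
    have e2 := hz LinearMap.id (fun _ _ => rfl)
    simp only [TensorProduct.map_id, LinearMap.id_apply] at e2
    have e1' : ‖t‖ ^ 2 = ∑ k, ‖T.1 (z k)‖ ^ 2 := by
      have := preInt_norm_sq X π t
      rw [show t = TensorProduct.map LinearMap.id (T.1 : H →ₗ[ℂ] H) s from rfl, e1] at this
      simp only [innerₛₗ_apply_apply, ContinuousLinearMap.coe_coe,
        inner_self_eq_norm_sq_to_K] at this
      have h : ((∑ k, ‖T.1 (z k)‖ ^ 2 : ℝ) : ℂ) = ((‖t‖ ^ 2 : ℝ) : ℂ) := by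
        rw [← this]; push_cast; rfl
      exact (Complex.ofReal_injective h).symm
    have e2' : ‖s‖ ^ 2 = ∑ k, ‖z k‖ ^ 2 := by
      have this : (∑ k, innerₛₗ ℂ (z k) (z k)) = _ := e2.symm.trans (preInt_norm_sq X π s)
      simp only [innerₛₗ_apply_apply, inner_self_eq_norm_sq_to_K] at this
      have h : ((∑ k, ‖z k‖ ^ 2 : ℝ) : ℂ) = ((‖s‖ ^ 2 : ℝ) : ℂ) := by
        rw [← this]; push_cast; rfl
      exact (Complex.ofReal_injective h).symm
    refine le_of_sq_le_sq ?_ (by positivity)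
    rw [mul_pow, e1', e2', Finset.mul_sum]
    refine Finset.sum_le_sum fun k _ => ?_
    rw [← mul_pow]
    exact pow_le_pow_left₀ (norm_nonneg _) (T.1.le_opNorm _) 2
  have h2 : ‖(show PreIntTensor X π from TensorProduct.map (X.act a) LinearMap.id t)‖
      ≤ ‖a‖ * ‖t‖ := by
    refine le_of_sq_le_sq ?_ (by positivity)
    have := intForm_act_le (X := X.carrier) (g := innerₛₗ ℂ) X.rinner_act (fun y => by simp)
      (repEnd_adj π) a t
    rw [preInt_norm_sq X π t] at this
    have h3 := preInt_norm_sq X π (TensorProduct.map (X.act a) LinearMap.id t)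
    rw [h3, smul_eq_mul, ← Complex.ofReal_mul, Complex.real_le_real] at this
    rw [mul_pow]
    exact this
  have h3 : TensorProduct.map (X.act a) (T.1 : H →ₗ[ℂ] H) s
      = TensorProduct.map (X.act a) LinearMap.id t :=
    (map_map_apply (X.act a) LinearMap.id LinearMap.id (T.1 : H →ₗ[ℂ] H) s).symm
  rw [h3, mul_assoc]
  exact h2.trans (by gcongr)

/-- The operator `π_X(a) ⊗ T` on `X ⊙ H`, for `T` in the commutant. -/
def preOp (a : A) (T : commutant π) : PreIntTensor X π →L[ℂ] PreIntTensor X π :=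
  LinearMap.mkContinuous (E := PreIntTensor X π) (F := PreIntTensor X π)
    (TensorProduct.map (X.act a) (T.1 : H →ₗ[ℂ] H)) (‖a‖ * ‖T‖) (preInt_bound X π a T)

lemma preOp_apply (a : A) (T : commutant π) (s : PreIntTensor X π) :
    preOp X π a T s = TensorProduct.map (X.act a) (T.1 : H →ₗ[ℂ] H) s := rfl

/-- The operator `π_X(a) ⊗ T` on `X ⊗_B H`, for `T` in the commutant. -/
def tensorOp (a : A) (T : commutant π) : IntTensor X π →L[ℂ] IntTensor X π :=
  (preOp X π a T).completion

variable {X π}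

lemma tensorOp_coe (a : A) (T : commutant π) (s : PreIntTensor X π) :
    tensorOp X π a T s = (preOp X π a T s : IntTensor X π) := by
  simp [tensorOp]

lemma intTensor_ext {f g : IntTensor X π →L[ℂ] IntTensor X π}
    (h : ∀ s : PreIntTensor X π, f s = g s) : f = g := by
  ext z
  induction z using UniformSpace.Completion.induction_on with
  | hp => exact isClosed_eq f.continuous g.continuous
  | ih s => exact h s

lemma norm_tensorOp_le (a : A) (T : commutant π) : ‖tensorOp X π a T‖ ≤ ‖a‖ * ‖T‖ := by
  refine ContinuousLinearMap.opNorm_le_bound _ (by positivity) fun z => ?_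
  induction z using UniformSpace.Completion.induction_on with
  | hp => exact isClosed_le (by fun_prop) (by fun_prop)
  | ih s =>
    rw [tensorOp_coe, UniformSpace.Completion.norm_coe, UniformSpace.Completion.norm_coe]
    exact preInt_bound X π a T s

lemma tensorOp_mul (a b : A) (S T : commutant π) :
    tensorOp X π (a * b) (S * T) = tensorOp X π a S * tensorOp X π b T := by
  refine intTensor_ext fun s => ?_
  rw [mul_apply_eq_comp, tensorOp_coe, tensorOp_coe, tensorOp_coe]
  congr 1
  have h := map_map_apply (X.act a) (S.1 : H →ₗ[ℂ] H) (X.act b) (T.1 : H →ₗ[ℂ] H) s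
  refine Eq.trans ?_ h.symm
  rw [preOp_apply, map_mul]
  rfl

lemma tensorOp_star (a : A) (T : commutant π) :
    tensorOp X π (star a) (star T) = star (tensorOp X π a T) := by
  rw [ContinuousLinearMap.star_eq_adjoint, ContinuousLinearMap.eq_adjoint_iff]
  intro x y
  induction x, y using UniformSpace.Completion.induction_on₂ with
  | hp => exact isClosed_eq (by fun_prop) (by fun_prop)
  | ih s t =>
    rw [tensorOp_coe, tensorOp_coe, UniformSpace.Completion.inner_coe,
      UniformSpace.Completion.inner_coe]
    refine (intForm_adj (X := X.carrier) (g := innerₛₗ ℂ) (ρ := repEnd π) (X.rinner_act a)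
      (T := (T.1 : H →ₗ[ℂ] H)) (T' := ((star T).1 : H →ₗ[ℂ] H)) (fun y z => ?_)
      (fun b y => (congr($(mem_commutant.mp T.2 b) y)).symm) s t).symm
    simp [ContinuousLinearMap.star_eq_adjoint, ContinuousLinearMap.adjoint_inner_left]

variable (X π)

/-- The ⋆-representation `θ_X^H` on the algebraic tensor product `A ⊙ π(B)'`, given by
`θ(a ⊗ T) = π_X(a) ⊗ T`. -/
def thetaAlg : A ⊗[ℂ] commutant π →ₗ[ℂ] (IntTensor X π →L[ℂ] IntTensor X π) :=
  TensorProduct.lift <| LinearMap.mk₂ ℂ (fun a T => tensorOp X π a T)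
    (fun a b T => intTensor_ext fun s => by
      rw [add_apply, tensorOp_coe, tensorOp_coe, tensorOp_coe,
        ← UniformSpace.Completion.coe_add]
      congr 1
      simp only [preOp_apply, map_add, TensorProduct.map_add_left]
      rfl)
    (fun c a T => intTensor_ext fun s => by
      rw [smul_apply, tensorOp_coe, tensorOp_coe,
        ← UniformSpace.Completion.coe_smul]
      congr 1
      simp only [preOp_apply, map_smul, TensorProduct.map_smul_left]
      rfl)
    (fun a S T => intTensor_ext fun s => by
      rw [add_apply, tensorOp_coe, tensorOp_coe, tensorOp_coe,
        ← UniformSpace.Completion.coe_add]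
      congr 1
      have : (((S + T : commutant π).1 : H →L[ℂ] H) : H →ₗ[ℂ] H) = S.1 + T.1 := rfl
      simp only [preOp_apply, this, TensorProduct.map_add_right]
      rfl)
    (fun c a T => intTensor_ext fun s => by
      rw [smul_apply, tensorOp_coe, tensorOp_coe,
        ← UniformSpace.Completion.coe_smul]
      congr 1
      have : (((c • T : commutant π).1 : H →L[ℂ] H) : H →ₗ[ℂ] H) = c • T.1 := rfl
      simp only [preOp_apply, this, TensorProduct.map_smul_right]
      rfl)

variable {X π}

lemma thetaAlg_tmul (a : A) (T : commutant π) : thetaAlg X π (a ⊗ₜ[ℂ] T) = tensorOp X π a T := rfl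

lemma thetaAlg_mul (z z' : A ⊗[ℂ] commutant π) :
    thetaAlg X π (z * z') = thetaAlg X π z * thetaAlg X π z' := by
  induction z with
  | zero => simp
  | add z₁ z₂ h₁ h₂ => rw [add_mul, map_add, h₁, h₂, map_add, add_mul]
  | tmul a S =>
    induction z' with
    | zero => simp
    | add z₁ z₂ h₁ h₂ => rw [mul_add, map_add, h₁, h₂, map_add, mul_add]
    | tmul b T =>
      rw [Algebra.TensorProduct.tmul_mul_tmul, thetaAlg_tmul, thetaAlg_tmul, thetaAlg_tmul,
        tensorOp_mul]

lemma thetaAlg_star (z : A ⊗[ℂ] commutant π) :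
    thetaAlg X π (star z) = star (thetaAlg X π z) := by
  induction z with
  | zero => simp
  | add z₁ z₂ h₁ h₂ => rw [star_add, map_add, h₁, h₂, map_add, star_add]
  | tmul a S => rw [TensorProduct.star_tmul, thetaAlg_tmul, thetaAlg_tmul, tensorOp_star]

end IntTensor

section MaxTensor

/-- A C⋆-seminorm on a complex ⋆-algebra. -/
def IsCStarSeminorm {R : Type*} [Ring R] [StarRing R] [Module ℂ R] (p : Seminorm ℂ R) : Prop :=
  (∀ y z : R, p (y * z) ≤ p y * p z) ∧ ∀ z : R, p (star z * z) = p z ^ 2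

/-- C⋆-seminorms on a unital C⋆-algebra are dominated by the norm. -/
lemma IsCStarSeminorm.le_norm {R : Type*} [CStarAlgebra R] {p : Seminorm ℂ R}
    (hp : IsCStarSeminorm p) (a : R) : p a ≤ ‖a‖ := by
  let _ : PartialOrder R := CStarAlgebra.spectralOrder R
  have _ : StarOrderedRing R := CStarAlgebra.spectralOrderedRing R
  have h1 : p 1 ≤ 1 := by
    have h := hp.2 1
    rw [star_one, one_mul] at h
    nlinarith [sq_nonneg (p 1 - 1), apply_nonneg p (1 : R)]
  have hu : ∀ u : unitary R, p u ≤ 1 := by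
    intro u
    have h := hp.2 u
    rw [Unitary.star_mul_self_of_mem u.2] at h
    nlinarith [apply_nonneg p (u : R)]
  have hs : ∀ h : selfAdjoint R, ‖h‖ ≤ 1 → p (h : R) ≤ 1 := by
    intro h hh
    have e : (h : R) = ((2 : ℂ)⁻¹) • (selfAdjoint.unitarySelfAddISMul h hh : R)
        + ((2 : ℂ)⁻¹) • (star (selfAdjoint.unitarySelfAddISMul h hh) : unitary R) := by
      have := congrArg (fun x : selfAdjoint R => (x : R))
        (selfAdjoint.realPart_unitarySelfAddISMul h hh)
      simp only [realPart_apply_coe] at this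
      nth_rewrite 1 [← this]
      rw [smul_add, Unitary.coe_star]
      simp only [← Complex.coe_smul]
      norm_num
    rw [e]
    refine (map_add_le_add p _ _).trans ?_
    rw [map_smul_eq_mul, map_smul_eq_mul]
    have := hu (selfAdjoint.unitarySelfAddISMul h hh)
    have := hu (star (selfAdjoint.unitarySelfAddISMul h hh))
    rw [show ‖(2 : ℂ)⁻¹‖ = 1 / 2 by norm_num]
    linarith
  have hs' : ∀ h : R, IsSelfAdjoint h → p h ≤ ‖h‖ := by
    intro h hh
    rcases eq_or_ne h 0 with rfl | h0
    · simp
    have hn : 0 < ‖h‖ := norm_pos_iff.mpr h0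
    have := hs ⟨((‖h‖⁻¹ : ℝ) : ℂ) • h, by
      rw [selfAdjoint.mem_iff, star_smul, hh.star_eq]; simp⟩ (by
        change ‖((‖h‖⁻¹ : ℝ) : ℂ) • h‖ ≤ 1
        rw [norm_smul]; simp [hn.ne'])
    rw [map_smul_eq_mul] at this
    simp only [Complex.norm_real, norm_inv, norm_norm] at this
    rwa [inv_mul_le_iff₀ hn, mul_one] at this
  refine le_of_sq_le_sq ?_ (norm_nonneg _)
  rw [← hp.2 a, sq ‖a‖, ← CStarRing.norm_star_mul_self]
  exact hs' _ (IsSelfAdjoint.star_mul_self a)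

variable (A : Type u) (N : Type v) [CStarAlgebra A] [CStarAlgebra N]

variable {A N} in
lemma IsCStarSeminorm.tmul_le {p : Seminorm ℂ (A ⊗[ℂ] N)} (hp : IsCStarSeminorm p)
    (a : A) (x : N) : p (a ⊗ₜ[ℂ] x) ≤ ‖a‖ * ‖x‖ := by
  have h1 : IsCStarSeminorm (p.comp ((TensorProduct.mk ℂ A N).flip 1)) := by
    refine ⟨fun y z => ?_, fun z => ?_⟩
    · simpa using hp.1 (y ⊗ₜ[ℂ] 1) (z ⊗ₜ[ℂ] 1)
    · simpa using hp.2 (z ⊗ₜ[ℂ] 1)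
  have h2 : IsCStarSeminorm (p.comp (TensorProduct.mk ℂ A N 1)) := by
    refine ⟨fun y z => ?_, fun z => ?_⟩
    · simpa using hp.1 (1 ⊗ₜ[ℂ] y) (1 ⊗ₜ[ℂ] z)
    · simpa using hp.2 (1 ⊗ₜ[ℂ] z)
  calc p (a ⊗ₜ[ℂ] x) = p ((a ⊗ₜ[ℂ] 1) * (1 ⊗ₜ[ℂ] x)) := by simp
    _ ≤ p (a ⊗ₜ[ℂ] 1) * p (1 ⊗ₜ[ℂ] x) := hp.1 _ _
    _ ≤ ‖a‖ * ‖x‖ := mul_le_mul (h1.le_norm a) (h2.le_norm x) (apply_nonneg _ _) (norm_nonneg _)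

lemma bddAbove_cstarSeminorm :
    BddAbove {p : Seminorm ℂ (A ⊗[ℂ] N) | IsCStarSeminorm p} := by
  rw [Seminorm.bddAbove_iff]
  have h : ∀ z : A ⊗[ℂ] N, ∃ c : ℝ, ∀ p : Seminorm ℂ (A ⊗[ℂ] N), IsCStarSeminorm p → p z ≤ c := by
    intro z
    induction z with
    | zero => exact ⟨0, fun p _ => by simp⟩
    | tmul a x => exact ⟨‖a‖ * ‖x‖, fun p hp => hp.tmul_le a x⟩
    | add z₁ z₂ h₁ h₂ =>
      obtain ⟨c₁, h₁⟩ := h₁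
      obtain ⟨c₂, h₂⟩ := h₂
      exact ⟨c₁ + c₂, fun p hp => (map_add_le_add p _ _).trans (add_le_add (h₁ p hp) (h₂ p hp))⟩
  choose c hc using h
  refine ⟨c, ?_⟩
  rintro _ ⟨p, hp, rfl⟩ z
  exact hc z p hp

/-- The maximal C⋆-norm on `A ⊙ N`: the supremum of all C⋆-seminorms. -/
def maxSeminorm : Seminorm ℂ (A ⊗[ℂ] N) := sSup {p | IsCStarSeminorm p}

variable {A N} in
lemma le_maxSeminorm {p : Seminorm ℂ (A ⊗[ℂ] N)} (hp : IsCStarSeminorm p) : p ≤ maxSeminorm A N :=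
  le_csSup (bddAbove_cstarSeminorm A N) hp

/-- The algebraic tensor product `A ⊙ N`, normed by the maximal C⋆-norm. -/
def PreMaxTensor : Type (max u v) := A ⊗[ℂ] N

instance : AddCommGroup (PreMaxTensor A N) := inferInstanceAs (AddCommGroup (A ⊗[ℂ] N))
instance : Module ℂ (PreMaxTensor A N) := inferInstanceAs (Module ℂ (A ⊗[ℂ] N))

instance : Norm (PreMaxTensor A N) := ⟨fun z => maxSeminorm A N z⟩

lemma preMaxTensor_core : SeminormedSpace.Core ℂ (PreMaxTensor A N) where
  norm_nonneg z := apply_nonneg (maxSeminorm A N) z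
  norm_smul c z := map_smul_eq_mul (maxSeminorm A N) c z
  norm_triangle y z := map_add_le_add (maxSeminorm A N) y z

instance : SeminormedAddCommGroup (PreMaxTensor A N) :=
  SeminormedAddCommGroup.ofCore (preMaxTensor_core A N)

instance : NormedSpace ℂ (PreMaxTensor A N) where
  norm_smul_le c z := (map_smul_eq_mul (maxSeminorm A N) c z).le

/-- The maximal tensor product `A ⊗_max N`, as a Banach space. -/
abbrev MaxTensor : Type (max u v) := UniformSpace.Completion (PreMaxTensor A N)

end MaxTensor

section WeakContainment

variable {A : Type u} {B : Type v} [CStarAlgebra A] [NonUnitalCStarAlgebra B]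
  [PartialOrder B] [StarOrderedRing B]
  {H : Type x} [NormedAddCommGroup H] [InnerProductSpace ℂ H] [CompleteSpace H]
  (X : Corr.{u, v, w} A B) (π : B →⋆ₙₐ[ℂ] (H →L[ℂ] H))

/-- The C⋆-seminorm `z ↦ ‖θ(z)‖`. -/
def thetaSeminorm : Seminorm ℂ (A ⊗[ℂ] commutant π) :=
  (normSeminorm ℂ (IntTensor X π →L[ℂ] IntTensor X π)).comp (thetaAlg X π)

lemma isCStarSeminorm_theta : IsCStarSeminorm (thetaSeminorm X π) := by
  refine ⟨fun y z => ?_, fun z => ?_⟩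
  · change ‖thetaAlg X π (y * z)‖ ≤ ‖thetaAlg X π y‖ * ‖thetaAlg X π z‖
    rw [thetaAlg_mul]
    exact norm_mul_le _ _
  · change ‖thetaAlg X π (star z * z)‖ = ‖thetaAlg X π z‖ ^ 2
    rw [thetaAlg_mul, thetaAlg_star, sq]
    exact CStarRing.norm_star_mul_self (x := thetaAlg X π z)

/-- `θ_X^H` on `A ⊙ π(B)'`, continuous for the maximal norm. -/
def preTheta : PreMaxTensor A (commutant π) →L[ℂ] (IntTensor X π →L[ℂ] IntTensor X π) :=
  LinearMap.mkContinuous (E := PreMaxTensor A (commutant π)) (thetaAlg X π) 1 fun z => by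
    rw [one_mul]
    exact le_maxSeminorm (isCStarSeminorm_theta X π) z

/-- The representation `θ_X^H` of `A ⊗_max π(B)'` on `X ⊗_B H`, the continuous extension of
`a ⊗ T ↦ π_X(a) ⊗ T`. -/
def theta : MaxTensor A (commutant π) →L[ℂ] (IntTensor X π →L[ℂ] IntTensor X π) :=
  (preTheta X π).extend UniformSpace.Completion.toComplL

lemma theta_coe (z : PreMaxTensor A (commutant π)) :
    theta X π (z : MaxTensor A (commutant π)) = thetaAlg X π z :=
  ContinuousLinearMap.extend_eq _ (UniformSpace.Completion.denseRange_coe)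
    (UniformSpace.Completion.isUniformInducing_coe _) z

/-- `X ≺_{(H, π)} Y`: the representation `θ_X^H` is weakly contained in `θ_Y^H`, that is,
`ker θ_Y^H ⊆ ker θ_X^H` in `A ⊗_max π(B)'`. -/
def WeaklyContained (π : B →⋆ₙₐ[ℂ] (H →L[ℂ] H)) (X : Corr.{u, v, w} A B)
    (Y : Corr.{u, v, y} A B) : Prop :=
  ∀ z : MaxTensor A (commutant π), theta Y π z = 0 → theta X π z = 0

end WeakContainment

section BaseChange

variable {A : Type u} {B : Type v} [CStarAlgebra A] [NonUnitalCStarAlgebra B]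
  [PartialOrder B] [StarOrderedRing B]
  {C : Type x} [NonUnitalCStarAlgebra C] [PartialOrder C] [StarOrderedRing C]

/-- The inner product `⟨c, c'⟩ = c* c'` on `C`. -/
def mulForm (C : Type x) [NonUnitalCStarAlgebra C] : C →ₗ⋆[ℂ] C →ₗ[ℂ] C :=
  LinearMap.mk₂'ₛₗ (starRingEnd ℂ) (RingHom.id ℂ) (fun c c' => star c * c')
    (fun a b c => by simp [add_mul]) (fun r a b => by simp [smul_mul_assoc])
    (fun a b c => by simp [mul_add]) (fun r a b => by simp [mul_smul_comm])

lemma mulForm_apply (c c' : C) : mulForm C c c' = star c * c' := rfl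

/-- The action of `B` on `C` by left multiplication through `φ`. -/
def mulEnd (φ : B →⋆ₙₐ[ℂ] C) : B →ₙₐ[ℂ] Module.End ℂ C where
  toFun b := LinearMap.mulLeft ℂ (φ b)
  map_smul' c b := by ext; simp [smul_mul_assoc]
  map_zero' := by ext; simp
  map_add' b c := by ext; simp [add_mul]
  map_mul' b c := by ext; simp

lemma mulEnd_apply (φ : B →⋆ₙₐ[ℂ] C) (b : B) (c : C) : mulEnd φ b c = φ b * c := rfl

lemma mulEnd_adj (φ : B →⋆ₙₐ[ℂ] C) (b : B) (y z : C) :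
    mulForm C y (mulEnd φ b z) = mulForm C (mulEnd φ (star b) y) z := by
  simp [mulForm_apply, mulEnd_apply, mul_assoc, map_star]

/-- The algebraic tensor product `X ⊙ C`, carrying the semi-inner product of `X ⊗_φ C`. -/
def PreBase (X : Corr.{u, v, w} A B) (_φ : B →⋆ₙₐ[ℂ] C) : Type (max w x) := X.carrier ⊗[ℂ] C

variable (X : Corr.{u, v, w} A B) (φ : B →⋆ₙₐ[ℂ] C)

instance : AddCommGroup (PreBase X φ) := inferInstanceAs (AddCommGroup (X.carrier ⊗[ℂ] C))
instance : Module ℂ (PreBase X φ) := inferInstanceAs (Module ℂ (X.carrier ⊗[ℂ] C))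

/-- The `C`-valued semi-inner product `⟨ξ ⊗ c, ξ' ⊗ c'⟩ = c* φ(⟨ξ, ξ'⟩) c'`. -/
def baseForm : PreBase X φ →ₗ⋆[ℂ] PreBase X φ →ₗ[ℂ] C :=
  intForm (X := X.carrier) (mulForm C) (mulEnd φ)

/-- The right action `(ξ ⊗ c') c = ξ ⊗ (c' c)`. -/
def baseMul (c : C) : PreBase X φ →ₗ[ℂ] PreBase X φ :=
  TensorProduct.map (LinearMap.id (M := X.carrier)) (LinearMap.mulRight ℂ c)

/-- The left action `π_X(a) ⊗ 1`. -/
def baseAct (a : A) : PreBase X φ →ₗ[ℂ] PreBase X φ :=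
  TensorProduct.map (X.act a) (LinearMap.id (M := C))

variable {X φ}

lemma baseForm_star (s t : PreBase X φ) : star (baseForm X φ s t) = baseForm X φ t s :=
  intForm_star (X := X.carrier) (fun y z => by simp [mulForm_apply]) (mulEnd_adj φ) s t

lemma baseForm_nonneg (s : PreBase X φ) : 0 ≤ baseForm X φ s s :=
  intForm_nonneg (X := X.carrier) (fun y => star_mul_self_nonneg y) (mulEnd_adj φ) s

lemma baseForm_mul_right (c : C) (s t : PreBase X φ) :
    baseForm X φ s (baseMul X φ c t) = baseForm X φ s t * c := by
  have key : ∀ s t : X.carrier ⊗[ℂ] C, intForm (mulForm C) (mulEnd φ) s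
      (TensorProduct.map LinearMap.id (LinearMap.mulRight ℂ c) t)
      = intForm (mulForm C) (mulEnd φ) s t * c := by
    intro s t
    induction s with
    | zero => simp
    | add s₁ s₂ h₁ h₂ => simp [h₁, h₂, add_mul]
    | tmul ξ y =>
      induction t with
      | zero => simp
      | add t₁ t₂ h₁ h₂ => simp [h₁, h₂, add_mul]
      | tmul ξ' y' =>
        simp [intForm_tmul, mulForm_apply, mulEnd_apply, mul_assoc]
  exact key s t

lemma baseForm_mul_left (c : C) (s t : PreBase X φ) :
    baseForm X φ (baseMul X φ c s) t = star c * baseForm X φ s t := by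
  rw [← baseForm_star, baseForm_mul_right, star_mul, baseForm_star]

lemma baseForm_act (a : A) (s t : PreBase X φ) :
    baseForm X φ s (baseAct X φ a t) = baseForm X φ (baseAct X φ (star a) s) t :=
  intForm_adj (X := X.carrier) (X.rinner_act a) (fun _ _ => rfl) (fun _ _ => rfl) s t

lemma baseForm_cauchy_schwarz (s t : PreBase X φ) :
    ‖baseForm X φ s t‖ ^ 2 ≤ ‖baseForm X φ s s‖ * ‖baseForm X φ t t‖ := by
  set a := baseForm X φ s s with ha
  set b := baseForm X φ t t with hb
  set z := baseForm X φ s t with hz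
  have hz' : baseForm X φ t s = star z := (baseForm_star s t).symm
  have key : ∀ r : ℝ, 0 ≤ r → (2 * r - r ^ 2 * ‖a‖) * ‖z‖ ^ 2 ≤ ‖b‖ := by
    intro r hr
    rcases le_or_gt (2 * r - r ^ 2 * ‖a‖) 0 with hneg | hpos
    · exact (mul_nonpos_of_nonpos_of_nonneg hneg (by positivity)).trans (norm_nonneg _)
    have h0 : 0 ≤ baseForm X φ (((r : ℝ) : ℂ) • baseMul X φ z s - t)
        (((r : ℝ) : ℂ) • baseMul X φ z s - t) := baseForm_nonneg _
    have e : baseForm X φ (((r : ℝ) : ℂ) • baseMul X φ z s - t)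
        (((r : ℝ) : ℂ) • baseMul X φ z s - t)
        = (r ^ 2) • (star z * a * z) - (2 * r) • (star z * z) + b := by
      rw [map_sub, LinearMap.map_sub₂, LinearMap.map_sub₂, map_smul, LinearMap.map_smulₛₗ₂,
        LinearMap.map_smulₛₗ₂, map_smul, Complex.conj_ofReal, baseForm_mul_right,
        baseForm_mul_left, baseForm_mul_left, baseForm_mul_right, hz', ← ha, ← hb, ← hz]
      simp only [Complex.coe_smul, two_mul, add_smul, sq, mul_smul]
      abel
    rw [e] at h0
    have h1 : star z * a * z ≤ ‖a‖ • (star z * z) :=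
      CStarAlgebra.star_left_conjugate_le_norm_smul
        (hb := IsSelfAdjoint.of_nonneg (baseForm_nonneg s))
    have h2 : (2 * r - r ^ 2 * ‖a‖) • (star z * z) ≤ b := by
      have h3 : (r ^ 2) • (star z * a * z) ≤ (r ^ 2) • ‖a‖ • (star z * z) :=
        smul_le_smul_of_nonneg_left h1 (by positivity)
      rw [sub_smul, mul_smul (r ^ 2)]
      have h4 : (2 * r) • (star z * z) ≤ (r ^ 2) • (star z * a * z) + b := by
        rw [← sub_nonneg]
        convert h0 using 1
        abel
      rw [sub_le_iff_le_add']
      exact h4.trans (by gcongr)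
    have h5 := CStarAlgebra.norm_le_norm_of_nonneg_of_le
      (smul_nonneg hpos.le (star_mul_self_nonneg z)) h2
    rwa [norm_smul, CStarRing.norm_star_mul_self, Real.norm_of_nonneg hpos.le, ← sq] at h5
  rcases eq_or_lt_of_le (norm_nonneg a) with h | h
  · rw [← h, zero_mul]
    rw [← h] at key
    by_contra hc
    push Not at hc
    have := key (‖b‖ / ‖z‖ ^ 2) (by positivity)
    rw [mul_zero, sub_zero, mul_assoc, div_mul_cancel₀ _ hc.ne'] at this
    have hb0 : ‖b‖ = 0 := by linarith [norm_nonneg b]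
    have := key 1 (by norm_num)
    linarith
  · have := key (‖a‖⁻¹) (by positivity)
    have e : 2 * ‖a‖⁻¹ - ‖a‖⁻¹ ^ 2 * ‖a‖ = ‖a‖⁻¹ := by field_simp; ring
    rwa [e, inv_mul_le_iff₀ h] at this

instance : Norm (PreBase X φ) := ⟨fun s => √‖baseForm X φ s s‖⟩

lemma preBase_norm_sq (s : PreBase X φ) : ‖s‖ ^ 2 = ‖baseForm X φ s s‖ :=
  Real.sq_sqrt (norm_nonneg _)

lemma norm_baseForm_le (s t : PreBase X φ) : ‖baseForm X φ s t‖ ≤ ‖s‖ * ‖t‖ := by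
  refine le_of_sq_le_sq ?_ (mul_nonneg (Real.sqrt_nonneg _) (Real.sqrt_nonneg _))
  rw [mul_pow, preBase_norm_sq, preBase_norm_sq]
  exact baseForm_cauchy_schwarz s t

variable (X φ) in
lemma preBase_core : SeminormedSpace.Core ℂ (PreBase X φ) where
  norm_nonneg z := Real.sqrt_nonneg _
  norm_smul c z := by
    change √‖baseForm X φ (c • z) (c • z)‖ = ‖c‖ * √‖baseForm X φ z z‖
    rw [map_smul, LinearMap.map_smulₛₗ₂, norm_smul, norm_smul, ← mul_assoc]
    simp [← sq]
  norm_triangle s t := by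
    refine le_of_sq_le_sq ?_ (add_nonneg (Real.sqrt_nonneg _) (Real.sqrt_nonneg _))
    rw [preBase_norm_sq]
    simp only [map_add, LinearMap.add_apply]
    have h1 := norm_baseForm_le s t
    have h2 := norm_baseForm_le t s
    have h3 := norm_baseForm_le s s
    have h4 := norm_baseForm_le t t
    have := norm_add₃_le (a := baseForm X φ s s + baseForm X φ t s) (b := baseForm X φ s t)
      (c := baseForm X φ t t)
    have := norm_add_le (baseForm X φ s s) (baseForm X φ t s)
    rw [← add_assoc]
    nlinarith

instance : SeminormedAddCommGroup (PreBase X φ) :=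
  SeminormedAddCommGroup.ofCore (preBase_core X φ)

instance : NormedSpace ℂ (PreBase X φ) where
  norm_smul_le c z := ((preBase_core X φ).norm_smul c z).le

lemma norm_baseMul_le (c : C) (s : PreBase X φ) : ‖baseMul X φ c s‖ ≤ ‖c‖ * ‖s‖ := by
  refine le_of_sq_le_sq ?_ (by positivity)
  rw [mul_pow, preBase_norm_sq, preBase_norm_sq, baseForm_mul_right, baseForm_mul_left]
  calc ‖star c * baseForm X φ s s * c‖ ≤ ‖star c‖ * ‖baseForm X φ s s‖ * ‖c‖ :=
        (norm_mul_le _ _).trans (by gcongr; exact norm_mul_le _ _)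
    _ = ‖c‖ ^ 2 * ‖baseForm X φ s s‖ := by rw [norm_star]; ring

lemma norm_baseAct_le (a : A) (s : PreBase X φ) : ‖baseAct X φ a s‖ ≤ ‖a‖ * ‖s‖ := by
  refine le_of_sq_le_sq ?_ (by positivity)
  rw [mul_pow, preBase_norm_sq, preBase_norm_sq]
  have := CStarAlgebra.norm_le_norm_of_nonneg_of_le (baseForm_nonneg _)
    (intForm_act_le (X := X.carrier) X.rinner_act (fun y => star_mul_self_nonneg y)
      (mulEnd_adj φ) a s)
  rw [norm_smul] at this
  rw [show ‖((‖a‖ ^ 2 : ℝ) : ℂ)‖ = ‖a‖ ^ 2 by simp] at this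
  exact this

instance : SMul Cᵐᵒᵖ (PreBase X φ) := ⟨fun c s => baseMul X φ c.unop s⟩

lemma preBase_smul_def (c : Cᵐᵒᵖ) (s : PreBase X φ) : c • s = baseMul X φ c.unop s := rfl

instance : UniformContinuousConstSMul Cᵐᵒᵖ (PreBase X φ) where
  uniformContinuous_const_smul c :=
    (LinearMap.mkContinuous (baseMul X φ c.unop) ‖c.unop‖
      (norm_baseMul_le c.unop)).uniformContinuous

instance : Inner Cᵐᵒᵖ (PreBase X φ) := ⟨fun s t => MulOpposite.op (baseForm X φ s t)⟩

lemma preBase_inner (s t : PreBase X φ) :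
    inner Cᵐᵒᵖ s t = MulOpposite.op (baseForm X φ s t) := rfl

/-- The opposite of the semi-inner product as a continuous sesquilinear map. -/
def baseFormL : PreBase X φ →L⋆[ℂ] PreBase X φ →L[ℂ] Cᵐᵒᵖ :=
  LinearMap.mkContinuous₂ (LinearMap.mk₂'ₛₗ (starRingEnd ℂ) (RingHom.id ℂ)
    (fun s t : PreBase X φ => MulOpposite.op (baseForm X φ s t))
    (fun a b c => by simp) (fun r a b => by simp)
    (fun a b c => by simp) (fun r a b => by simp)) 1
    (fun s t => by rw [one_mul]; exact norm_baseForm_le s t)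

lemma continuous_preBase_inner :
    Continuous (Function.uncurry (inner Cᵐᵒᵖ (E := PreBase X φ))) := by
  have : Continuous fun p : PreBase X φ × PreBase X φ => baseFormL (X := X) (φ := φ) p.1 p.2 := by
    fun_prop
  exact this

variable (X φ) in
/-- The Hilbert `C`-module `X ⊗_φ C`: separation and completion of `X ⊙ C`. -/
abbrev BaseChange : Type (max w x) := UniformSpace.Completion (PreBase X φ)

open UniformSpace

lemma baseChange_inner_coe (s t : PreBase X φ) :
    inner Cᵐᵒᵖ (s : BaseChange X φ) (t : BaseChange X φ) = MulOpposite.op (baseForm X φ s t) :=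
  (Completion.isDenseInducing_coe.prodMap Completion.isDenseInducing_coe).extend_eq
    continuous_preBase_inner (s, t)

lemma continuous_baseChange_inner :
    Continuous (Function.uncurry (inner Cᵐᵒᵖ (E := BaseChange X φ))) := by
  let inner' : PreBase X φ →+ PreBase X φ →+ Cᵐᵒᵖ :=
    { toFun := fun s => (baseFormL (X := X) (φ := φ) s).toLinearMap.toAddMonoidHom
      map_zero' := by ext; simp
      map_add' := fun s t => by ext; simp }
  have : Continuous fun p : PreBase X φ × PreBase X φ => inner' p.1 p.2 := continuous_preBase_inner
  rw [Completion.toInner, inner, Function.uncurry_curry _]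
  change Continuous (((Completion.isDenseInducing_toCompl (PreBase X φ)).prodMap
    (Completion.isDenseInducing_toCompl (PreBase X φ))).extend
      fun p : PreBase X φ × PreBase X φ => inner' p.1 p.2)
  exact (Completion.isDenseInducing_toCompl _).extend_Z_bilin
    (Completion.isDenseInducing_toCompl _) this

lemma continuous_baseChange_inner' {α : Type*} [TopologicalSpace α] {f g : α → BaseChange X φ}
    (hf : Continuous f) (hg : Continuous g) : Continuous fun z => inner Cᵐᵒᵖ (f z) (g z) :=
  continuous_baseChange_inner.comp (hf.prodMk hg)

lemma baseChange_norm (z : BaseChange X φ) : ‖z‖ = √‖inner Cᵐᵒᵖ z z‖ := by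
  induction z using Completion.induction_on with
  | hp =>
    exact isClosed_eq continuous_norm
      (continuous_baseChange_inner' continuous_id continuous_id).norm.sqrt
  | ih s => rw [Completion.norm_coe, baseChange_inner_coe]; rfl

lemma baseChange_inner_add (r s t : BaseChange X φ) :
    inner Cᵐᵒᵖ r (s + t) = inner Cᵐᵒᵖ r s + inner Cᵐᵒᵖ r t := by
  induction r, s, t using Completion.induction_on₃ with
  | hp =>
    refine isClosed_eq (continuous_baseChange_inner' continuous_fst
      ((continuous_fst.comp continuous_snd).add (continuous_snd.comp continuous_snd))) ?_
    exact (continuous_baseChange_inner' continuous_fst (continuous_fst.comp continuous_snd)).add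
      (continuous_baseChange_inner' continuous_fst (continuous_snd.comp continuous_snd))
  | ih r s t =>
    rw [← Completion.coe_add, baseChange_inner_coe, baseChange_inner_coe, baseChange_inner_coe,
      map_add, MulOpposite.op_add]

lemma baseChange_inner_nonneg (s : BaseChange X φ) : 0 ≤ inner Cᵐᵒᵖ s s := by
  induction s using Completion.induction_on with
  | hp =>
    have h : IsClosed {c : C | 0 ≤ c} := CStarAlgebra.isClosed_nonneg
    exact h.preimage (MulOpposite.continuous_unop.comp
      (continuous_baseChange_inner' continuous_id continuous_id))
  | ih s =>
    rw [baseChange_inner_coe]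
    exact MulOpposite.op_nonneg.2 (baseForm_nonneg s)

lemma baseChange_inner_mul (c : Cᵐᵒᵖ) (s t : BaseChange X φ) :
    inner Cᵐᵒᵖ s (c • t) = c * inner Cᵐᵒᵖ s t := by
  induction s, t using Completion.induction_on₂ with
  | hp =>
    refine isClosed_eq (continuous_baseChange_inner' continuous_fst
      ((uniformContinuous_const_smul c).continuous.comp continuous_snd)) ?_
    exact continuous_const.mul (continuous_baseChange_inner' continuous_fst continuous_snd)
  | ih s t =>
    rw [← Completion.coe_smul, baseChange_inner_coe, baseChange_inner_coe, preBase_smul_def,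
      baseForm_mul_right]
    rfl

lemma baseChange_inner_smul (c : ℂ) (s t : BaseChange X φ) :
    inner Cᵐᵒᵖ s (c • t) = c • inner Cᵐᵒᵖ s t := by
  induction s, t using Completion.induction_on₂ with
  | hp =>
    refine isClosed_eq (continuous_baseChange_inner' continuous_fst
      ((uniformContinuous_const_smul c).continuous.comp continuous_snd)) ?_
    exact (continuous_const_smul c).comp
      (continuous_baseChange_inner' continuous_fst continuous_snd)
  | ih s t =>
    rw [← Completion.coe_smul, baseChange_inner_coe, baseChange_inner_coe, map_smul,
      MulOpposite.op_smul]

lemma baseChange_inner_star (s t : BaseChange X φ) :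
    star (inner Cᵐᵒᵖ s t) = inner Cᵐᵒᵖ t s := by
  induction s, t using Completion.induction_on₂ with
  | hp =>
    refine isClosed_eq ?_ (continuous_baseChange_inner' continuous_snd continuous_fst)
    exact continuous_star.comp (continuous_baseChange_inner' continuous_fst continuous_snd)
  | ih s t =>
    rw [baseChange_inner_coe, baseChange_inner_coe, ← baseForm_star s t]
    rfl

instance : CStarModule Cᵐᵒᵖ (BaseChange X φ) where
  inner_add_right {r s t} := baseChange_inner_add r s t
  inner_self_nonneg {s} := baseChange_inner_nonneg s
  inner_self {s} := by
    rw [← norm_eq_zero (a := s), baseChange_norm, Real.sqrt_eq_zero (norm_nonneg _), norm_eq_zero]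
  inner_op_smul_right {c s t} := baseChange_inner_mul c s t
  inner_smul_right_complex {c s t} := baseChange_inner_smul c s t
  star_inner s t := baseChange_inner_star s t
  norm_eq_sqrt_norm_inner_self s := baseChange_norm s

variable (X φ) in
/-- `π_X(a) ⊗ 1` as a continuous operator on `X ⊙ C`. -/
def preBaseActL (a : A) : PreBase X φ →L[ℂ] PreBase X φ :=
  LinearMap.mkContinuous (baseAct X φ a) ‖a‖ (norm_baseAct_le a)

variable (X φ) in
/-- `π_X(a) ⊗ 1` on `X ⊗_φ C`. -/
def baseActL (a : A) : BaseChange X φ →L[ℂ] BaseChange X φ := (preBaseActL X φ a).completion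

lemma baseActL_coe (a : A) (s : PreBase X φ) :
    baseActL X φ a (s : BaseChange X φ) = (baseAct X φ a s : BaseChange X φ) := by
  simp [baseActL, preBaseActL]

lemma baseChange_ext {f g : BaseChange X φ →L[ℂ] BaseChange X φ}
    (h : ∀ s : PreBase X φ, f s = g s) : f = g := by
  ext z
  induction z using UniformSpace.Completion.induction_on with
  | hp => exact isClosed_eq f.continuous g.continuous
  | ih s => exact h s

lemma baseActL_add (a b : A) : baseActL X φ (a + b) = baseActL X φ a + baseActL X φ b := by
  refine baseChange_ext fun s => ?_
  rw [add_apply, baseActL_coe, baseActL_coe, baseActL_coe, ← Completion.coe_add]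
  congr 1
  simp only [baseAct, map_add, TensorProduct.map_add_left]
  rfl

lemma baseActL_smul (c : ℂ) (a : A) : baseActL X φ (c • a) = c • baseActL X φ a := by
  refine baseChange_ext fun s => ?_
  rw [smul_apply, baseActL_coe, baseActL_coe, ← Completion.coe_smul]
  congr 1
  simp only [baseAct, map_smul, TensorProduct.map_smul_left]
  rfl

lemma baseActL_mul (a b : A) : baseActL X φ (a * b) = baseActL X φ a * baseActL X φ b := by
  refine baseChange_ext fun s => ?_
  rw [mul_apply_eq_comp, baseActL_coe, baseActL_coe, baseActL_coe]
  congr 1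
  have h := map_map_apply (X.act a) LinearMap.id (X.act b) (LinearMap.id (M := C)) s
  refine Eq.trans ?_ h.symm
  rw [baseAct, map_mul]
  rfl

lemma baseActL_inner (a : A) (s t : BaseChange X φ) :
    inner Cᵐᵒᵖ s (baseActL X φ a t) = inner Cᵐᵒᵖ (baseActL X φ (star a) s) t := by
  induction s, t using Completion.induction_on₂ with
  | hp =>
    exact isClosed_eq
      (continuous_baseChange_inner' continuous_fst
        ((baseActL X φ a).continuous.comp continuous_snd))
      (continuous_baseChange_inner' ((baseActL X φ (star a)).continuous.comp continuous_fst)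
        continuous_snd)
  | ih s t =>
    rw [baseActL_coe, baseActL_coe, baseChange_inner_coe, baseChange_inner_coe, baseForm_act]

variable (X φ) in
/-- The `A`-`C` correspondence `X ⊗_φ C` (also written `X ⊗_B C`), with left action
`π_X ⊗ 1`. -/
def baseChange : Corr.{u, x, max w x} A C where
  carrier := BaseChange X φ
  act :=
    { toFun := fun a => (baseActL X φ a : BaseChange X φ →ₗ[ℂ] BaseChange X φ)
      map_smul' := fun c a => by rw [baseActL_smul]; rfl
      map_zero' := by
        have := baseActL_smul (X := X) (φ := φ) 0 0
        rw [zero_smul, zero_smul] at this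
        rw [this]
        rfl
      map_add' := fun a b => by rw [baseActL_add]; rfl
      map_mul' := fun a b => by rw [baseActL_mul]; rfl }
  rinner_act a ξ η := congrArg MulOpposite.unop (baseActL_inner a ξ η)

end BaseChange

section VonNeumann

variable {H : Type x} [NormedAddCommGroup H] [InnerProductSpace ℂ H] [CompleteSpace H]

variable (H) in
/-- The σ-weak (ultraweak) topology on `B(H)`: the coarsest topology making all functionals
`T ↦ ∑ₙ ⟨ξₙ, T ηₙ⟩` with `∑ ‖ξₙ‖² < ∞` and `∑ ‖ηₙ‖² < ∞` continuous. -/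
@[reducible] def sigmaWeak : TopologicalSpace (H →L[ℂ] H) :=
  ⨅ p : {p : (ℕ → H) × (ℕ → H) //
      Summable (fun n => ‖p.1 n‖ ^ 2) ∧ Summable (fun n => ‖p.2 n‖ ^ 2)},
    TopologicalSpace.induced
      (fun T : H →L[ℂ] H => ∑' n, inner ℂ (p.1.1 n) (T (p.1.2 n))) inferInstance

/-- The underlying C⋆-algebra of a von Neumann algebra `M ⊆ B(H)`. -/
def VN (M : VonNeumannAlgebra H) : Type x := M.toStarSubalgebra

instance (M : VonNeumannAlgebra H) : IsClosed (M.toStarSubalgebra : Set (H →L[ℂ] H)) := by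
  have : (M.toStarSubalgebra : Set (H →L[ℂ] H)) =
      Set.centralizer (Set.centralizer (M : Set (H →L[ℂ] H))) :=
    M.centralizer_centralizer.symm
  rw [this]
  exact Set.isClosed_centralizer _

instance (M : VonNeumannAlgebra H) : CStarAlgebra (VN M) :=
  inferInstanceAs (CStarAlgebra M.toStarSubalgebra)

instance (M : VonNeumannAlgebra H) : PartialOrder (VN M) := CStarAlgebra.spectralOrder (VN M)

instance (M : VonNeumannAlgebra H) : StarOrderedRing (VN M) :=
  CStarAlgebra.spectralOrderedRing (VN M)

/-- The inclusion `M ⊆ B(H)`. -/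
def VN.incl (M : VonNeumannAlgebra H) : VN M →⋆ₐ[ℂ] (H →L[ℂ] H) := M.toStarSubalgebra.subtype

/-- The σ-weak topology of `M`. -/
@[reducible] def VN.sigmaWeak (M : VonNeumannAlgebra H) : TopologicalSpace (VN M) :=
  TopologicalSpace.induced (VN.incl M) (CStarCorr.sigmaWeak H)

/-- Faithful normal (nondegenerate) representations of `M`. -/
structure IsFaithfulNormal {M : VonNeumannAlgebra H} {K : Type y} [NormedAddCommGroup K]
    [InnerProductSpace ℂ K] [CompleteSpace K] (σ : VN M →⋆ₙₐ[ℂ] (K →L[ℂ] K)) : Prop where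
  nondegenerate : Nondegenerate σ
  injective : Function.Injective σ
  normal : @Continuous _ _ (VN.sigmaWeak M) (CStarCorr.sigmaWeak K) σ

variable {A : Type u} [CStarAlgebra A] {M : VonNeumannAlgebra H}

/-- `X ≺ Y` for correspondences over a von Neumann algebra: weak containment with respect to any
faithful normal representation of `M`. -/
def VNWeaklyContained (X : Corr.{u, x, w} A (VN M)) (Y : Corr.{u, x, y} A (VN M)) : Prop :=
  ∀ (K : Type x) [NormedAddCommGroup K] [InnerProductSpace ℂ K] [CompleteSpace K]
    (σ : VN M →⋆ₙₐ[ℂ] (K →L[ℂ] K)), IsFaithfulNormal σ → WeaklyContained σ X Y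

/-- `X ≺ Y` for correspondences over a von Neumann algebra: weak containment with respect to some
faithful normal representation of `M`. -/
def VNWeaklyContainedSome (X : Corr.{u, x, w} A (VN M)) (Y : Corr.{u, x, y} A (VN M)) : Prop :=
  ∃ (K : Type x) (_ : NormedAddCommGroup K) (_ : InnerProductSpace ℂ K) (_ : CompleteSpace K)
    (σ : VN M →⋆ₙₐ[ℂ] (K →L[ℂ] K)), IsFaithfulNormal σ ∧ WeaklyContained σ X Y

variable {B : Type v} [NonUnitalCStarAlgebra B]

/-- The von Neumann algebra `M = π(B)''`. -/
def bicommutant (π : B →⋆ₙₐ[ℂ] (H →L[ℂ] H)) : VonNeumannAlgebra H where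
  toStarSubalgebra := StarSubalgebra.centralizer ℂ (commutant π : Set (H →L[ℂ] H))
  centralizer_centralizer' := by simp

lemma mem_bicommutant (π : B →⋆ₙₐ[ℂ] (H →L[ℂ] H)) (b : B) :
    π b ∈ (bicommutant π).toStarSubalgebra := by
  refine (StarSubalgebra.mem_centralizer_iff ℂ).mpr fun T hT => ⟨?_, ?_⟩
  · exact (mem_commutant.mp hT b).symm
  · exact (mem_commutant.mp (star_mem hT) b).symm

/-- `π` as a ⋆-homomorphism into `M = π(B)''`. -/
def toBicommutant (π : B →⋆ₙₐ[ℂ] (H →L[ℂ] H)) : B →⋆ₙₐ[ℂ] VN (bicommutant π) where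
  toFun b := ⟨π b, mem_bicommutant π b⟩
  map_smul' c b := Subtype.ext (map_smul π c b)
  map_zero' := Subtype.ext (map_zero π)
  map_add' b c := Subtype.ext (map_add π b c)
  map_mul' b c := Subtype.ext (map_mul π b c)
  map_star' b := Subtype.ext (map_star π b)

end VonNeumann

section Universal

variable (B : Type v) [NonUnitalCStarAlgebra B] [PartialOrder B] [StarOrderedRing B]

/-- The states of `B`: positive functionals of norm one. -/
def State : Type v :=
  {f : B →ₚ[ℂ] ℂ // IsLUB ((fun b : B => ‖f b‖) '' Metric.closedBall 0 1) 1}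

/-- The Hilbert space of the universal representation: the `ℓ²`-direct sum of the GNS spaces of
all states. -/
abbrev UnivSpace : Type v := lp (fun f : State B => f.1.GNS) 2

variable {B}

lemma norm_gns_le (f : B →ₚ[ℂ] ℂ) (b : B) : ‖f.gnsNonUnitalStarAlgHom b‖ ≤ ‖b‖ :=
  NonUnitalStarAlgHom.norm_apply_le _ _

variable (B) in
/-- The universal representation of `B`: the direct sum of the GNS representations of all
states. -/
def universalRep : B →⋆ₙₐ[ℂ] (UnivSpace B →L[ℂ] UnivSpace B) where
  toFun b := lp.mapCLM 2 (fun f : State B => f.1.gnsNonUnitalStarAlgHom b) (norm_nonneg b)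
    (fun f => norm_gns_le f.1 b)
  map_smul' c b := by
    ext z f
    exact congr($(map_smul f.1.gnsNonUnitalStarAlgHom c b) (z f))
  map_zero' := by
    ext z f
    exact congr($(map_zero f.1.gnsNonUnitalStarAlgHom) (z f))
  map_add' b c := by
    ext z f
    exact congr($(map_add f.1.gnsNonUnitalStarAlgHom b c) (z f))
  map_mul' b c := by
    ext z f
    exact congr($(map_mul f.1.gnsNonUnitalStarAlgHom b c) (z f))
  map_star' b := by
    rw [ContinuousLinearMap.star_eq_adjoint, ContinuousLinearMap.eq_adjoint_iff]
    intro s t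
    rw [lp.inner_eq_tsum, lp.inner_eq_tsum]
    refine tsum_congr fun f => ?_
    simp only [lp.mapCLM_apply_coe, map_star, ContinuousLinearMap.star_eq_adjoint,
      ContinuousLinearMap.adjoint_inner_left]

end Universal

section Coefficients

variable {A : Type u} {B : Type v} [CStarAlgebra A] [NonUnitalCStarAlgebra B]
  [PartialOrder B] [StarOrderedRing B]

/-- The coefficient `Ω_ξ(a) = ⟨ξ, π_X(a) ξ⟩`. -/
def coeff (X : Corr.{u, v, w} A B) (ξ : X.carrier) : A → B := fun a => rinner B ξ (X.act a ξ)

/-- `F_Y`, the convex hull of the coefficients `Ω_η`, `η ∈ Y`. -/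
def coeffHull (Y : Corr.{u, v, w} A B) : Set (A → B) := convexHull ℝ (Set.range (coeff Y))

end Coefficients

end CStarCorr

end

noncomputable section

namespace CStarCorr

open scoped TensorProduct ComplexOrder InnerProductSpace

set_option linter.unusedSectionVars false

/-! ### The maximal tensor product as a C⋆-algebra. -/

section MaxTensorCStar

open UniformSpace

variable {A : Type u} {N : Type v} [CStarAlgebra A] [CStarAlgebra N]

/-! Kernel inclusion is turned into approximation of coefficients by Hahn–Banach separation, and
approximation is turned back into kernel inclusion by an argument in the style of Fell.

From weak containment to strong approximation (`WeaklyContained.strong_approx`): if `Ω_ξ` were not a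
point-strong limit of the cone `F_Y`, a functional `ψ ↦ ∑ ⟨g_p, π(ψ(a_p)) k_p⟩` would have
nonpositive real part on `F_Y` and positive real part at `Ω_ξ`. On coefficients `Ω_η` it is the
quadratic form of a matrix over `A ⊗_max π(B)'` at the tuple `(η ⊗ h_i)`, where `h` lists the
vectors `g_p` and `k_p`. The projection onto the closure of `π(B)h` is a matrix over `π(B)'`
(`exists_commutant_projection`). Compressing by it makes the real part of the form nonpositive on
all tuples of `Y ⊗_B H`. Matrix positivity passes from `θ_Y` to `θ_X` because `ker θ_Y ⊆ ker θ_X`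
(`matForm_nonneg_transfer`, by functional calculus in matrices over the maximal tensor product), and
this is a contradiction.

Domination `ψ(1) ≤ Ω_ξ(1)` is arranged by conjugating with `q = 2(1 + ψ(1))⁻¹ s`, where `s =
Ω_ξ(1)^{1/2}`. The scalar inequality `4c/(1 + c)² ≤ 1` gives the bound. The approximation survives
because strong convergence of `ψ(1)` controls the resolvents, provided that `ξ` is first replaced by
a vector `ξu` with `u Ω_ξ(1) u` close to `1` on most of the spectrum (`exists_regularization`,
`exists_cutdown`). Domination bounds the net, so weak operator convergence becomes σ-weak.

Conversely, if the vector functionals of a total set of vectors for `θ_X` are limits of sums of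
vector functionals of `θ_Y`, then `‖θ_X(z)‖ ≤ ‖θ_Y(z)‖` (`norm_le_of_vector_approx`).

For the base change to `M = π(B)''`, normality carries σ-weak convergence from `H` to `K`, which
gives the passage to `X ⊗_B M`. In the other direction, the dominated net over `M` is bounded, hence
its convergence on `K` reflects to `H` by compactness and faithfulness; the double commutant theorem
then replaces coefficients of `Y ⊗_B M` by coefficients of `Y`.

In the universal representation weak operator convergence is weak convergence, since bounded
functionals are combinations of positive ones. Convexity of `F_Y` upgrades weak to norm
approximation, and the same cutdown, uniform on the unit ball, restores domination. -/

lemma isCStarSeminorm_zero : IsCStarSeminorm (0 : Seminorm ℂ (A ⊗[ℂ] N)) :=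
  ⟨fun _ _ => by simp, fun _ => by simp⟩

lemma maxSeminorm_apply (z : A ⊗[ℂ] N) :
    maxSeminorm A N z = ⨆ p : {p : Seminorm ℂ (A ⊗[ℂ] N) | IsCStarSeminorm p},
      (p : Seminorm ℂ (A ⊗[ℂ] N)) z :=
  Seminorm.sSup_apply (bddAbove_cstarSeminorm A N)

lemma maxSeminorm_le {z : A ⊗[ℂ] N} {c : ℝ}
    (h : ∀ p : Seminorm ℂ (A ⊗[ℂ] N), IsCStarSeminorm p → p z ≤ c) : maxSeminorm A N z ≤ c := by
  have : Nonempty {p : Seminorm ℂ (A ⊗[ℂ] N) | IsCStarSeminorm p} := ⟨⟨0, isCStarSeminorm_zero⟩⟩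
  rw [maxSeminorm_apply]
  exact ciSup_le fun p => h p.1 p.2

variable (A N) in
/-- The maximal C⋆-seminorm is a C⋆-seminorm. -/
lemma isCStarSeminorm_max : IsCStarSeminorm (maxSeminorm A N) := by
  have hmul : ∀ y z : A ⊗[ℂ] N, maxSeminorm A N (y * z) ≤ maxSeminorm A N y * maxSeminorm A N z :=
    fun y z => maxSeminorm_le fun p hp => (hp.1 y z).trans <|
      mul_le_mul (le_maxSeminorm hp y) (le_maxSeminorm hp z) (apply_nonneg _ _) (apply_nonneg _ _)
  refine ⟨hmul, fun z => le_antisymm (maxSeminorm_le fun p hp => ?_) ?_⟩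
  · rw [hp.2]
    exact pow_le_pow_left₀ (apply_nonneg _ _) (le_maxSeminorm hp z) 2
  · rw [← Real.le_sqrt (apply_nonneg _ _) (apply_nonneg _ _)]
    refine maxSeminorm_le fun p hp => Real.le_sqrt_of_sq_le ?_
    rw [← hp.2]
    exact le_maxSeminorm hp _

/-- The C⋆-identity and submultiplicativity give `p(z)² ≤ p(z*) p(z)`; cancel `p(z)` and apply the
result to `z*` as well. -/
lemma IsCStarSeminorm.map_star {R : Type*} [Ring R] [StarRing R] [Module ℂ R] {p : Seminorm ℂ R}
    (hp : IsCStarSeminorm p) (z : R) : p (star z) = p z := by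
  have key : ∀ z, p z ≤ p (star z) := by
    intro z
    rcases eq_or_lt_of_le (apply_nonneg p z) with h | h
    · rw [← h]; exact apply_nonneg _ _
    have := hp.1 (star z) z
    rw [hp.2, sq] at this
    exact le_of_mul_le_mul_right this h
  refine le_antisymm ?_ (key z)
  simpa using key (star z)

instance : Ring (PreMaxTensor A N) := inferInstanceAs (Ring (A ⊗[ℂ] N))

instance : StarRing (PreMaxTensor A N) := inferInstanceAs (StarRing (A ⊗[ℂ] N))

instance : SeminormedRing (PreMaxTensor A N) where
  __ := (inferInstance : SeminormedAddCommGroup (PreMaxTensor A N))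
  __ := (inferInstance : Ring (PreMaxTensor A N))
  norm_mul_le := (isCStarSeminorm_max A N).1

lemma preMaxTensor_norm_star (z : PreMaxTensor A N) : ‖star z‖ = ‖z‖ :=
  (isCStarSeminorm_max A N).map_star z

lemma preMaxTensor_norm_star_mul_self (z : PreMaxTensor A N) : ‖star z * z‖ = ‖z‖ * ‖z‖ := by
  rw [← sq]
  exact (isCStarSeminorm_max A N).2 z

lemma preMaxTensor_smul_mul (c : ℂ) (y z : PreMaxTensor A N) : c • y * z = c • (y * z) :=
  smul_mul_assoc (α := ℂ) (β := A ⊗[ℂ] N) c y z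

lemma preMaxTensor_mul_smul (c : ℂ) (y z : PreMaxTensor A N) : y * c • z = c • (y * z) :=
  mul_smul_comm (α := ℂ) (β := A ⊗[ℂ] N) c y z

lemma preMaxTensor_star_smul (c : ℂ) (z : PreMaxTensor A N) : star (c • z) = star c • star z :=
  star_smul (R := ℂ) (A := A ⊗[ℂ] N) c z

lemma uniformContinuous_preMaxTensor_star :
    UniformContinuous (star : PreMaxTensor A N → PreMaxTensor A N) := by
  refine (LipschitzWith.of_dist_le_mul (K := 1) fun y z => ?_).uniformContinuous
  rw [dist_eq_norm, dist_eq_norm, ← star_sub, preMaxTensor_norm_star]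
  simp

instance : Star (MaxTensor A N) := ⟨Completion.map star⟩

lemma maxTensor_star_coe (z : PreMaxTensor A N) :
    star (z : MaxTensor A N) = ((star z : PreMaxTensor A N) : MaxTensor A N) :=
  Completion.map_coe uniformContinuous_preMaxTensor_star z

lemma continuous_maxTensor_star : Continuous (star : MaxTensor A N → MaxTensor A N) :=
  Completion.continuous_map

instance : StarRing (MaxTensor A N) where
  star_involutive z := by
    induction z using Completion.induction_on with
    | hp =>
      exact isClosed_eq (f := fun z : MaxTensor A N => star (star z)) (g := id)
        (continuous_maxTensor_star.comp continuous_maxTensor_star) continuous_id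
    | ih z => rw [maxTensor_star_coe, maxTensor_star_coe, star_star]
  star_mul y z := by
    induction y, z using Completion.induction_on₂ with
    | hp =>
      exact isClosed_eq (continuous_maxTensor_star.comp (by fun_prop))
        ((continuous_maxTensor_star.comp continuous_snd).mul
          (continuous_maxTensor_star.comp continuous_fst))
    | ih y z =>
      rw [← Completion.coe_mul, maxTensor_star_coe, maxTensor_star_coe, maxTensor_star_coe,
        ← Completion.coe_mul, star_mul]
  star_add y z := by
    induction y, z using Completion.induction_on₂ with
    | hp =>
      exact isClosed_eq (continuous_maxTensor_star.comp (by fun_prop))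
        ((continuous_maxTensor_star.comp continuous_fst).add
          (continuous_maxTensor_star.comp continuous_snd))
    | ih y z =>
      rw [← Completion.coe_add, maxTensor_star_coe, maxTensor_star_coe, maxTensor_star_coe,
        ← Completion.coe_add, star_add]

lemma continuous_maxTensor_smul (c : ℂ) : Continuous fun z : MaxTensor A N => c • z :=
  (Completion.uniformContinuous_map (f := fun z : PreMaxTensor A N => c • z)).continuous

lemma maxTensor_smul_mul (c : ℂ) (y z : MaxTensor A N) : c • y * z = c • (y * z) := by
  induction y, z using Completion.induction_on₂ with
  | hp =>
    exact isClosed_eq (((continuous_maxTensor_smul c).comp continuous_fst).mul continuous_snd)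
      ((continuous_maxTensor_smul c).comp (continuous_fst.mul continuous_snd))
  | ih y z =>
    rw [← Completion.coe_smul, ← Completion.coe_mul, ← Completion.coe_mul, ← Completion.coe_smul,
      preMaxTensor_smul_mul]

lemma maxTensor_mul_smul (c : ℂ) (y z : MaxTensor A N) : y * c • z = c • (y * z) := by
  induction y, z using Completion.induction_on₂ with
  | hp =>
    exact isClosed_eq (continuous_fst.mul ((continuous_maxTensor_smul c).comp continuous_snd))
      ((continuous_maxTensor_smul c).comp (continuous_fst.mul continuous_snd))
  | ih y z =>
    rw [← Completion.coe_smul, ← Completion.coe_mul, ← Completion.coe_mul, ← Completion.coe_smul,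
      preMaxTensor_mul_smul]

instance : Algebra ℂ (MaxTensor A N) := Algebra.ofModule maxTensor_smul_mul maxTensor_mul_smul

instance : NormedAlgebra ℂ (MaxTensor A N) where
  norm_smul_le := norm_smul_le

instance : CStarRing (MaxTensor A N) where
  norm_mul_self_le z := by
    refine le_of_eq ?_
    induction z using Completion.induction_on with
    | hp =>
      exact isClosed_eq (by fun_prop) (continuous_maxTensor_star.mul continuous_id).norm
    | ih z =>
      rw [maxTensor_star_coe, ← Completion.coe_mul, Completion.norm_coe, Completion.norm_coe,
        preMaxTensor_norm_star_mul_self]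

instance : StarModule ℂ (MaxTensor A N) where
  star_smul c z := by
    induction z using Completion.induction_on with
    | hp =>
      exact isClosed_eq (continuous_maxTensor_star.comp (continuous_maxTensor_smul c))
        ((continuous_maxTensor_smul _).comp continuous_maxTensor_star)
    | ih z =>
      rw [← Completion.coe_smul, maxTensor_star_coe, maxTensor_star_coe, ← Completion.coe_smul,
        preMaxTensor_star_smul]

/-- The maximal tensor product is a C⋆-algebra. -/
instance : CStarAlgebra (MaxTensor A N) where

end MaxTensorCStar

/-! ### Multiplicativity of `θ` and domination of norms. -/

section ThetaHom

open UniformSpace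

variable {A : Type u} {B : Type v} [CStarAlgebra A] [NonUnitalCStarAlgebra B]
  [PartialOrder B] [StarOrderedRing B]
  {H : Type x} [NormedAddCommGroup H] [InnerProductSpace ℂ H] [CompleteSpace H]
  {X : Corr.{u, v, w} A B} {π : B →⋆ₙₐ[ℂ] (H →L[ℂ] H)}

lemma theta_mul (y z : MaxTensor A (commutant π)) :
    theta X π (y * z) = theta X π y * theta X π z := by
  induction y, z using Completion.induction_on₂ with
  | hp =>
    exact isClosed_eq ((theta X π).continuous.comp (continuous_fst.mul continuous_snd))
      (((theta X π).continuous.comp continuous_fst).mul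
        ((theta X π).continuous.comp continuous_snd))
  | ih y z =>
    rw [← Completion.coe_mul, theta_coe, theta_coe, theta_coe]
    exact thetaAlg_mul y z

lemma theta_star (z : MaxTensor A (commutant π)) :
    theta X π (star z) = star (theta X π z) := by
  induction z using Completion.induction_on with
  | hp =>
    exact isClosed_eq ((theta X π).continuous.comp continuous_maxTensor_star)
      (continuous_star.comp (theta X π).continuous)
  | ih z =>
    rw [maxTensor_star_coe, theta_coe, theta_coe]
    exact thetaAlg_star z

/-- Weak containment follows from domination of the seminorms on the algebraic tensor product. -/
lemma weaklyContained_of_norm_le {Y : Corr.{u, v, y} A B}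
    (h : ∀ z : A ⊗[ℂ] commutant π, ‖thetaAlg X π z‖ ≤ ‖thetaAlg Y π z‖) :
    WeaklyContained π X Y := by
  have key : ∀ z : MaxTensor A (commutant π), ‖theta X π z‖ ≤ ‖theta Y π z‖ := by
    intro z
    induction z using Completion.induction_on with
    | hp => exact isClosed_le (theta X π).continuous.norm (theta Y π).continuous.norm
    | ih z =>
      rw [theta_coe, theta_coe]
      exact h z
  intro z hz
  have := key z
  rw [hz, norm_zero] at this
  exact norm_le_zero_iff.mp this

end ThetaHom

/-- Here `p` is the negative part of `a` and `g* g = p`. Compressing `a` by `p` leaves minus a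
square, so a representation in which `a` is positive must kill `g p`, hence `p³`. -/
lemma exists_posPart_negPart_witness {D : Type*} [NonUnitalCStarAlgebra D] [PartialOrder D]
    [StarOrderedRing D] (a : D) (ha : IsSelfAdjoint a) :
    ∃ q p g : D, a = star q * q - p ∧ star p = p ∧ star (g * p) * (g * p) = p * p * p ∧
      star p * a * p = -(star (g * p) * (g * p)) := by
  have hp0 : 0 ≤ a⁻ := CFC.negPart_nonneg a
  have hps : star a⁻ = a⁻ := (IsSelfAdjoint.of_nonneg hp0).star_eq
  obtain ⟨g, hg⟩ := exists_eq_star_mul_self hp0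
  obtain ⟨q, hq⟩ := exists_eq_star_mul_self (CFC.posPart_nonneg a)
  have h : star (g * a⁻) * (g * a⁻) = a⁻ * a⁻ * a⁻ := by
    conv_rhs => enter [1, 2]; rw [hg]
    rw [star_mul, hps]
    simp only [mul_assoc]
  refine ⟨q, a⁻, g, ?_, hps, h, ?_⟩
  · rw [← hq, CFC.posPart_sub_negPart a ha]
  · rw [h, hps]
    nth_rewrite 2 [← CFC.posPart_sub_negPart a ha]
    rw [mul_sub, CFC.negPart_mul_posPart, zero_sub, neg_mul]

/-! ### Matrices over a represented C⋆-algebra and transfer of positivity. -/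

section MatrixRep

variable {D : Type*} [CStarAlgebra D] {ι : Type*} [Fintype ι]
  {K : Type*} [NormedAddCommGroup K] [InnerProductSpace ℂ K] [CompleteSpace K]

/-- The action on `Kⁿ` of a matrix over an algebra represented on `K`. -/
def matAct (ρ : D →⋆ₙₐ[ℂ] (K →L[ℂ] K)) (W : CStarMatrix ι ι D) (v : ι → K) : ι → K :=
  fun i => ∑ j, ρ (W i j) (v j)

/-- The quadratic form on `Kⁿ` of a matrix over an algebra represented on `K`. -/
def matForm (ρ : D →⋆ₙₐ[ℂ] (K →L[ℂ] K)) (Z : CStarMatrix ι ι D) (v : ι → K) : ℂ :=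
  ∑ i, inner ℂ (v i) (matAct ρ Z v i)

variable {ρ : D →⋆ₙₐ[ℂ] (K →L[ℂ] K)}

lemma matAct_mul (V W : CStarMatrix ι ι D) (v : ι → K) :
    matAct ρ (V * W) v = matAct ρ V (matAct ρ W v) := by
  ext i
  simp only [matAct, CStarMatrix.mul_apply, map_sum, map_mul, sum_apply,
    mul_apply_eq_comp]
  exact Finset.sum_comm

lemma inner_matAct_star (W : CStarMatrix ι ι D) (v w : ι → K) :
    ∑ i, inner ℂ (v i) (matAct ρ (star W) w i) = ∑ i, inner ℂ (matAct ρ W v i) (w i) := by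
  simp only [matAct, CStarMatrix.star_apply, map_star, inner_sum, sum_inner,
    ContinuousLinearMap.star_eq_adjoint, ContinuousLinearMap.adjoint_inner_right]
  exact Finset.sum_comm

lemma matForm_conj (W Z : CStarMatrix ι ι D) (v : ι → K) :
    matForm ρ (star W * Z * W) v = matForm ρ Z (matAct ρ W v) := by
  rw [matForm, mul_assoc, matAct_mul, matAct_mul, inner_matAct_star]
  rfl

lemma matForm_star_mul_self (W : CStarMatrix ι ι D) (v : ι → K) :
    matForm ρ (star W * W) v = ((∑ i, ‖matAct ρ W v i‖ ^ 2 : ℝ) : ℂ) := by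
  rw [matForm, matAct_mul, inner_matAct_star]
  simp [inner_self_eq_norm_sq_to_K]

lemma matForm_add (Y Z : CStarMatrix ι ι D) (v : ι → K) :
    matForm ρ (Y + Z) v = matForm ρ Y v + matForm ρ Z v := by
  simp [matForm, matAct, Finset.sum_add_distrib]

lemma matForm_neg (Z : CStarMatrix ι ι D) (v : ι → K) :
    matForm ρ (-Z) v = -matForm ρ Z v := by
  simp [matForm, matAct, inner_sum]

lemma matForm_star (Z : CStarMatrix ι ι D) (v : ι → K) :
    matForm ρ (star Z) v = star (matForm ρ Z v) := by
  rw [matForm, inner_matAct_star, matForm, star_sum]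
  simp

lemma matForm_eq_zero {Z : CStarMatrix ι ι D} (h : ∀ i j, ρ (Z i j) = 0) (v : ι → K) :
    matForm ρ Z v = 0 := by
  simp [matForm, matAct, h]

/-- The form of `W* W` at `v` is `‖W v‖²`; tuples supported in the single slot `j` isolate the
entries of the `j`-th column. -/
lemma apply_eq_zero_of_matForm {W : CStarMatrix ι ι D}
    (h : ∀ v : ι → K, (matForm ρ (star W * W) v).re ≤ 0) (i j : ι) : ρ (W i j) = 0 := by
  classical
  ext k
  have := h (Pi.single j k)
  rw [matForm_star_mul_self, Complex.ofReal_re] at this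
  have h2 := (Finset.sum_eq_zero_iff_of_nonneg (fun i _ => by positivity)).mp
    (le_antisymm this (Finset.sum_nonneg fun i _ => by positivity)) i (Finset.mem_univ i)
  have h3 : matAct ρ W (Pi.single j k) i = 0 := by simpa using h2
  rw [matAct, Finset.sum_eq_single j] at h3
  · simpa using h3
  · intro l _ hl
    simp [Pi.single_eq_of_ne hl]
  · simp

lemma apply_mul_eq_zero {V W : CStarMatrix ι ι D} (h : ∀ i j, ρ (V i j) = 0) (i j : ι) :
    ρ ((W * V) i j) = 0 := by
  simp [CStarMatrix.mul_apply, h]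

/-- If the kernel of `ρ₂` is contained in that of `ρ₁`, positivity of a matrix in `ρ₂` implies
positivity in `ρ₁`. -/
lemma matForm_nonneg_transfer {K₁ K₂ : Type*} [NormedAddCommGroup K₁] [InnerProductSpace ℂ K₁]
    [CompleteSpace K₁] [NormedAddCommGroup K₂] [InnerProductSpace ℂ K₂] [CompleteSpace K₂]
    {ρ₁ : D →⋆ₙₐ[ℂ] (K₁ →L[ℂ] K₁)} {ρ₂ : D →⋆ₙₐ[ℂ] (K₂ →L[ℂ] K₂)}
    (hker : ∀ d, ρ₂ d = 0 → ρ₁ d = 0) {Z : CStarMatrix ι ι D} (hZ : IsSelfAdjoint Z)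
    (hpos : ∀ w : ι → K₂, 0 ≤ (matForm ρ₂ Z w).re) (v : ι → K₁) :
    0 ≤ (matForm ρ₁ Z v).re := by
  classical
  let _ : PartialOrder D := CStarAlgebra.spectralOrder D
  have _ : StarOrderedRing D := CStarAlgebra.spectralOrderedRing D
  obtain ⟨q, P, g, hZq, hPs, hPPP, hPZP⟩ := exists_posPart_negPart_witness Z hZ
  -- Testing positivity on tuples of the form `P w` forces `‖g P w‖² ≤ 0`.
  have h2 : ∀ i j, ρ₂ ((g * P) i j) = 0 := by
    refine apply_eq_zero_of_matForm fun w => ?_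
    have := hpos (matAct ρ₂ P w)
    rw [← matForm_conj, hPZP, matForm_neg, Complex.neg_re] at this
    linarith
  have h3 : ∀ i j, ρ₁ ((P * P * P) i j) = 0 := by
    rw [← hPPP]
    exact apply_mul_eq_zero fun i j => hker _ (h2 i j)
  -- From `P³` one descends to `P²` and then to `P`, because `P⁴ = (P²)* P²` and `P² = P* P`. Only
  -- the square `q* q` remains in `ρ₁`.
  have h4 : ∀ i j, ρ₁ ((P * P) i j) = 0 := by
    refine apply_eq_zero_of_matForm fun w => le_of_eq ?_
    have e : star (P * P) * (P * P) = P * (P * P * P) := by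
      rw [star_mul, hPs]; simp only [mul_assoc]
    rw [e, matForm_eq_zero (apply_mul_eq_zero h3)]
    rfl
  have h5 : ∀ i j, ρ₁ (P i j) = 0 := by
    refine apply_eq_zero_of_matForm fun w => le_of_eq ?_
    rw [hPs, matForm_eq_zero h4]
    rfl
  rw [hZq, sub_eq_add_neg, matForm_add, matForm_neg,
    matForm_eq_zero h5, matForm_star_mul_self, neg_zero, add_zero, Complex.ofReal_re]
  exact Finset.sum_nonneg fun i _ => by positivity

end MatrixRep

/-! ### `θ` as a ⋆-homomorphism. -/

section ThetaHom

variable {A : Type u} {B : Type v} [CStarAlgebra A] [NonUnitalCStarAlgebra B]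
  [PartialOrder B] [StarOrderedRing B]
  {H : Type x} [NormedAddCommGroup H] [InnerProductSpace ℂ H] [CompleteSpace H]

variable (X : Corr.{u, v, w} A B) (π : B →⋆ₙₐ[ℂ] (H →L[ℂ] H)) in
/-- `θ_X^H` as a ⋆-homomorphism on the C⋆-algebra `A ⊗_max π(B)'`. -/
def thetaHom : MaxTensor A (commutant π) →⋆ₙₐ[ℂ] (IntTensor X π →L[ℂ] IntTensor X π) where
  toFun := theta X π
  map_smul' c z := map_smul (theta X π) c z
  map_zero' := map_zero (theta X π)
  map_add' := map_add (theta X π)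
  map_mul' := theta_mul
  map_star' := theta_star

end ThetaHom

/-! ### Cyclic projections and the double commutant theorem. -/

section CyclicProjection

variable {B : Type v} [NonUnitalCStarAlgebra B]
  {H : Type x} [NormedAddCommGroup H] [InnerProductSpace ℂ H] [CompleteSpace H]
  {ι : Type*} [Fintype ι]

lemma starProjection_commute {E : Type*} [NormedAddCommGroup E] [InnerProductSpace ℂ E]
    [CompleteSpace E] (K : Submodule ℂ E) [K.HasOrthogonalProjection] (T : E →L[ℂ] E)
    (h : ∀ z ∈ K, T z ∈ K) (h' : ∀ z ∈ K, ContinuousLinearMap.adjoint T z ∈ K) (z : E) :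
    K.starProjection (T z) = T (K.starProjection z) := by
  refine ext_inner_left ℂ fun t => ?_
  have h1 : K.starProjection (T (K.starProjection z)) = T (K.starProjection z) :=
    Submodule.starProjection_eq_self_iff.mpr (h _ (Submodule.starProjection_apply_mem K z))
  have h2 : K.starProjection (ContinuousLinearMap.adjoint T (K.starProjection t))
      = ContinuousLinearMap.adjoint T (K.starProjection t) :=
    Submodule.starProjection_eq_self_iff.mpr (h' _ (Submodule.starProjection_apply_mem K t))
  rw [← h1, ← Submodule.inner_starProjection_left_eq_right,
    ← Submodule.inner_starProjection_left_eq_right,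
    ← ContinuousLinearMap.adjoint_inner_left, ← ContinuousLinearMap.adjoint_inner_left,
    ← Submodule.inner_starProjection_left_eq_right, h2]

/-- The diagonal amplification of an operator. -/
def diagOp (ι : Type*) [Fintype ι] (T : H →L[ℂ] H) :
    PiLp 2 (fun _ : ι => H) →L[ℂ] PiLp 2 (fun _ : ι => H) :=
  ((PiLp.continuousLinearEquiv 2 ℂ (fun _ : ι => H)).symm :
      (ι → H) →L[ℂ] PiLp 2 (fun _ : ι => H)) ∘L
    ContinuousLinearMap.pi fun i => T ∘L PiLp.proj 2 (fun _ : ι => H) i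

lemma diagOp_apply (T : H →L[ℂ] H) (z : PiLp 2 (fun _ : ι => H)) (i : ι) :
    diagOp ι T z i = T (z i) := rfl

lemma adjoint_diagOp (T : H →L[ℂ] H) :
    ContinuousLinearMap.adjoint (diagOp ι T) = diagOp ι (ContinuousLinearMap.adjoint T) := by
  symm
  rw [ContinuousLinearMap.eq_adjoint_iff]
  intro s t
  simp only [PiLp.inner_apply, diagOp_apply, ContinuousLinearMap.adjoint_inner_left]

lemma eq_zero_of_forall_rep_eq_zero {π : B →⋆ₙₐ[ℂ] (H →L[ℂ] H)} (hπ : Nondegenerate π) {g : H}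
    (h : ∀ b, π b g = 0) : g = 0 := by
  refine hπ.eq_zero_of_inner_left ℂ fun {z} hv => ?_
  induction hv using Submodule.span_induction with
  | mem z hz =>
    obtain ⟨b, k, rfl⟩ := hz
    rw [← ContinuousLinearMap.adjoint_inner_left, ← ContinuousLinearMap.star_eq_adjoint,
      ← map_star, h, inner_zero_left]
  | zero => simp
  | add y z _ _ hy hz => rw [inner_add_right, hy, hz, add_zero]
  | smul c z _ hz => rw [inner_smul_right, hz, mul_zero]

/-- The projection onto the cyclic subspace generated by `h ∈ Hⁿ` is a matrix over the
commutant. -/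
lemma exists_commutant_projection {π : B →⋆ₙₐ[ℂ] (H →L[ℂ] H)} (hπ : Nondegenerate π) (h : ι → H) :
    ∃ E : ι → ι → commutant π, (∀ i, ∑ j, (E i j).1 (h j) = h i) ∧
      ∀ k : ι → H, (fun i => ∑ j, (E i j).1 (k j)) ∈
        closure (Set.range fun (b : B) (i : ι) => π b (h i)) := by
  classical
  let V := PiLp 2 (fun _ : ι => H)
  let e := PiLp.continuousLinearEquiv 2 ℂ (fun _ : ι => H)
  let L : B →ₗ[ℂ] V :=
    { toFun := fun b => e.symm fun i => π b (h i)
      map_add' := fun b c => by rw [← map_add]; congr 1; ext i; simp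
      map_smul' := fun c b => by rw [RingHom.id_apply, ← map_smul]; congr 1; ext i; simp }
  let K : Submodule ℂ V := (LinearMap.range L).topologicalClosure
  have hK : IsClosed (K : Set V) := Submodule.isClosed_topologicalClosure _
  have : CompleteSpace K := hK.completeSpace_coe
  have hL : ∀ b, L b ∈ K := fun b => Submodule.le_topologicalClosure _ ⟨b, rfl⟩
  have hinv : ∀ b, ∀ z ∈ K, diagOp ι (π b) z ∈ K := by
    intro b z hz
    refine map_mem_closure (diagOp ι (π b)).continuous hz ?_
    rintro _ ⟨c, rfl⟩
    refine ⟨b * c, ?_⟩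
    ext i
    simp [L, e, diagOp_apply]
  have hcomm : ∀ b z, K.starProjection (diagOp ι (π b) z)
      = diagOp ι (π b) (K.starProjection z) := by
    intro b
    refine starProjection_commute K _ (hinv b) ?_
    rw [adjoint_diagOp, ← ContinuousLinearMap.star_eq_adjoint, ← map_star]
    exact hinv _
  -- Without a unit in `B`, that `h` lies in the closure of `π(B)h` needs nondegeneracy: every
  -- `π(b)` kills `h - P h`, where `P` is the projection onto `K`, since `P` commutes with `π(b)`
  -- and fixes `π(b)h`.
  have hfix : K.starProjection (e.symm h) = e.symm h := by
    have key : ∀ b, diagOp ι (π b) (e.symm h - K.starProjection (e.symm h)) = 0 := by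
      intro b
      rw [map_sub, ← hcomm, sub_eq_zero]
      exact (Submodule.starProjection_eq_self_iff.mpr (hL b)).symm
    symm
    rw [← sub_eq_zero]
    ext i
    refine eq_zero_of_forall_rep_eq_zero hπ fun b => ?_
    have := congrArg (fun z : V => z i) (key b)
    exact this
  -- The matrix entries of the projection; they commute with `π(b)` because the projection commutes
  -- with the diagonal operators.
  let T : ι → ι → (H →L[ℂ] H) := fun i j =>
    PiLp.proj 2 (fun _ : ι => H) i ∘L K.starProjection ∘L
      (e.symm : (ι → H) →L[ℂ] V) ∘L ContinuousLinearMap.single ℂ (fun _ : ι => H) j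
  have hT : ∀ i j k, T i j k = K.starProjection (e.symm (Pi.single j k)) i := fun i j k => rfl
  have hsum : ∀ (k : ι → H) i, ∑ j, T i j (k j) = K.starProjection (e.symm k) i := by
    intro k i
    have e1 : e.symm k = ∑ j, e.symm (Pi.single j (k j)) := by
      rw [← map_sum, Finset.univ_sum_single]
    rw [e1, map_sum]
    simp only [hT]
    exact (map_sum (PiLp.proj 2 (fun _ : ι => H) i : V →L[ℂ] H) _ _).symm
  refine ⟨fun i j => ⟨T i j, mem_commutant.mpr fun b => ?_⟩, fun i => ?_, fun k => ?_⟩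
  · ext k
    have e1 : diagOp ι (π b) (e.symm (Pi.single j k)) = e.symm (Pi.single j (π b k)) := by
      ext l
      rcases eq_or_ne l j with rfl | hl
      · simp [diagOp_apply, e]
      · simp [diagOp_apply, e, hl]
    rw [mul_apply_eq_comp, mul_apply_eq_comp, hT, hT, ← e1, hcomm]
    rfl
  · simp only
    rw [hsum, hfix]
    rfl
  · simp only [hsum]
    have hmem : K.starProjection (e.symm k) ∈ K := Submodule.starProjection_apply_mem K _
    refine map_mem_closure (f := fun z : V => e z) e.continuous hmem ?_
    rintro _ ⟨b, rfl⟩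
    exact ⟨b, by ext i; simp [L, e]⟩

/-- The double commutant theorem: `π(B)` is strongly dense in `π(B)''`. -/
lemma mem_closure_of_mem_bicommutant {π : B →⋆ₙₐ[ℂ] (H →L[ℂ] H)} (hπ : Nondegenerate π)
    (m : VN (bicommutant π)) (h : ι → H) :
    (fun i => VN.incl (bicommutant π) m (h i)) ∈
      closure (Set.range fun (b : B) (i : ι) => π b (h i)) := by
  obtain ⟨E, hE, hcl⟩ := exists_commutant_projection hπ h
  -- An element `m` of the bicommutant commutes with the entries of the projection `E`, and `E h =
  -- h`; hence `m h = E (m h)` lies in the cyclic subspace.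
  have hm : ∀ T : commutant π, ∀ k, VN.incl _ m (T.1 k) = T.1 (VN.incl _ m k) := by
    intro T k
    have := ((StarSubalgebra.mem_centralizer_iff ℂ).mp m.2 T.1 T.2).1
    exact congr($this k).symm
  have e : (fun i => VN.incl (bicommutant π) m (h i))
      = fun i => ∑ j, (E i j).1 (VN.incl (bicommutant π) m (h j)) := by
    ext i
    simp only [← hm, ← map_sum, hE]
  rw [e]
  exact hcl _

end CyclicProjection

/-! ### Elementary tensors in `X ⊗_B H`. -/

section Vec

open UniformSpace

variable {A : Type u} {B : Type v} [CStarAlgebra A] [NonUnitalCStarAlgebra B]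
  [PartialOrder B] [StarOrderedRing B]
  {H : Type x} [NormedAddCommGroup H] [InnerProductSpace ℂ H] [CompleteSpace H]

variable (X : Corr.{u, v, w} A B) (π : B →⋆ₙₐ[ℂ] (H →L[ℂ] H)) in
/-- The elementary tensor `ξ ⊗ h` in `X ⊗_B H`. -/
def vec : X.carrier →ₗ[ℂ] H →ₗ[ℂ] IntTensor X π :=
  (TensorProduct.mk ℂ X.carrier H).compr₂
    ((Completion.toComplL : PreIntTensor X π →L[ℂ] IntTensor X π) :
      PreIntTensor X π →ₗ[ℂ] IntTensor X π)

variable {X : Corr.{u, v, w} A B} {π : B →⋆ₙₐ[ℂ] (H →L[ℂ] H)}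

lemma inner_vec (ξ η : X.carrier) (h k : H) :
    inner ℂ (vec X π ξ h) (vec X π η k) = inner ℂ h (π (rinner B ξ η) k) :=
  Completion.inner_coe (E := PreIntTensor X π) (ξ ⊗ₜ[ℂ] h) (η ⊗ₜ[ℂ] k)

lemma norm_rinner_self (ξ : X.carrier) : ‖rinner B ξ ξ‖ = ‖ξ‖ ^ 2 := by
  rw [CStarModule.norm_sq_eq (A := Bᵐᵒᵖ)]
  rfl

lemma norm_rep_le (π : B →⋆ₙₐ[ℂ] (H →L[ℂ] H)) (b : B) : ‖π b‖ ≤ ‖b‖ :=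
  NonUnitalStarAlgHom.norm_apply_le _ _

lemma norm_vec_le (ξ : X.carrier) (h : H) : ‖vec X π ξ h‖ ≤ ‖ξ‖ * ‖h‖ := by
  refine le_of_sq_le_sq ?_ (by positivity)
  rw [← inner_self_eq_norm_sq (𝕜 := ℂ), inner_vec]
  calc RCLike.re (inner ℂ h (π (rinner B ξ ξ) h)) ≤ ‖inner ℂ h (π (rinner B ξ ξ) h)‖ :=
        RCLike.re_le_norm _
    _ ≤ ‖h‖ * ‖π (rinner B ξ ξ) h‖ := norm_inner_le_norm _ _
    _ ≤ ‖h‖ * (‖ξ‖ ^ 2 * ‖h‖) := by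
        gcongr
        refine (ContinuousLinearMap.le_opNorm _ _).trans ?_
        gcongr
        exact (norm_rep_le π _).trans_eq (norm_rinner_self ξ)
    _ = (‖ξ‖ * ‖h‖) ^ 2 := by ring

lemma continuous_vec_right (ξ : X.carrier) : Continuous (vec X π ξ) :=
  (LinearMap.mkContinuous (vec X π ξ) ‖ξ‖ (norm_vec_le ξ)).continuous

lemma continuous_vec_left (h : H) : Continuous fun ξ => vec X π ξ h :=
  (LinearMap.mkContinuous ((vec X π).flip h) ‖h‖
    (fun ξ => (norm_vec_le ξ h).trans_eq (mul_comm _ _))).continuous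

/-- The tensor product is balanced over `B` although it was built from the tensor product over `ℂ`:
the difference of the two sides is a null vector of the semi-inner product. -/
lemma vec_op_smul (ξ : X.carrier) (b : B) (h : H) :
    vec X π (MulOpposite.op b • ξ) h = vec X π ξ (π b h) := by
  rw [← sub_eq_zero, ← inner_self_eq_zero (𝕜 := ℂ)]
  simp only [inner_sub_left, inner_sub_right, inner_vec, rinner_op_smul_left,
    rinner_op_smul_right, map_mul, map_star, mul_apply_eq_comp,
    ContinuousLinearMap.star_eq_adjoint, ContinuousLinearMap.adjoint_inner_right]
  ring

lemma tensorOp_vec (a : A) (T : commutant π) (ξ : X.carrier) (h : H) :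
    tensorOp X π a T (vec X π ξ h) = vec X π (X.act a ξ) (T.1 h) :=
  tensorOp_coe (X := X) a T (ξ ⊗ₜ[ℂ] h)

lemma theta_tmul (a : A) (T : commutant π) :
    theta X π (Completion.coe' (α := PreMaxTensor A (commutant π)) (a ⊗ₜ[ℂ] T))
      = tensorOp X π a T := theta_coe X π _

lemma mem_of_forall_vec_mem {S : Submodule ℂ (IntTensor X π)}
    (hS : IsClosed (S : Set (IntTensor X π)))
    (h : ∀ ξ k, vec X π ξ k ∈ S) (z : IntTensor X π) : z ∈ S := by
  induction z using Completion.induction_on with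
  | hp => exact hS
  | ih s =>
    have key : ∀ s : X.carrier ⊗[ℂ] H, Completion.coe' (α := PreIntTensor X π) s ∈ S := by
      intro s
      induction s with
      | zero =>
        have : ((0 : PreIntTensor X π) : IntTensor X π) ∈ S := by
          rw [Completion.coe_zero]; exact S.zero_mem
        exact this
      | tmul ξ k => exact h ξ k
      | add s t hs ht =>
        have := Completion.coe_add (α := PreIntTensor X π) s t
        exact this ▸ S.add_mem hs ht
    exact key s

lemma act_one_act (a : A) (ξ : X.carrier) : X.act 1 (X.act a ξ) = X.act a ξ := by
  rw [← Module.End.mul_apply, ← map_mul, one_mul]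

lemma act_act_one (a : A) (ξ : X.carrier) : X.act a (X.act 1 ξ) = X.act a ξ := by
  rw [← Module.End.mul_apply, ← map_mul, mul_one]

/-- Since `π_X` need not be unital, `ξ` and `π_X(1)ξ` may differ; operators `1 ⊗ T` produce the
latter, and coefficients do not see the change. -/
lemma coeff_act_one (ξ : X.carrier) : coeff X (X.act 1 ξ) = coeff X ξ := by
  ext a
  rw [coeff, act_act_one, ← star_one, ← X.rinner_act, act_one_act]
  rfl

lemma inner_tensorOp_vec (a : A) (T : commutant π) (ξ : X.carrier) (h k : H) :
    inner ℂ (vec X π ξ h) (tensorOp X π a T (vec X π ξ k))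
      = inner ℂ h (π (coeff X ξ a) (T.1 k)) := by
  rw [tensorOp_vec, inner_vec]
  rfl

/-- Balancing moves `π(b)` from the second leg to the first, `ξ ⊗ π(b)h_i = ξb ⊗ h_i`, with the same
`b` for all `i`; then pass to limits. -/
lemma vec_mem_closure {ι : Type*} {h k : ι → H}
    (hk : k ∈ closure (Set.range fun (b : B) (i : ι) => π b (h i))) (ξ : X.carrier) :
    (fun i => vec X π ξ (k i)) ∈
      closure (Set.range fun (η : X.carrier) (i : ι) => vec X π η (h i)) := by
  have hc : Continuous fun (k : ι → H) (i : ι) => vec X π ξ (k i) :=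
    continuous_pi fun i => (continuous_vec_right ξ).comp (continuous_apply i)
  refine map_mem_closure hc hk ?_
  rintro _ ⟨b, rfl⟩
  exact ⟨MulOpposite.op b • ξ, by ext i; exact vec_op_smul ξ b (h i)⟩

variable (X π) in
/-- The closure of `{(η ⊗ hᵢ)ᵢ : η ∈ X}` as a submodule. -/
def vecSubmodule {ι : Type*} (h : ι → H) : Submodule ℂ (ι → IntTensor X π) :=
  (LinearMap.range (LinearMap.pi fun i => (vec X π).flip (h i))).topologicalClosure

lemma coe_vecSubmodule {ι : Type*} (h : ι → H) :
    (vecSubmodule X π h : Set (ι → IntTensor X π))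
      = closure (Set.range fun (η : X.carrier) (i : ι) => vec X π η (h i)) := rfl

/-- By linearity and density it suffices to treat a tuple with one elementary tensor `ξ ⊗ k` in a
single slot. Its image is `π_X(a)ξ` tensored with a tuple in the range of `E`, to which
`vec_mem_closure` applies. -/
lemma sum_tensorOp_mem {ι : Type*} [Fintype ι] {h : ι → H} {E : ι → ι → commutant π}
    (hE : ∀ k : ι → H, (fun i => ∑ j, (E i j).1 (k j)) ∈
        closure (Set.range fun (b : B) (i : ι) => π b (h i))) (a : A) (w : ι → IntTensor X π) :
    (fun i => ∑ j, tensorOp X π a (E i j) (w j)) ∈ vecSubmodule X π h := by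
  classical
  have hcl : IsClosed (vecSubmodule X π h : Set (ι → IntTensor X π)) :=
    Submodule.isClosed_topologicalClosure _
  have key : ∀ j z, (fun i => tensorOp X π a (E i j) z) ∈ vecSubmodule X π h := by
    intro j z
    let R : IntTensor X π →L[ℂ] (ι → IntTensor X π) :=
      ContinuousLinearMap.pi fun i => tensorOp X π a (E i j)
    refine mem_of_forall_vec_mem (S := (vecSubmodule X π h).comap R.toLinearMap)
      (hcl.preimage R.continuous) (fun ξ k => ?_) z
    have h1 := vec_mem_closure (X := X) (hE (Pi.single j k)) (X.act a ξ)
    change (fun i => tensorOp X π a (E i j) (vec X π ξ k)) ∈ vecSubmodule X π h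
    have h2 : (fun i => tensorOp X π a (E i j) (vec X π ξ k)) =
        fun i => vec X π (X.act a ξ) (∑ l, (E i l).1 ((Pi.single j k : ι → H) l)) := by
      ext i
      rw [tensorOp_vec, Finset.sum_eq_single j]
      · simp
      · intro l _ hl
        simp [Pi.single_eq_of_ne hl]
      · simp
    rw [h2]
    exact h1
  have e : (fun i => ∑ j, tensorOp X π a (E i j) (w j))
      = ∑ j, fun i => tensorOp X π a (E i j) (w j) := by
    ext i
    simp
  rw [e]
  exact Submodule.sum_mem _ fun j _ => key j (w j)

end Vec

/-! ### The cone of sums of coefficients. -/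

section CoeffHull

variable {A : Type u} {B : Type v} [CStarAlgebra A] [NonUnitalCStarAlgebra B]
  [PartialOrder B] [StarOrderedRing B] {Y : Corr.{u, v, w} A B}

lemma coeff_smul (c : ℂ) (η : Y.carrier) : coeff Y (c • η) = (‖c‖ ^ 2 : ℝ) • coeff Y η := by
  ext a
  simp only [coeff, map_smul, rinner_smul_left, rinner_smul_right, Pi.smul_apply, smul_smul]
  rw [← Complex.coe_smul]
  congr 1
  rw [Complex.star_def, mul_comm, ← Complex.normSq_eq_conj_mul_self, Complex.normSq_eq_norm_sq]

lemma coeff_sqrt_smul {t : ℝ} (ht : 0 ≤ t) (η : Y.carrier) :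
    coeff Y (((√t : ℝ) : ℂ) • η) = t • coeff Y η := by
  rw [coeff_smul, Complex.norm_real, Real.norm_of_nonneg (Real.sqrt_nonneg t), Real.sq_sqrt ht]

lemma coeff_op_smul (b : B) (η : Y.carrier) (a : A) :
    coeff Y (MulOpposite.op b • η) a = star b * coeff Y η a * b := by
  -- Adjointable operators are automatically `B`-linear: the difference is orthogonal to every
  -- vector, in particular to itself.
  have h : Y.act a (MulOpposite.op b • η) = MulOpposite.op b • Y.act a η := by
    refine sub_eq_zero.mp ((CStarModule.inner_self (A := Bᵐᵒᵖ)).mp ?_)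
    refine MulOpposite.unop_injective ?_
    change rinner B _ _ = 0
    have key : ∀ ζ : Y.carrier,
        rinner B ζ (Y.act a (MulOpposite.op b • η) - MulOpposite.op b • Y.act a η) = 0 := by
      intro ζ
      have hs : ∀ ζ η θ : Y.carrier, rinner B ζ (η - θ) = rinner B ζ η - rinner B ζ θ := by
        intro ζ η θ
        simp [rinner]
      rw [hs, Y.rinner_act, rinner_op_smul_right, rinner_op_smul_right, Y.rinner_act, sub_self]
    exact key _
  rw [coeff, h, rinner_op_smul_right, rinner_op_smul_left]
  rfl

/-- The elements of `F_Y` are the finite sums of coefficients. -/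
lemma mem_coeffHull_iff {ψ : A → B} :
    ψ ∈ coeffHull Y ↔ ∃ (n : ℕ) (η : Fin n → Y.carrier), ψ = ∑ i, coeff Y (η i) := by
  constructor
  · intro h
    let S : Set (A → B) := {ψ | ∃ (n : ℕ) (η : Fin n → Y.carrier), ψ = ∑ i, coeff Y (η i)}
    -- Coefficients are quadratic in the vector, so a nonnegative factor `t` is absorbed by scaling
    -- with `√t`. Finite sums thus form a convex cone.
    have hsm : ∀ ψ ∈ S, ∀ t : ℝ, 0 ≤ t → t • ψ ∈ S := by
      rintro _ ⟨n, η, rfl⟩ t ht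
      refine ⟨n, fun i => ((√t : ℝ) : ℂ) • η i, ?_⟩
      simp only [coeff_sqrt_smul ht, Finset.smul_sum]
    have hadd : ∀ ψ ∈ S, ∀ χ ∈ S, ψ + χ ∈ S := by
      rintro _ ⟨n, η, rfl⟩ _ ⟨m, ζ, rfl⟩
      refine ⟨n + m, Fin.append η ζ, ?_⟩
      simp [Fin.sum_univ_add]
    refine (convexHull_min (s := Set.range (coeff Y)) (t := S) ?_ ?_) h
    · rintro _ ⟨η, rfl⟩
      exact ⟨1, fun _ => η, by simp⟩
    · intro ψ hψ χ hχ s t hs ht _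
      exact hadd _ (hsm _ hψ s hs) _ (hsm _ hχ t ht)
  · rintro ⟨n, η, rfl⟩
    rcases Nat.eq_zero_or_pos n with rfl | hn
    · refine subset_convexHull ℝ _ ⟨0, ?_⟩
      ext a
      simp [coeff, rinner]
    · have hn' : (0 : ℝ) < n := by exact_mod_cast hn
      -- A sum of `n` coefficients is the average of the coefficients of the vectors `√n η_i`.
      have e : ∑ i, coeff Y (η i)
          = ∑ i, ((n : ℝ)⁻¹) • coeff Y (((√n : ℝ) : ℂ) • η i) := by
        refine Finset.sum_congr rfl fun i _ => ?_
        rw [coeff_sqrt_smul hn'.le, smul_smul, inv_mul_cancel₀ hn'.ne', one_smul]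
      rw [e]
      refine (convex_convexHull ℝ _).sum_mem (fun i _ => by positivity) ?_
        (fun i _ => subset_convexHull ℝ _ ⟨_, rfl⟩)
      simp [hn'.ne']

lemma smul_mem_coeffHull {ψ : A → B} (h : ψ ∈ coeffHull Y) {t : ℝ} (ht : 0 ≤ t) :
    t • ψ ∈ coeffHull Y := by
  obtain ⟨n, η, rfl⟩ := mem_coeffHull_iff.mp h
  refine mem_coeffHull_iff.mpr ⟨n, fun i => ((√t : ℝ) : ℂ) • η i, ?_⟩
  simp only [coeff_sqrt_smul ht, Finset.smul_sum]

lemma zero_mem_coeffHull : (0 : A → B) ∈ coeffHull Y :=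
  mem_coeffHull_iff.mpr ⟨0, Fin.elim0, by simp⟩

lemma coeff_mem_coeffHull (η : Y.carrier) : coeff Y η ∈ coeffHull Y :=
  subset_convexHull ℝ _ ⟨η, rfl⟩

lemma conj_mem_coeffHull {ψ : A → B} (h : ψ ∈ coeffHull Y) (b : B) :
    (fun a => star b * ψ a * b) ∈ coeffHull Y := by
  obtain ⟨n, η, rfl⟩ := mem_coeffHull_iff.mp h
  refine mem_coeffHull_iff.mpr ⟨n, fun i => MulOpposite.op b • η i, ?_⟩
  ext a
  simp [coeff_op_smul, Finset.mul_sum, Finset.sum_mul]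

end CoeffHull

/-! ### From weak containment to strong approximation. -/

section StrongApprox

open UniformSpace

variable {A : Type u} {B : Type v} [CStarAlgebra A] [NonUnitalCStarAlgebra B]
  [PartialOrder B] [StarOrderedRing B]
  {H : Type x} [NormedAddCommGroup H] [InnerProductSpace ℂ H] [CompleteSpace H]
  {X : Corr.{u, v, w} A B} {Y : Corr.{u, v, y} A B} {π : B →⋆ₙₐ[ℂ] (H →L[ℂ] H)}

/-- The matrix `(1 ⊗ Eᵢⱼ)` over `A ⊗_max π(B)'`. -/
def oneTmulMatrix {ι : Type*} (E : ι → ι → commutant π) :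
    CStarMatrix ι ι (MaxTensor A (commutant π)) :=
  CStarMatrix.ofMatrix <| Matrix.of fun i j =>
    Completion.coe' (α := PreMaxTensor A (commutant π)) ((1 : A) ⊗ₜ[ℂ] E i j)

lemma matAct_theta_one {ι : Type*} [Fintype ι] (E : ι → ι → commutant π)
    (w : ι → IntTensor X π) :
    matAct (thetaHom X π) (oneTmulMatrix E) w
      = fun i => ∑ j, tensorOp X π 1 (E i j) (w j) := by
  ext i
  exact Finset.sum_congr rfl fun j _ => congr($(theta_tmul (X := X) 1 (E i j)) (w j))

/-- The matrix whose only nonzero entries are `a p ⊗ 1` at the positions `(p, t p)`. -/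
def selectMatrix {P G : Type*} [DecidableEq G] (a : P → A) (t : P → G) :
    CStarMatrix (P ⊕ G) (P ⊕ G) (MaxTensor A (commutant π)) :=
  CStarMatrix.ofMatrix <| Matrix.of <| Sum.elim
    (fun p => Sum.elim (fun _ => 0) fun k => if k = t p then
      Completion.coe' (α := PreMaxTensor A (commutant π)) (a p ⊗ₜ[ℂ] 1) else 0)
    (fun _ _ => 0)

/-- A separating functional pairs unrelated families `g` and `h`. Listing both in one tuple over `P
⊕ G` and placing the `a p` in the off-diagonal block turns it into a quadratic form evaluated at `(η
⊗ ·)`. -/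
lemma matForm_selectMatrix {P G : Type*} [Fintype P] [Fintype G] [DecidableEq G] (a : P → A)
    (t : P → G) (g : P → H) (h : G → H) (η : X.carrier) :
    matForm (thetaHom X π) (selectMatrix a t) (fun i => vec X π η (Sum.elim g h i))
      = ∑ p, inner ℂ (g p) (π (coeff X η (a p)) (h (t p))) := by
  have h0 : ∀ k, matAct (thetaHom X π) (selectMatrix a t)
      (fun i => vec X π η (Sum.elim g h i)) (Sum.inr k) = 0 := by
    intro k
    refine Finset.sum_eq_zero fun j _ => ?_
    change thetaHom X π 0 _ = 0
    simp
  have h1 : ∀ p, matAct (thetaHom X π) (selectMatrix a t)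
      (fun i => vec X π η (Sum.elim g h i)) (Sum.inl p)
      = tensorOp X π (a p) 1 (vec X π η (h (t p))) := by
    intro p
    rw [matAct, Fintype.sum_sum_type, Finset.sum_eq_zero, zero_add, Finset.sum_eq_single (t p)]
    · rw [← theta_tmul]
      change thetaHom X π (if t p = t p then _ else 0) _ = _
      rw [if_pos rfl]
      rfl
    · intro k _ hk
      change thetaHom X π (if k = t p then _ else 0) _ = _
      rw [if_neg hk, map_zero]
      rfl
    · simp
    · intro j _
      change thetaHom X π 0 _ = 0
      simp
  rw [matForm, Fintype.sum_sum_type]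
  simp only [h0, h1, inner_zero_right, Finset.sum_const_zero, add_zero]
  refine Finset.sum_congr rfl fun p _ => ?_
  exact inner_tensorOp_vec (a p) 1 η (g p) (h (t p))

/-- Inequalities between matrix coefficients pass from `Y` to `X` under weak containment. -/
lemma WeaklyContained.matForm_nonpos (hXY : WeaklyContained π X Y) (hπ : Nondegenerate π)
    {ι : Type*} [Fintype ι] (h : ι → H) (Z : CStarMatrix ι ι (MaxTensor A (commutant π)))
    (hZ : ∀ η : Y.carrier, (matForm (thetaHom Y π) Z fun i => vec Y π η (h i)).re ≤ 0)
    (ξ : X.carrier) :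
    (matForm (thetaHom X π) Z fun i => vec X π (X.act 1 ξ) (h i)).re ≤ 0 := by
  obtain ⟨E, hE, hcl⟩ := exists_commutant_projection hπ h
  let F := oneTmulMatrix (A := A) E
  -- `F` sends an arbitrary tuple into the closure of the tuples `(η ⊗ h_i)`, where the hypothesis
  -- applies by continuity.
  have hneg : ∀ w : ι → IntTensor Y π, (matForm (thetaHom Y π) (star F * Z * F) w).re ≤ 0 := by
    intro w
    rw [matForm_conj, matAct_theta_one]
    have hc : Continuous fun v : ι → IntTensor Y π => (matForm (thetaHom Y π) Z v).re := by
      unfold matForm matAct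
      fun_prop
    have hmem := sum_tensorOp_mem (X := Y) hcl 1 w
    rw [← SetLike.mem_coe, coe_vecSubmodule] at hmem
    refine closure_minimal ?_ (isClosed_le hc continuous_const) hmem
    rintro _ ⟨η, rfl⟩
    exact hZ η
  let G := star F * Z * F
  -- Positivity is transferred only for self-adjoint matrices; the form of `G + G*` is twice the
  -- real part of the form of `G`.
  have hsa : IsSelfAdjoint (-(G + star G)) := by
    rw [isSelfAdjoint_iff, star_neg, star_add, star_star, add_comm]
  have key := matForm_nonneg_transfer (ρ₁ := thetaHom X π) (ρ₂ := thetaHom Y π) hXY hsa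
    (fun w => by
      rw [matForm_neg, matForm_add, matForm_star, Complex.neg_re, Complex.add_re,
        Complex.star_def, Complex.conj_re]
      linarith [hneg w]) (fun i => vec X π ξ (h i))
  rw [matForm_neg, matForm_add, matForm_star, Complex.neg_re, Complex.add_re, Complex.star_def,
      Complex.conj_re, matForm_conj, matAct_theta_one] at key
  -- Because `E h = h`, the compression does nothing to the tuple of `ξ` except apply `π_X(1)`.
  have e : (fun i => ∑ j, tensorOp X π 1 (E i j) (vec X π ξ (h j)))
      = fun i => vec X π (X.act 1 ξ) (h i) := by
    ext i
    simp only [tensorOp_vec, ← map_sum, hE]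
  rw [e] at key
  linarith

/-- Under weak containment, the coefficients of `X` are approximated in the point-strong
topology by convex combinations of coefficients of `Y`. -/
theorem WeaklyContained.strong_approx (hXY : WeaklyContained π X Y) (hπ : Nondegenerate π)
    (ξ : X.carrier) (F : Finset A) (G : Finset H) {ε : ℝ} (hε : 0 < ε) :
    ∃ ψ ∈ coeffHull Y, ∀ a ∈ F, ∀ k ∈ G, ‖π (ψ a) k - π (coeff X ξ a) k‖ < ε := by
  classical
  let V := PiLp 2 (fun _ : F × G => H)
  let e := PiLp.continuousLinearEquiv 2 ℂ (fun _ : F × G => H)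
  let Φ : (A → B) →ₗ[ℝ] V :=
    { toFun := fun ψ => e.symm fun p => π (ψ p.1) p.2
      map_add' := fun ψ χ => by rw [← map_add]; congr 1; ext p; simp
      map_smul' := fun c ψ => by
        refine PiLp.ext fun p => ?_
        change π ((c • ψ) p.1) p.2 = c • π (ψ p.1) p.2
        rw [Pi.smul_apply, ← Complex.coe_smul c (ψ p.1), map_smul, ← Complex.coe_smul c]
        rfl }
  have hΦ : ∀ ψ p, Φ ψ p = π (ψ p.1) p.2 := fun _ _ => rfl
  by_cases hcl : Φ (coeff X ξ) ∈ closure (Φ '' coeffHull Y)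
  · obtain ⟨_, ⟨ψ, hψ, rfl⟩, hd⟩ := Metric.mem_closure_iff.mp hcl ε hε
    refine ⟨ψ, hψ, fun a ha k hk => ?_⟩
    rw [dist_comm, dist_eq_norm] at hd
    exact (PiLp.norm_apply_le (Φ ψ - Φ (coeff X ξ)) (⟨a, ha⟩, ⟨k, hk⟩)).trans_lt hd
  exfalso
  have hconv : Convex ℝ (closure (Φ '' coeffHull Y)) :=
    ((convex_convexHull ℝ _).linear_image Φ).closure
  obtain ⟨f, c, hf, hc⟩ := RCLike.geometric_hahn_banach_closed_point (𝕜 := ℂ) hconv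
    isClosed_closure hcl
  have hf' : ∀ ψ ∈ coeffHull Y, (f (Φ ψ)).re < c := fun ψ hψ =>
    hf _ (subset_closure ⟨ψ, hψ, rfl⟩)
  have hc0 : 0 < c := by
    have := hf' 0 zero_mem_coeffHull
    simpa using this
  -- A real functional bounded above on a cone is nonpositive there: rescaling a positive value to
  -- equal `c` would contradict the strict bound.
  have hneg : ∀ ψ ∈ coeffHull Y, (f (Φ ψ)).re ≤ 0 := by
    intro ψ hψ
    by_contra! hpos
    have := hf' _ (smul_mem_coeffHull hψ (t := c / (f (Φ ψ)).re) (by positivity))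
    rw [map_smul, ← Complex.coe_smul, map_smul, smul_eq_mul, Complex.re_ofReal_mul,
      div_mul_cancel₀ _ hpos.ne'] at this
    exact lt_irrefl _ this
  -- The `ℓ²` norm on the product makes `V` a Hilbert space, so the separating functional is given
  -- by vectors of `H`.
  let g : V := (InnerProductSpace.toDual ℂ V).symm f
  have hg : ∀ ψ, f (Φ ψ) = ∑ p : F × G, inner ℂ (g p) (π (ψ p.1) p.2) := by
    intro ψ
    rw [← InnerProductSpace.toDual_symm_apply, PiLp.inner_apply]
    rfl
  have h1 : ∀ η : Y.carrier, (matForm (thetaHom Y π)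
      (selectMatrix (fun p : F × G => (p.1 : A)) (fun p => p.2))
      (fun i => vec Y π η (Sum.elim (fun p => g p) (fun k : G => (k : H)) i))).re ≤ 0 := by
    intro η
    rw [matForm_selectMatrix, ← hg]
    exact hneg _ (coeff_mem_coeffHull η)
  have h2 := hXY.matForm_nonpos hπ _ _ h1 ξ
  rw [matForm_selectMatrix, coeff_act_one, ← hg] at h2
  have h3 : c < (f (Φ (coeff X ξ))).re := hc
  linarith

end StrongApprox

/-! ### From approximation of vector functionals to weak containment. -/

section Fell

open Filter Topology

/-- For self-adjoint `T`, iterating `‖Tᵐu‖² ≤ ‖u‖ ‖T²ᵐu‖` gives `(‖Tu‖/‖u‖)^(2^k) ≤ ‖T^(2^k)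
u‖/‖u‖`. On taking `2^k`-th roots the constant `C` disappears. Hence growth bounds whose constants
depend on the vector still give a uniform operator bound. -/
lemma norm_apply_le_of_pow_bound {K : Type*} [NormedAddCommGroup K] [InnerProductSpace ℂ K]
    [CompleteSpace K] {T : K →L[ℂ] K} (hT : IsSelfAdjoint T) {c C : ℝ} (hc : 0 ≤ c) {u : K}
    (h : ∀ m, 1 ≤ m → ‖(T ^ m) u‖ ≤ C * c ^ m) : ‖T u‖ ≤ c * ‖u‖ := by
  have hstep : ∀ m : ℕ, ‖(T ^ m) u‖ ^ 2 ≤ ‖u‖ * ‖(T ^ (2 * m)) u‖ := by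
    intro m
    have hs : ContinuousLinearMap.adjoint (T ^ m) = T ^ m := by
      rw [← ContinuousLinearMap.star_eq_adjoint, (hT.pow m).star_eq]
    rw [← inner_self_eq_norm_sq (𝕜 := ℂ), ← ContinuousLinearMap.adjoint_inner_right, hs,
      ← mul_apply_eq_comp, ← pow_add, ← two_mul]
    exact (RCLike.re_le_norm _).trans (norm_inner_le_norm _ _)
  have hpow : ∀ k : ℕ, ‖u‖ * ‖T u‖ ^ (2 ^ k) ≤ ‖u‖ ^ (2 ^ k) * ‖(T ^ (2 ^ k)) u‖ := by
    intro k
    induction k with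
    | zero => simp
    | succ k ih =>
      rcases eq_or_lt_of_le (norm_nonneg u) with h0 | h0
      · rw [← h0]; simp
      have h1 : (‖u‖ * ‖T u‖ ^ (2 ^ k)) ^ 2 ≤ (‖u‖ ^ (2 ^ k) * ‖(T ^ (2 ^ k)) u‖) ^ 2 :=
        pow_le_pow_left₀ (by positivity) ih 2
      have h2 := hstep (2 ^ k)
      have h3 : ‖u‖ * (‖u‖ * ‖T u‖ ^ (2 ^ (k + 1)))
          ≤ ‖u‖ * (‖u‖ ^ (2 ^ (k + 1)) * ‖(T ^ (2 ^ (k + 1))) u‖) := by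
        calc ‖u‖ * (‖u‖ * ‖T u‖ ^ (2 ^ (k + 1))) = (‖u‖ * ‖T u‖ ^ (2 ^ k)) ^ 2 := by
              rw [pow_succ 2 k, pow_mul]; ring
          _ ≤ (‖u‖ ^ (2 ^ k) * ‖(T ^ (2 ^ k)) u‖) ^ 2 := h1
          _ = ‖u‖ ^ (2 ^ (k + 1)) * ‖(T ^ (2 ^ k)) u‖ ^ 2 := by
              rw [pow_succ 2 k, pow_mul]; ring
          _ ≤ ‖u‖ ^ (2 ^ (k + 1)) * (‖u‖ * ‖(T ^ (2 * 2 ^ k)) u‖) := by gcongr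
          _ = _ := by rw [pow_succ' 2 k]; ring
      exact le_of_mul_le_mul_left h3 h0
  by_contra! hlt
  have hu : 0 < ‖u‖ := by
    rw [norm_pos_iff]; rintro rfl; simp at hlt
  have hTu : 0 < ‖T u‖ := lt_of_le_of_lt (by positivity) hlt
  have hc0 : 0 < c := by
    rcases eq_or_lt_of_le hc with h0 | h0
    · have := h 1 le_rfl
      rw [← h0] at this
      simp at this
      simp [this] at hTu
    · exact h0
  have hr : 1 < ‖T u‖ / (c * ‖u‖) := by rwa [one_lt_div (by positivity)]
  obtain ⟨k, hk⟩ := pow_unbounded_of_one_lt (C / ‖u‖) hr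
  have hk' : C / ‖u‖ < (‖T u‖ / (c * ‖u‖)) ^ (2 ^ k) :=
    hk.trans_le (pow_le_pow_right₀ hr.le Nat.lt_two_pow_self.le)
  rw [div_pow, div_lt_div_iff₀ hu (by positivity), mul_pow] at hk'
  have h1 := hpow k
  have h2 := h (2 ^ k) Nat.one_le_two_pow
  have h3 : ‖u‖ ^ (2 ^ k) * ‖(T ^ (2 ^ k)) u‖ ≤ ‖u‖ ^ (2 ^ k) * (C * c ^ (2 ^ k)) := by gcongr
  nlinarith

lemma map_pow_of_map_mul {R S : Type*} [Monoid R] [Monoid S] {θ : R → S}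
    (hmul : ∀ y z, θ (y * z) = θ y * θ z) (z : R) {m : ℕ} (hm : 1 ≤ m) :
    θ (z ^ m) = θ z ^ m := by
  induction m, hm using Nat.le_induction with
  | base => simp
  | succ m _ ih => rw [pow_succ, hmul, ih, pow_succ]

/-- A ⋆-representation `θ₁` is dominated by `θ₂` if the vector functionals of a total set of
vectors of `θ₁` are limits of sums of vector functionals of `θ₂`. -/
theorem norm_le_of_vector_approx {R : Type*} [Ring R] [StarRing R]
    {K₁ K₂ : Type*} [NormedAddCommGroup K₁] [InnerProductSpace ℂ K₁] [CompleteSpace K₁]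
    [NormedAddCommGroup K₂] [InnerProductSpace ℂ K₂] [CompleteSpace K₂]
    {θ₁ : R → K₁ →L[ℂ] K₁} {θ₂ : R → K₂ →L[ℂ] K₂}
    (hmul₁ : ∀ y z, θ₁ (y * z) = θ₁ y * θ₁ z) (hstar₁ : ∀ z, θ₁ (star z) = star (θ₁ z))
    (hmul₂ : ∀ y z, θ₂ (y * z) = θ₂ y * θ₂ z) (hstar₂ : ∀ z, θ₂ (star z) = star (θ₂ z))
    {S : Set K₁} (hS : Dense (Submodule.span ℂ S : Set K₁))
    (h : ∀ v ∈ S, ∀ z : R, ∀ ε > 0, ∃ (n : ℕ) (w : Fin n → K₂),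
      ‖inner ℂ v (θ₁ z v) - ∑ i, inner ℂ (w i) (θ₂ z (w i))‖ < ε ∧
      ‖inner ℂ v (θ₁ 1 v) - ∑ i, inner ℂ (w i) (θ₂ 1 (w i))‖ < ε) (z : R) :
    ‖θ₁ z‖ ≤ ‖θ₂ z‖ := by
  -- The domination is by the value at `1`, since `θ₂(1)` is only a projection; it holds for vector
  -- functionals of `θ₂` and survives sums and limits.
  have hdom : ∀ v ∈ S, ∀ z : R,
      (inner ℂ v (θ₁ z v)).re
        ≤ ‖θ₂ z‖ * (inner ℂ v (θ₁ 1 v)).re := by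
    intro v hv z
    refine le_of_forall_pos_le_add fun δ hδ => ?_
    set M := ‖θ₂ z‖ with hM
    have hM0 : 0 ≤ M := norm_nonneg _
    -- The error at `z` counts once and the error at `1` counts `M` times, which adds up to `δ`.
    obtain ⟨n, w, h1, h2⟩ := h v hv z (δ / (M + 1)) (by positivity)
    have hw : ∀ i, (inner ℂ (w i) (θ₂ z (w i))).re
        ≤ M * (inner ℂ (w i) (θ₂ 1 (w i))).re := by
      intro i
      have hone : star (θ₂ (1 : R)) = θ₂ 1 := by
        rw [← hstar₂, star_one]
      have e1 : inner ℂ (w i) (θ₂ 1 (w i))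
          = inner ℂ (θ₂ 1 (w i)) (θ₂ 1 (w i)) := by
        rw [← ContinuousLinearMap.adjoint_inner_right, ← ContinuousLinearMap.star_eq_adjoint,
          hone, ← mul_apply_eq_comp, ← hmul₂, one_mul]
      have e2 : inner ℂ (w i) (θ₂ z (w i))
          = inner ℂ (θ₂ 1 (w i)) (θ₂ z (θ₂ 1 (w i))) := by
        rw [← ContinuousLinearMap.adjoint_inner_right, ← ContinuousLinearMap.star_eq_adjoint,
          hone, ← mul_apply_eq_comp, ← mul_apply_eq_comp, ← hmul₂, ← hmul₂, one_mul,
          mul_one]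
      rw [e1, e2]
      have e3 : (inner ℂ (θ₂ 1 (w i)) (θ₂ 1 (w i))).re
          = ‖θ₂ 1 (w i)‖ ^ 2 := inner_self_eq_norm_sq (𝕜 := ℂ) _
      rw [e3]
      refine (Complex.re_le_norm _).trans ((norm_inner_le_norm _ _).trans ?_)
      have := (θ₂ z).le_opNorm (θ₂ 1 (w i))
      calc _ ≤ ‖θ₂ 1 (w i)‖ * (M * ‖θ₂ 1 (w i)‖) := by gcongr
        _ = _ := by ring
    have hsum : (∑ i, inner ℂ (w i) (θ₂ z (w i))).re
        ≤ M * (∑ i, inner ℂ (w i) (θ₂ 1 (w i))).re := by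
      rw [Complex.re_sum, Complex.re_sum, Finset.mul_sum]
      exact Finset.sum_le_sum fun i _ => hw i
    have h1' := (Complex.re_le_norm _).trans_lt h1
    have h2' := ((Complex.abs_re_le_norm _).trans_lt h2)
    rw [Complex.sub_re] at h1' h2'
    have h2'' := (abs_lt.mp h2').1
    have e : δ = (M + 1) * (δ / (M + 1)) := by field_simp
    rw [e]
    nlinarith
  set T := θ₁ (star z * z) with hTdef
  set c := ‖θ₂ z‖ ^ 2 with hcdef
  have hTsa : IsSelfAdjoint T := by
    rw [isSelfAdjoint_iff, hTdef, ← hstar₁, star_mul, star_star]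
  have hYc : ‖θ₂ (star z * z)‖ = c := by
    rw [hmul₂, hstar₂, CStarRing.norm_star_mul_self, hcdef, sq]
  -- `‖Tᵐv‖²` is the vector functional of `v` at `(z* z)²ᵐ`, so `hdom` applies. The constant is
  -- `√⟨v, θ₁(1)v⟩`, and `m = 0` is excluded because `θ₁` need not be unital.
  have hv : ∀ v ∈ S, ∃ C, ∀ m, 1 ≤ m → ‖(T ^ m) v‖ ≤ C * c ^ m := by
    intro v hv
    refine ⟨√(inner ℂ v (θ₁ 1 v)).re, fun m hm => ?_⟩
    have e1 : ‖(T ^ m) v‖ ^ 2 = (inner ℂ v (θ₁ ((star z * z) ^ (2 * m)) v)).re := by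
      have hs : ContinuousLinearMap.adjoint (T ^ m) = T ^ m := by
        rw [← ContinuousLinearMap.star_eq_adjoint, (hTsa.pow m).star_eq]
      rw [map_pow_of_map_mul hmul₁ _ (by omega), ← inner_self_eq_norm_sq (𝕜 := ℂ),
        ← ContinuousLinearMap.adjoint_inner_right, hs, ← mul_apply_eq_comp, ← pow_add, ← two_mul]
      rfl
    have e2 := hdom v hv ((star z * z) ^ (2 * m))
    have e3 : ‖θ₂ ((star z * z) ^ (2 * m))‖ ≤ c ^ (2 * m) := by
      rw [map_pow_of_map_mul hmul₂ _ (by omega), ← hYc]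
      exact norm_pow_le' _ (by omega)
    have e4 : 0 ≤ (inner ℂ v (θ₁ 1 v)).re := by
      have hone : star (θ₁ (1 : R)) = θ₁ 1 := by
        rw [← hstar₁, star_one]
      have e1 : inner ℂ v (θ₁ 1 v)
          = inner ℂ (θ₁ 1 v) (θ₁ 1 v) := by
        rw [← ContinuousLinearMap.adjoint_inner_right, ← ContinuousLinearMap.star_eq_adjoint,
          hone, ← mul_apply_eq_comp, ← hmul₁, one_mul]
      rw [e1]
      exact inner_self_nonneg (𝕜 := ℂ)
    refine le_of_sq_le_sq ?_ (by positivity)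
    rw [e1, mul_pow, Real.sq_sqrt e4, ← pow_mul]
    calc _ ≤ _ := e2
      _ ≤ c ^ (2 * m) * (inner ℂ v (θ₁ 1 v)).re := by gcongr
      _ = _ := by rw [mul_comm 2 m, mul_comm]
  -- Numerical domination does not pass to sums of vectors, but a growth rate does, with a changed
  -- constant.
  have hspan : ∀ u ∈ Submodule.span ℂ S, ∃ C, ∀ m, 1 ≤ m → ‖(T ^ m) u‖ ≤ C * c ^ m := by
    intro u hu
    induction hu using Submodule.span_induction with
    | mem u hu => exact hv u hu
    | zero => exact ⟨0, fun m _ => by simp⟩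
    | add s t _ _ hs ht =>
      obtain ⟨C₁, h₁⟩ := hs
      obtain ⟨C₂, h₂⟩ := ht
      refine ⟨C₁ + C₂, fun m hm => ?_⟩
      rw [map_add, add_mul]
      exact (norm_add_le _ _).trans (add_le_add (h₁ m hm) (h₂ m hm))
    | smul r t _ ht =>
      obtain ⟨C, hC⟩ := ht
      refine ⟨‖r‖ * C, fun m hm => ?_⟩
      rw [map_smul, norm_smul, mul_assoc]
      exact mul_le_mul_of_nonneg_left (hC m hm) (norm_nonneg _)
  have hle : ∀ u, ‖T u‖ ≤ c * ‖u‖ := by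
    intro u
    refine closure_minimal (s := (Submodule.span ℂ S : Set (K₁)))
      (t := {u | ‖T u‖ ≤ c * ‖u‖}) (fun u hu => ?_)
      (isClosed_le T.continuous.norm (continuous_const.mul continuous_norm)) (hS u)
    obtain ⟨C, hC⟩ := hspan u hu
    exact norm_apply_le_of_pow_bound hTsa (by positivity) hC
  have hT : ‖T‖ ≤ c := T.opNorm_le_bound (by positivity) hle
  have hX : ‖T‖ = ‖θ₁ z‖ ^ 2 := by
    rw [hTdef, hmul₁, hstar₁, CStarRing.norm_star_mul_self, sq]
  rw [hX] at hT
  exact le_of_sq_le_sq hT (norm_nonneg _)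

variable {A : Type u} {B : Type v} [CStarAlgebra A] [NonUnitalCStarAlgebra B]
  [PartialOrder B] [StarOrderedRing B]
  {H : Type x} [NormedAddCommGroup H] [InnerProductSpace ℂ H] [CompleteSpace H]
  {X : Corr.{u, v, w} A B} {Y : Corr.{u, v, y} A B} {π : B →⋆ₙₐ[ℂ] (H →L[ℂ] H)}

/-- Weak containment follows if the vector functionals of a total set of vectors of `X ⊗_B H` are
limits of sums of vector functionals of `Y ⊗_B H`. -/
theorem weaklyContained_of_total {S : Set (IntTensor X π)}
    (hS : Dense (Submodule.span ℂ S : Set (IntTensor X π)))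
    (h : ∀ v ∈ S, ∀ z : A ⊗[ℂ] commutant π, ∀ ε > 0, ∃ (n : ℕ) (w : Fin n → IntTensor Y π),
      ‖inner ℂ v (thetaAlg X π z v) - ∑ i, inner ℂ (w i) (thetaAlg Y π z (w i))‖ < ε ∧
      ‖inner ℂ v (thetaAlg X π 1 v) - ∑ i, inner ℂ (w i) (thetaAlg Y π 1 (w i))‖ < ε) :
    WeaklyContained π X Y :=
  weaklyContained_of_norm_le <| norm_le_of_vector_approx (θ₁ := thetaAlg X π)
    (θ₂ := thetaAlg Y π) thetaAlg_mul thetaAlg_star thetaAlg_mul thetaAlg_star hS h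

/-- A weak operator limit of elements of `F_Y` is approximated by vector functionals. -/
lemma exists_vec_approx_of_tendsto {α : Type*} {l : Filter α} [l.NeBot] {ψ : α → A → B}
    (hψ : ∀ i, ψ i ∈ coeffHull Y) {φ : A → B} {v : IntTensor X π} {h : H}
    (hv : ∀ a T, inner ℂ v (tensorOp X π a T v) = inner ℂ h (π (φ a) (T.1 h)))
    (ht : ∀ a k, Tendsto (fun i => inner ℂ h (π (ψ i a) k)) l (𝓝 (inner ℂ h (π (φ a) k))))
    (z : A ⊗[ℂ] commutant π) (ε : ℝ) (hε : 0 < ε) :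
    ∃ (n : ℕ) (w : Fin n → IntTensor Y π),
      ‖inner ℂ v (thetaAlg X π z v) - ∑ i, inner ℂ (w i) (thetaAlg Y π z (w i))‖ < ε ∧
      ‖inner ℂ v (thetaAlg X π 1 v) - ∑ i, inner ℂ (w i) (thetaAlg Y π 1 (w i))‖ < ε := by
  choose n η hη using fun i => mem_coeffHull_iff.mp (hψ i)
  -- By linearity in `z` only elementary tensors `a ⊗ T` matter, and there the sum is `⟨h, π(ψ_i(a))
  -- T h⟩`.
  have key : ∀ z : A ⊗[ℂ] commutant π, Tendsto (fun i => ∑ j, inner ℂ (vec Y π (η i j) h)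
      (thetaAlg Y π z (vec Y π (η i j) h))) l (𝓝 (inner ℂ v (thetaAlg X π z v))) := by
    intro z
    induction z with
    | zero => simp
    | add s t hs ht =>
      simp only [map_add, add_apply, inner_add_right, Finset.sum_add_distrib]
      exact hs.add ht
    | tmul a T =>
      simp only [thetaAlg_tmul, inner_tensorOp_vec]
      rw [hv]
      convert ht a (T.1 h) using 2 with i
      rw [hη i]
      simp
  have h1 := (key z).eventually (Metric.ball_mem_nhds _ hε)
  have h2 := (key 1).eventually (Metric.ball_mem_nhds _ hε)
  obtain ⟨i, hi1, hi2⟩ := (h1.and h2).exists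
  refine ⟨n i, fun j => vec Y π (η i j) h, ?_, ?_⟩
  · rw [dist_comm, dist_eq_norm] at hi1
    exact hi1
  · rw [dist_comm, dist_eq_norm] at hi2
    exact hi2

lemma dense_span_vec : Dense (Submodule.span ℂ {z | ∃ ξ h, vec X π ξ h = z} :
    Set (IntTensor X π)) := by
  intro z
  have := mem_of_forall_vec_mem
    (S := (Submodule.span ℂ {z | ∃ ξ h, vec X π ξ h = z}).topologicalClosure)
    (Submodule.isClosed_topologicalClosure _)
    (fun ξ k => Submodule.le_topologicalClosure _ (Submodule.subset_span ⟨ξ, k, rfl⟩)) z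
  exact this

/-- Weak containment follows if every coefficient of `X` is a point-weak limit of elements of
`F_Y`. -/
theorem weaklyContained_of_weak_approx
    (h : ∀ ξ : X.carrier, ∀ (F : Finset A) (G : Finset H), ∀ ε > 0, ∃ ψ ∈ coeffHull Y,
      ∀ a ∈ F, ∀ s ∈ G, ∀ t ∈ G, ‖inner ℂ s (π (ψ a) t) - inner ℂ s (π (coeff X ξ a) t)‖ < ε) :
    WeaklyContained π X Y := by
  classical
  refine weaklyContained_of_total dense_span_vec ?_
  rintro _ ⟨ξ, k, rfl⟩
  choose ψ hψ hd using fun p : Finset A × Finset H × ℕ =>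
    h ξ p.1 p.2.1 (1 / ((p.2.2 : ℝ) + 1)) (by positivity)
  refine exists_vec_approx_of_tendsto (l := atTop) hψ (φ := coeff X ξ) (h := k)
    (fun a T => inner_tensorOp_vec a T ξ k k) fun a t => ?_
  rw [tendsto_iff_norm_sub_tendsto_zero]
  have h0 : Tendsto (fun p : Finset A × Finset H × ℕ => 1 / ((p.2.2 : ℝ) + 1)) atTop (𝓝 0) := by
    have : Tendsto (fun p : Finset A × Finset H × ℕ => p.2.2) atTop atTop := by
      rw [← prod_atTop_atTop_eq, ← prod_atTop_atTop_eq]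
      exact tendsto_snd.comp tendsto_snd
    exact tendsto_one_div_add_atTop_nhds_zero_nat.comp this
  refine squeeze_zero' (Eventually.of_forall fun _ => norm_nonneg _) ?_ h0
  filter_upwards [eventually_ge_atTop (({a}, {k, t}, 0) : Finset A × Finset H × ℕ)] with p hp
  obtain ⟨h1, h2, -⟩ := hp
  exact (hd p a (h1 (by simp)) k (h2 (by simp)) t (h2 (by simp))).le

end Fell

/-! ### Functional calculus for the cutdown. -/

section Calculus

variable {B : Type v} [NonUnitalCStarAlgebra B] [PartialOrder B] [StarOrderedRing B]

/-- The element `c (1 + c)⁻¹`. -/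
lemma exists_quasi_resolvent {c : B} (hc : 0 ≤ c) :
    ∃ r : B, star r = r ∧ r + r * c = c ∧ r * c = c * r := by
  have hsa : IsSelfAdjoint c := .of_nonneg hc
  -- The absolute value keeps the function continuous on all of `ℝ` and changes nothing on the
  -- nonnegative spectrum. As `B` may lack a unit, `1 - r` plays the role of `(1 + c)⁻¹`.
  have hne : ∀ t : ℝ, 1 + |t| ≠ 0 := fun t => by positivity
  have hcont : Continuous fun t : ℝ => t / (1 + |t|) :=
    continuous_id.div (by fun_prop) hne
  have e0 : cfcₙ (fun t : ℝ => t) c = c := cfcₙ_id' ℝ c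
  refine ⟨cfcₙ (fun t : ℝ => t / (1 + |t|)) c, (cfcₙ_predicate _ c : IsSelfAdjoint _).star_eq,
    ?_, ?_⟩
  · nth_rewrite 3 4 [← e0]
    rw [← cfcₙ_mul (fun t : ℝ => t / (1 + |t|)) (fun t => t) c hcont.continuousOn (by simp)
      (by fun_prop) (by simp),
      ← cfcₙ_add (fun t : ℝ => t / (1 + |t|)) _ c hcont.continuousOn (by simp)
      (by fun_prop) (by simp)]
    refine cfcₙ_congr fun t ht => ?_
    have ht0 : 0 ≤ t := quasispectrum_nonneg_of_nonneg c hc t ht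
    have := hne t
    rw [abs_of_nonneg ht0] at this ⊢
    field_simp
  · nth_rewrite 2 3 [← e0]
    exact (cfcₙ_commute_cfcₙ _ _ c).eq

/-- Take `s = b^{1/2}`, `u = b^{1/2}(b + δ)⁻¹` and `r = c(1 + c)⁻¹` for `c = u b u = b²(b + δ)⁻²`.
Where `c` is near `1` the factor `2(1 + c)⁻¹` is near `1`, so the cutdown of `c` loses little. On
the spectrum the final difference is `√t δ²/((t + δ)² + t²)`, which the inequality `2√(tδ) ≤ t + δ`
bounds by `√δ`. -/
lemma exists_regularization {b : B} (hb : 0 ≤ b) {δ : ℝ} (hδ : 0 < δ) :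
    ∃ s u r : B, star s = s ∧ star u = u ∧ star r = r ∧ s * s = b ∧
      r + r * (u * b * u) = u * b * u ∧ ‖s - s * (u * ((2 : ℝ) • (s - r * s)))‖ ≤ √δ := by
  have hsa : IsSelfAdjoint b := .of_nonneg hb
  have hpos : ∀ t : ℝ, 0 < |t| + δ := fun t => by positivity
  let fs : ℝ → ℝ := fun t => √t
  let fu : ℝ → ℝ := fun t => √t / (|t| + δ)
  let fr : ℝ → ℝ := fun t => t ^ 2 / ((|t| + δ) ^ 2 + t ^ 2)
  have hden : ∀ t : ℝ, 0 < (|t| + δ) ^ 2 + t ^ 2 := fun t => by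
    have := hpos t; positivity
  have cs : Continuous fs := Real.continuous_sqrt
  have cu : Continuous fu := Real.continuous_sqrt.div (by fun_prop) fun t => (hpos t).ne'
  have cr : Continuous fr := (continuous_pow 2).div (by fun_prop) fun t => (hden t).ne'
  have zs : fs 0 = 0 := by simp [fs]
  have zu : fu 0 = 0 := by simp [fu]
  have zr : fr 0 = 0 := by simp [fr]
  have e0 : cfcₙ (fun t : ℝ => t) b = b := cfcₙ_id' ℝ b
  have mul : ∀ {f g : ℝ → ℝ}, Continuous f → f 0 = 0 → Continuous g → g 0 = 0 →
      cfcₙ f b * cfcₙ g b = cfcₙ (fun t => f t * g t) b := fun hf hf0 hg hg0 =>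
    (cfcₙ_mul _ _ b hf.continuousOn hf0 hg.continuousOn hg0).symm
  have sub : ∀ {f g : ℝ → ℝ}, Continuous f → f 0 = 0 → Continuous g → g 0 = 0 →
      cfcₙ f b - cfcₙ g b = cfcₙ (fun t => f t - g t) b := fun hf hf0 hg hg0 =>
    (cfcₙ_sub _ _ b hf.continuousOn hf0 hg.continuousOn hg0).symm
  have hadd : ∀ {f g : ℝ → ℝ}, Continuous f → f 0 = 0 → Continuous g → g 0 = 0 →
      cfcₙ f b + cfcₙ g b = cfcₙ (fun t => f t + g t) b := fun hf hf0 hg hg0 =>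
    (cfcₙ_add _ _ b hf.continuousOn hf0 hg.continuousOn hg0).symm
  have hnn : ∀ t ∈ quasispectrum ℝ b, 0 ≤ t := quasispectrum_nonneg_of_nonneg b hb
  have hubu : cfcₙ fu b * b * cfcₙ fu b = cfcₙ (fun t => fu t * t * fu t) b := by
    nth_rewrite 2 [← e0]
    rw [mul (g := fun t => t) cu zu continuous_id rfl,
      mul (f := fun t => fu t * t) (cu.mul continuous_id) (by simp) cu zu]
  refine ⟨cfcₙ fs b, cfcₙ fu b, cfcₙ fr b, (cfcₙ_predicate _ b : IsSelfAdjoint _).star_eq,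
    (cfcₙ_predicate _ b : IsSelfAdjoint _).star_eq, (cfcₙ_predicate _ b : IsSelfAdjoint _).star_eq,
    ?_, ?_, ?_⟩
  · rw [mul cs zs cs zs]
    nth_rewrite 2 [← e0]
    exact cfcₙ_congr fun t ht => Real.mul_self_sqrt (hnn t ht)
  · rw [hubu, mul (g := fun t => fu t * t * fu t) cr zr ((cu.mul continuous_id).mul cu) (by simp),
      hadd (g := fun t => fr t * (fu t * t * fu t)) cr zr
        (cr.mul ((cu.mul continuous_id).mul cu)) (by simp)]
    refine cfcₙ_congr fun t ht => ?_
    have ht0 := hnn t ht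
    have h1 := hpos t
    have h2 := hden t
    simp only [fr, fu]
    rw [abs_of_nonneg ht0] at h1 h2 ⊢
    have e : √t / (t + δ) * t * (√t / (t + δ)) = t ^ 2 / (t + δ) ^ 2 := by
      rw [div_mul_eq_mul_div, div_mul_div_comm, mul_right_comm, Real.mul_self_sqrt ht0]
      ring
    rw [e]
    field_simp
  · rw [mul cr zr cs zs, sub (g := fun t => fr t * fs t) cs zs (cr.mul cs) (by simp [zs]),
      ← cfcₙ_smul (2 : ℝ) (fun t => fs t - fr t * fs t) b (cs.sub (cr.mul cs)).continuousOn
        (by simp [zs]),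
      mul (g := fun t => (2 : ℝ) • (fs t - fr t * fs t)) cu zu (by fun_prop) (by simp [zs]),
      mul (g := fun t => fu t * ((2 : ℝ) • (fs t - fr t * fs t))) cs zs (by fun_prop)
        (by simp [zs]),
      sub (g := fun t => fs t * (fu t * ((2 : ℝ) • (fs t - fr t * fs t)))) cs zs (by fun_prop)
        (by simp [zs])]
    refine norm_cfcₙ_le fun t ht => ?_
    have ht0 := hnn t ht
    have h1 := hpos t
    have h2 := hden t
    simp only [fr, fu, fs, smul_eq_mul]
    rw [abs_of_nonneg ht0] at h1 h2 ⊢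
    have e : √t - √t * (√t / (t + δ) * (2 * (√t - t ^ 2 / ((t + δ) ^ 2 + t ^ 2) * √t)))
        = √t * (δ ^ 2 / ((t + δ) ^ 2 + t ^ 2)) := by
      have : √t / (t + δ) * (2 * (√t - t ^ 2 / ((t + δ) ^ 2 + t ^ 2) * √t))
          = 2 * t * (t + δ) / ((t + δ) ^ 2 + t ^ 2) := by
        have h3 : √t / (t + δ) * (2 * (√t - t ^ 2 / ((t + δ) ^ 2 + t ^ 2) * √t))
          = 2 * (√t * √t) / (t + δ) * (1 - t ^ 2 / ((t + δ) ^ 2 + t ^ 2)) := by ring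
        rw [h3, Real.mul_self_sqrt ht0]
        field_simp
        ring
      rw [this]
      field_simp
      ring
    rw [e, Real.norm_of_nonneg (by positivity), mul_div_assoc', div_le_iff₀ h2]
    have h3 : √t * √δ * 2 ≤ t + δ := by
      nlinarith [sq_nonneg (√t - √δ), Real.sq_sqrt ht0, Real.sq_sqrt hδ.le]
    have h4 : √δ * √δ = δ := Real.mul_self_sqrt hδ.le
    have h5 : 0 < √δ := Real.sqrt_pos.mpr hδ
    have h6 : √t * δ ≤ √δ * (t + δ) := by
      calc √t * δ = √t * (√δ * √δ) := by rw [h4]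
        _ = √δ * (√t * √δ) := by ring
        _ ≤ √δ * (t + δ) := by
          have : 0 ≤ √t * √δ := by positivity
          gcongr
          linarith
    calc √t * δ ^ 2 = (√t * δ) * δ := by ring
      _ ≤ (√δ * (t + δ)) * (t + δ) := by gcongr; linarith
      _ ≤ √δ * ((t + δ) ^ 2 + t ^ 2) := by nlinarith [sq_nonneg t]

end Calculus

/-! ### Cutting approximants down below `Ω_ξ(1)`. -/

section CutDown

variable {A : Type u} {B : Type v} [CStarAlgebra A] [NonUnitalCStarAlgebra B]
  [PartialOrder B] [StarOrderedRing B]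
  {H : Type x} [NormedAddCommGroup H] [InnerProductSpace ℂ H] [CompleteSpace H]
  {X : Corr.{u, v, w} A B} {Y : Corr.{u, v, y} A B} {π : B →⋆ₙₐ[ℂ] (H →L[ℂ] H)}

lemma coeff_one_eq (ξ : X.carrier) : coeff X ξ 1 = rinner B (X.act 1 ξ) (X.act 1 ξ) := by
  rw [← congr_fun (coeff_act_one ξ) 1, coeff, act_one_act]

lemma coeff_one_nonneg (ξ : X.carrier) : 0 ≤ coeff X ξ 1 := by
  rw [coeff_one_eq]
  exact rinner_self_nonneg _

lemma coeffHull_one_nonneg {ψ : A → B} (hψ : ψ ∈ coeffHull Y) : 0 ≤ ψ 1 := by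
  obtain ⟨n, η, rfl⟩ := mem_coeffHull_iff.mp hψ
  rw [Finset.sum_apply]
  exact Finset.sum_nonneg fun i _ => coeff_one_nonneg _

lemma re_inner_rep_nonneg {b : B} (hb : 0 ≤ b) (h : H) : 0 ≤ (inner ℂ h (π b h)).re := by
  obtain ⟨d, rfl⟩ := exists_eq_star_mul_self hb
  rw [map_mul, map_star, mul_apply_eq_comp, ContinuousLinearMap.star_eq_adjoint,
    ContinuousLinearMap.adjoint_inner_right]
  exact inner_self_nonneg (𝕜 := ℂ)

/-- The Cauchy–Schwarz inequality for elements of `F_Y`. -/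
lemma norm_inner_coeffHull_le {ψ : A → B} (hψ : ψ ∈ coeffHull Y) (a : A) (h k : H) :
    ‖inner ℂ h (π (ψ a) k)‖
      ≤ ‖a‖ * (√(inner ℂ h (π (ψ 1) h)).re * √(inner ℂ k (π (ψ 1) k)).re) := by
  obtain ⟨n, η, rfl⟩ := mem_coeffHull_iff.mp hψ
  have hsq : ∀ i h, (inner ℂ h (π (coeff Y (η i) 1) h)).re
      = ‖vec Y π (Y.act 1 (η i)) h‖ ^ 2 := by
    intro i h
    rw [← inner_self_eq_norm_sq (𝕜 := ℂ), inner_vec, coeff_one_eq]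
    rfl
  have hle : ∀ i, ‖inner ℂ h (π (coeff Y (η i) a) k)‖
      ≤ ‖a‖ * (‖vec Y π (Y.act 1 (η i)) h‖ * ‖vec Y π (Y.act 1 (η i)) k‖) := by
    intro i
    have h1 := inner_tensorOp_vec (π := π) a 1 (Y.act 1 (η i)) h k
    rw [coeff_act_one] at h1
    have h2 : ‖(1 : commutant π)‖ ≤ 1 := ContinuousLinearMap.norm_id_le
    have h3 : ‖tensorOp Y π a 1‖ ≤ ‖a‖ :=
      (norm_tensorOp_le a 1).trans (mul_le_of_le_one_right (norm_nonneg _) h2)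
    change ‖inner ℂ h (π (coeff Y (η i) a) ((1 : commutant π).1 k))‖ ≤ _
    rw [← h1]
    refine (norm_inner_le_norm _ _).trans ?_
    calc _ ≤ ‖vec Y π (Y.act 1 (η i)) h‖ * (‖a‖ * ‖vec Y π (Y.act 1 (η i)) k‖) := by
          gcongr
          exact (ContinuousLinearMap.le_opNorm _ _).trans (by gcongr)
      _ = _ := by ring
  simp only [Finset.sum_apply, map_sum, sum_apply, inner_sum, Complex.re_sum, hsq]
  calc _ ≤ ∑ i, ‖inner ℂ h (π (coeff Y (η i) a) k)‖ := norm_sum_le _ _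
    _ ≤ ∑ i, ‖a‖ * (‖vec Y π (Y.act 1 (η i)) h‖ * ‖vec Y π (Y.act 1 (η i)) k‖) :=
        Finset.sum_le_sum fun i _ => hle i
    _ ≤ _ := by
        rw [← Finset.mul_sum]
        gcongr
        exact Real.sum_mul_le_sqrt_mul_sqrt _ _ _

/-- Domination at `1` bounds the whole map uniformly. This is what makes dominated nets σ-weakly
convergent and relatively compact. -/
lemma norm_inner_coeffHull_le_of_le {ψ : A → B} (hψ : ψ ∈ coeffHull Y) {b : B} (hb : ψ 1 ≤ b)
    (a : A) (h k : H) : ‖inner ℂ h (π (ψ a) k)‖ ≤ ‖a‖ * ‖b‖ * (‖h‖ * ‖k‖) := by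
  have key : ∀ h : H, (inner ℂ h (π (ψ 1) h)).re ≤ ‖b‖ * ‖h‖ ^ 2 := by
    intro h
    have h1 := re_inner_rep_nonneg (π := π) (sub_nonneg.mpr hb) h
    rw [map_sub, sub_apply, inner_sub_right, Complex.sub_re] at h1
    have h2 : (inner ℂ h (π b h)).re ≤ ‖b‖ * ‖h‖ ^ 2 := by
      refine (Complex.re_le_norm _).trans ((norm_inner_le_norm _ _).trans ?_)
      calc ‖h‖ * ‖π b h‖ ≤ ‖h‖ * (‖b‖ * ‖h‖) := by
            gcongr
            exact ((π b).le_opNorm h).trans (by gcongr; exact norm_rep_le π b)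
        _ = _ := by ring
    linarith
  refine (norm_inner_coeffHull_le hψ a h k).trans ?_
  have hs : ∀ h : H, √(inner ℂ h (π (ψ 1) h)).re ≤ √‖b‖ * ‖h‖ := by
    intro h
    rw [← Real.sqrt_sq (norm_nonneg h), ← Real.sqrt_mul (norm_nonneg b)]
    exact Real.sqrt_le_sqrt (key h)
  calc _ ≤ ‖a‖ * ((√‖b‖ * ‖h‖) * (√‖b‖ * ‖k‖)) := by gcongr <;> exact hs _
    _ = ‖a‖ * (√‖b‖ * √‖b‖) * (‖h‖ * ‖k‖) := by ring
    _ = _ := by rw [Real.mul_self_sqrt (norm_nonneg b)]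

/-- `Re⟨w, C w⟩ = Re⟨w, g⟩ - ‖w‖²`, and the product `‖w‖ ‖g‖` is absorbed by the squares. For `C =
π(ψ(1))` this bounds the `ψ(1)`-seminorm of `(1 + ψ(1))⁻¹ g` without any bound on `ψ(1)`. -/
lemma re_inner_le_of_add_apply_eq {C : H →L[ℂ] H} {w g : H} (h : w + C w = g) :
    (inner ℂ w (C w)).re ≤ ‖g‖ ^ 2 := by
  have h1 : (inner ℂ w g).re = ‖w‖ ^ 2 + (inner ℂ w (C w)).re := by
    rw [← h, inner_add_right, Complex.add_re]
    congr 1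
    exact inner_self_eq_norm_sq (𝕜 := ℂ) w
  have h2 : (inner ℂ w g).re ≤ ‖w‖ * ‖g‖ := (Complex.re_le_norm _).trans (norm_inner_le_norm _ _)
  nlinarith [sq_nonneg (‖w‖ - ‖g‖), sq_nonneg ‖w‖, sq_nonneg ‖g‖]

/-- Cutting down an element of `F_Y` by `2 (1 + ψ(1))⁻¹ s`. -/
lemma conj_apply_one_le {b c s r : B} (hs : star s = s) (hr : star r = r) (hss : s * s = b)
    (hrc : r + r * c = c) (hcomm : r * c = c * r) :
    star ((2 : ℝ) • (s - r * s)) * c * ((2 : ℝ) • (s - r * s)) ≤ b := by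
  have h1 : c * (s - r * s) = r * s := by
    rw [mul_sub, ← mul_assoc, ← hcomm, ← sub_mul]
    congr 1
    exact sub_eq_of_eq_add hrc.symm
  -- The identity `1 - 4c/(1 + c)² = ((1 - c)/(1 + c))²`, conjugated by `s`; here `1 - 2r` stands
  -- for `(1 - c)/(1 + c)`.
  have h2 : b - star ((2 : ℝ) • (s - r * s)) * c * ((2 : ℝ) • (s - r * s))
      = star (s - (2 : ℝ) • (r * s)) * (s - (2 : ℝ) • (r * s)) := by
    rw [mul_assoc, mul_smul_comm, h1]
    simp only [star_smul, star_sub, star_mul, hs, hr, star_trivial, smul_mul_assoc, mul_smul_comm,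
      sub_mul, mul_sub, smul_sub, smul_smul, ← hss, ← mul_assoc]
    module
  rw [← sub_nonneg, h2]
  exact star_mul_self_nonneg _

/-- Write `q = 2(1 + ψ(1))⁻¹ s` and `q₀ = 2(1 + φ(1))⁻¹ s`. The vector `w = (q - q₀)l` solves `(1 +
ψ(1))w = (φ(1) - ψ(1))q₀ l`, so it is small in the `ψ(1)`-seminorm as soon as `ψ(1)` is close to
`φ(1)` at the one vector `q₀ l`. Closeness is thus needed only at vectors chosen before `ψ`, and the
bound is free of `‖ψ(1)‖`, which is not controlled. -/
lemma norm_conj_sub_conj_le {ψ φ : A → B} (hψ : ψ ∈ coeffHull Y) {s r r₀ : B}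
    (hr₀ : star r₀ = r₀) (hrc : r + r * ψ 1 = ψ 1)
    (hcomm : r * ψ 1 = ψ 1 * r)
    (hrc₀ : r₀ + r₀ * φ 1 = φ 1) (hφ : star (φ 1) = φ 1) (a : A) (h k : H) {ε : ℝ}
    (hε : 0 ≤ ε) (hε1 : ε ≤ 1)
    (h1h : ‖π (ψ 1) (π ((2 : ℝ) • (s - r₀ * s)) h) - π (φ 1) (π ((2 : ℝ) • (s - r₀ * s)) h)‖ ≤ ε)
    (h1k : ‖π (ψ 1) (π ((2 : ℝ) • (s - r₀ * s)) k) - π (φ 1) (π ((2 : ℝ) • (s - r₀ * s)) k)‖ ≤ ε)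
    (hak : ‖π (ψ a) (π ((2 : ℝ) • (s - r₀ * s)) k) - π (φ a) (π ((2 : ℝ) • (s - r₀ * s)) k)‖ ≤ ε) :
    ‖inner ℂ h (π (star ((2 : ℝ) • (s - r * s)) * ψ a * ((2 : ℝ) • (s - r * s))) k)
      - inner ℂ h (π (star ((2 : ℝ) • (s - r₀ * s)) * φ a * ((2 : ℝ) • (s - r₀ * s))) k)‖
      ≤ ε * (‖a‖ * (2 * (‖s‖ * ‖k‖)
          + (‖(2 : ℝ) • (s - r₀ * s)‖ * ‖h‖ * (‖φ 1‖ + 1) + 1))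
          + ‖(2 : ℝ) • (s - r₀ * s)‖ * ‖h‖) := by
  set q := (2 : ℝ) • (s - r * s) with hq
  set q₀ := (2 : ℝ) • (s - r₀ * s) with hq₀
  have hconj : ∀ (p c : B), inner ℂ h (π (star p * c * p) k) = inner ℂ (π p h) (π c (π p k)) := by
    intro p c
    rw [mul_assoc, map_mul, map_star, mul_apply_eq_comp, ContinuousLinearMap.star_eq_adjoint,
      ContinuousLinearMap.adjoint_inner_right, map_mul, mul_apply_eq_comp]
  have hqadd : ∀ l, π q l + π (ψ 1) (π q l) = (2 : ℝ) • π s l := by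
    intro l
    have e : q + ψ 1 * q = (2 : ℝ) • s := by
      have : ψ 1 * r = ψ 1 - r := by rw [← hcomm]; exact eq_sub_of_add_eq' hrc
      rw [hq, mul_smul_comm, mul_sub, ← mul_assoc, this, sub_mul]
      module
    rw [← mul_apply_eq_comp, ← map_mul, ← add_apply, ← map_add, e,
      ← Complex.coe_smul, map_smul, ← Complex.coe_smul]
    rfl
  have hqadd₀ : ∀ l, π q₀ l + π (φ 1) (π q₀ l) = (2 : ℝ) • π s l := by
    intro l
    have e : q₀ + φ 1 * q₀ = (2 : ℝ) • s := by
      have h0 := congrArg star hrc₀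
      rw [star_add, star_mul, hr₀, hφ] at h0
      have : φ 1 * r₀ = φ 1 - r₀ := eq_sub_of_add_eq' h0
      rw [hq₀, mul_smul_comm, mul_sub, ← mul_assoc, this, sub_mul]
      module
    rw [← mul_apply_eq_comp, ← map_mul, ← add_apply, ← map_add, e,
      ← Complex.coe_smul, map_smul, ← Complex.coe_smul]
    rfl
  have hw : ∀ l, (π q l - π q₀ l) + π (ψ 1) (π q l - π q₀ l)
      = π (φ 1) (π q₀ l) - π (ψ 1) (π q₀ l) := by
    intro l
    have e1 := hqadd l
    have e2 := hqadd₀ l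
    rw [map_sub]
    have : π q l - π q₀ l + (π (ψ 1) (π q l) - π (ψ 1) (π q₀ l))
        = (π q l + π (ψ 1) (π q l)) - (π q₀ l + π (φ 1) (π q₀ l))
          + (π (φ 1) (π q₀ l) - π (ψ 1) (π q₀ l)) := by abel
    rw [this, e1, e2, sub_self, zero_add]
  have hsw : ∀ l, ‖π (ψ 1) (π q₀ l) - π (φ 1) (π q₀ l)‖ ≤ ε →
      √(inner ℂ (π q l - π q₀ l) (π (ψ 1) (π q l - π q₀ l))).re ≤ ε := by
    intro l hl
    rw [← Real.sqrt_sq hε]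
    refine Real.sqrt_le_sqrt ((re_inner_le_of_add_apply_eq (hw l)).trans ?_)
    rw [norm_sub_rev]
    gcongr
  have hsq : √(inner ℂ (π q k) (π (ψ 1) (π q k))).re ≤ 2 * (‖s‖ * ‖k‖) := by
    rw [← Real.sqrt_sq (show 0 ≤ 2 * (‖s‖ * ‖k‖) by positivity)]
    refine Real.sqrt_le_sqrt ((re_inner_le_of_add_apply_eq (hqadd k)).trans ?_)
    have : ‖(2 : ℝ) • π s k‖ ≤ 2 * (‖s‖ * ‖k‖) := by
      rw [norm_smul, Real.norm_of_nonneg (by norm_num : (0 : ℝ) ≤ 2)]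
      gcongr
      exact ((π s).le_opNorm k).trans (by gcongr; exact norm_rep_le π s)
    gcongr
  have hq₀h : ‖π q₀ h‖ ≤ ‖q₀‖ * ‖h‖ :=
    ((π q₀).le_opNorm h).trans (by gcongr; exact norm_rep_le π q₀)
  have hsq₀ : √(inner ℂ (π q₀ h) (π (ψ 1) (π q₀ h))).re ≤ ‖q₀‖ * ‖h‖ * (‖φ 1‖ + 1) + 1 := by
    set t := ‖q₀‖ * ‖h‖ with ht
    have ht0 : 0 ≤ t := by positivity
    have hf0 : 0 ≤ ‖φ 1‖ := norm_nonneg _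
    have e1 : ‖π (ψ 1) (π q₀ h)‖ ≤ ‖φ 1‖ * t + 1 := by
      have e2 : ‖π (φ 1) (π q₀ h)‖ ≤ ‖φ 1‖ * t :=
        ((π (φ 1)).le_opNorm _).trans (by gcongr; exact norm_rep_le π (φ 1))
      have e3 := norm_sub_norm_le (π (ψ 1) (π q₀ h)) (π (φ 1) (π q₀ h))
      linarith
    rw [← Real.sqrt_sq (show 0 ≤ t * (‖φ 1‖ + 1) + 1 by positivity)]
    refine Real.sqrt_le_sqrt ((Complex.re_le_norm _).trans ((norm_inner_le_norm _ _).trans ?_))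
    calc ‖π q₀ h‖ * ‖π (ψ 1) (π q₀ h)‖ ≤ t * (‖φ 1‖ * t + 1) := by gcongr
      _ ≤ (t * (‖φ 1‖ + 1) + 1) ^ 2 := by
        nlinarith [mul_nonneg ht0 hf0, mul_nonneg (mul_nonneg ht0 ht0) hf0,
          mul_nonneg (mul_nonneg ht0 ht0) (mul_nonneg hf0 hf0), mul_nonneg ht0 ht0]
  rw [hconj, hconj]
  -- Replace `q` by `q₀` on the left, then on the right, then `ψ` by `φ`; the first two terms fall
  -- to Cauchy–Schwarz for `ψ`, the third to closeness at `q₀ k`.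
  have hsplit : inner ℂ (π q h) (π (ψ a) (π q k)) - inner ℂ (π q₀ h) (π (φ a) (π q₀ k))
      = inner ℂ (π q h - π q₀ h) (π (ψ a) (π q k))
        + inner ℂ (π q₀ h) (π (ψ a) (π q k - π q₀ k))
        + inner ℂ (π q₀ h) (π (ψ a) (π q₀ k) - π (φ a) (π q₀ k)) := by
    simp only [inner_sub_left, inner_sub_right, map_sub]
    ring
  rw [hsplit]
  have t1 := norm_inner_coeffHull_le (π := π) hψ a (π q h - π q₀ h) (π q k)
  have t2 := norm_inner_coeffHull_le (π := π) hψ a (π q₀ h) (π q k - π q₀ k)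
  have t3 : ‖inner ℂ (π q₀ h) (π (ψ a) (π q₀ k) - π (φ a) (π q₀ k))‖ ≤ ‖q₀‖ * ‖h‖ * ε :=
    (norm_inner_le_norm _ _).trans (by gcongr)
  have t1' := t1.trans (show _ ≤ ‖a‖ * (ε * (2 * (‖s‖ * ‖k‖))) by gcongr; exact hsw h h1h)
  have t2' := t2.trans (show _ ≤ ‖a‖ * ((‖q₀‖ * ‖h‖ * (‖φ 1‖ + 1) + 1) * ε) by
    gcongr; exact hsw k h1k)
  refine (norm_add₃_le).trans ((add_le_add_three t1' t2' t3).trans (le_of_eq ?_))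
  ring

lemma inner_rep_conj (p c : B) (h k : H) :
    inner ℂ h (π (star p * c * p) k) = inner ℂ (π p h) (π c (π p k)) := by
  rw [mul_assoc, map_mul, map_star, mul_apply_eq_comp, ContinuousLinearMap.star_eq_adjoint,
    ContinuousLinearMap.adjoint_inner_right, map_mul, mul_apply_eq_comp]

lemma norm_rep_apply_le (b : B) (h : H) : ‖π b h‖ ≤ ‖b‖ * ‖h‖ :=
  ((π b).le_opNorm h).trans (by gcongr; exact norm_rep_le π b)

/-- Cauchy–Schwarz controls `Ω_ξ(a)` by the seminorm `‖s ·‖`, so it is enough that `s W` is close to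
`s`; no bound on `‖W‖` enters. -/
lemma norm_coeff_sub_conj_le (ξ : X.carrier) {s W : B} (hs : star s = s)
    (hss : s * s = coeff X ξ 1) {τ : ℝ} (hτ : ‖s - s * W‖ ≤ τ) (a : A) {h k : H} {R : ℝ}
    (hh : ‖h‖ ≤ R) (hk : ‖k‖ ≤ R) :
    ‖inner ℂ (π W h) (π (coeff X ξ a) (π W k)) - inner ℂ h (π (coeff X ξ a) k)‖
      ≤ ‖a‖ * R ^ 2 * (τ * (2 * ‖s‖ + τ)) := by
  have hτ0 : 0 ≤ τ := (norm_nonneg _).trans hτ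
  have hR : 0 ≤ R := (norm_nonneg _).trans hh
  have hsq : ∀ x : H, √(inner ℂ x (π (coeff X ξ 1) x)).re = ‖π s x‖ := by
    intro x
    rw [← hss]
    nth_rewrite 1 [← hs]
    rw [map_mul, map_star, mul_apply_eq_comp, ContinuousLinearMap.star_eq_adjoint,
      ContinuousLinearMap.adjoint_inner_right, ← Real.sqrt_sq (norm_nonneg (π s x)),
      ← inner_self_eq_norm_sq (𝕜 := ℂ)]
    rfl
  have hd : ∀ x : H, ‖x‖ ≤ R → ‖π s (x - π W x)‖ ≤ τ * R := by
    intro x hx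
    have : π s (x - π W x) = π (s - s * W) x := by
      rw [map_sub, map_sub, map_mul]; rfl
    rw [this]
    exact (norm_rep_apply_le _ _).trans (by gcongr)
  have hb : ∀ x : H, ‖x‖ ≤ R → ‖π s x‖ ≤ ‖s‖ * R := fun x hx =>
    (norm_rep_apply_le _ _).trans (by gcongr)
  have hW : ‖π s (π W h)‖ ≤ ‖s‖ * R + τ * R := by
    have : π s (π W h) = π s h - π s (h - π W h) := by rw [map_sub, sub_sub_cancel]
    rw [this]
    exact (norm_sub_le _ _).trans (add_le_add (hb h hh) (hd h hh))
  have t1 := norm_inner_coeffHull_le (π := π) (coeff_mem_coeffHull ξ) a (h - π W h) k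
  have t2 := norm_inner_coeffHull_le (π := π) (coeff_mem_coeffHull ξ) a (π W h) (k - π W k)
  rw [hsq, hsq] at t1 t2
  have e : inner ℂ h (π (coeff X ξ a) k) - inner ℂ (π W h) (π (coeff X ξ a) (π W k))
      = inner ℂ (h - π W h) (π (coeff X ξ a) k)
        + inner ℂ (π W h) (π (coeff X ξ a) (k - π W k)) := by
    simp only [inner_sub_left, inner_sub_right, map_sub]
    ring
  rw [norm_sub_rev, e]
  calc _ ≤ ‖a‖ * (τ * R * (‖s‖ * R)) + ‖a‖ * ((‖s‖ * R + τ * R) * (τ * R)) := by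
        refine (norm_add_le _ _).trans (add_le_add (t1.trans ?_) (t2.trans ?_))
        · gcongr
          exacts [hd h hh, hb k hk]
        · gcongr
          exact hd k hk
    _ = _ := by ring

/-- Strong approximants of a regularization of `Ω_ξ` can be cut down to weak approximants `ψ'` of
`Ω_ξ` with `ψ'(1) ≤ Ω_ξ(1)`. -/
theorem exists_cutdown (π : B →⋆ₙₐ[ℂ] (H →L[ℂ] H)) (Y : Corr.{u, v, y} A B) (ξ : X.carrier)
    (F : Finset A) {R ε : ℝ} (hR : 0 ≤ R) (hε : 0 < ε) :
    ∃ (ξ₀ : X.carrier) (q : B) (ε' : ℝ), 0 < ε' ∧ ∀ ψ ∈ coeffHull Y, ∃ ψ' ∈ coeffHull Y,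
      ψ' 1 ≤ coeff X ξ 1 ∧ ∀ a ∈ F, ∀ h k : H, ‖h‖ ≤ R → ‖k‖ ≤ R →
        ‖π (ψ 1) (π q h) - π (coeff X ξ₀ 1) (π q h)‖ ≤ ε' →
        ‖π (ψ 1) (π q k) - π (coeff X ξ₀ 1) (π q k)‖ ≤ ε' →
        ‖π (ψ a) (π q k) - π (coeff X ξ₀ a) (π q k)‖ ≤ ε' →
        ‖inner ℂ h (π (ψ' a) k) - inner ℂ h (π (coeff X ξ a) k)‖ < ε := by
  set b := coeff X ξ 1 with hbdef
  set α : ℝ := ∑ a ∈ F, ‖a‖ with hα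
  have hα0 : 0 ≤ α := Finset.sum_nonneg fun _ _ => norm_nonneg _
  have hαa : ∀ a ∈ F, ‖a‖ ≤ α := fun a ha =>
    Finset.single_le_sum (f := fun a : A => ‖a‖) (fun _ _ => norm_nonneg _) ha
  set D : ℝ := α * R ^ 2 * (2 * √‖b‖ + 1) with hD
  have hD0 : 0 ≤ D := by positivity
  -- `τ` is the regularization error. With `τ ≤ 1` the estimate of `norm_coeff_sub_conj_le` is at
  -- most `τ D`, half of the budget `ε`.
  set τ : ℝ := min 1 (ε / (2 * (D + 1))) with hτ
  have hτ0 : 0 < τ := by positivity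
  have hτ1 : τ ≤ 1 := min_le_left _ _
  have hτ2 : τ * (D + 1) ≤ ε / 2 := by
    have := min_le_right 1 (ε / (2 * (D + 1)))
    calc τ * (D + 1) ≤ ε / (2 * (D + 1)) * (D + 1) := by gcongr
      _ = ε / 2 := by field_simp
  obtain ⟨s, u, r₀, hs, hu, hr₀, hss, hrc₀, hτs⟩ :=
    exists_regularization (coeff_one_nonneg ξ) (δ := τ ^ 2) (by positivity)
  rw [Real.sqrt_sq hτ0.le] at hτs
  have hsn : ‖s‖ = √‖b‖ := by
    rw [hbdef, ← hss]
    nth_rewrite 2 [← hs]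
    rw [CStarRing.norm_star_mul_self, Real.sqrt_mul_self (norm_nonneg _)]
  set q := (2 : ℝ) • (s - r₀ * s) with hq
  have hφ : ∀ a, coeff X (MulOpposite.op u • ξ) a = u * coeff X ξ a * u := fun a => by
    rw [coeff_op_smul, hu]
  set C : ℝ := α * (2 * (‖s‖ * R) + (‖q‖ * R * (‖coeff X (MulOpposite.op u • ξ) 1‖ + 1) + 1))
    + ‖q‖ * R with hC
  have hC0 : 0 ≤ C := by positivity
  -- `C` bounds the factor of `ε` in `norm_conj_sub_conj_le` for `a ∈ F` and vectors of norm at most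
  -- `R`. This uses up less than the other half of `ε`.
  set ε' : ℝ := min 1 (ε / (4 * (C + 1))) with hε'
  have hε'0 : 0 < ε' := by positivity
  have hε'2 : ε' * C < ε / 2 := by
    have := min_le_right 1 (ε / (4 * (C + 1)))
    calc ε' * C ≤ ε' * (C + 1) := by gcongr; linarith
      _ ≤ ε / (4 * (C + 1)) * (C + 1) := by gcongr
      _ = ε / 4 := by field_simp
      _ < ε / 2 := by linarith
  refine ⟨MulOpposite.op u • ξ, q, ε', hε'0, fun ψ hψ => ?_⟩
  obtain ⟨r, hr, hrc, hcomm⟩ := exists_quasi_resolvent (coeffHull_one_nonneg hψ)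
  refine ⟨_, conj_mem_coeffHull hψ ((2 : ℝ) • (s - r * s)),
    conj_apply_one_le hs hr hss hrc hcomm, fun a ha h k hh hk h1 h2 h3 => ?_⟩
  have e1 := norm_conj_sub_conj_le (φ := coeff X (MulOpposite.op u • ξ)) hψ hr₀ hrc hcomm
    (by rw [hφ]; exact hrc₀) (IsSelfAdjoint.of_nonneg (coeff_one_nonneg _)).star_eq a h k
    hε'0.le (min_le_left _ _) h1 h2 h3
  have e2 := norm_coeff_sub_conj_le (π := π) ξ hs hss hτs a hh hk
  -- Conjugating the coefficient of `ξu` by `q` is conjugating `Ω_ξ` by `u q`, and `s u q` is within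
  -- `τ` of `s`.
  have e3 : inner ℂ h (π (star q * coeff X (MulOpposite.op u • ξ) a * q) k)
      = inner ℂ (π (u * q) h) (π (coeff X ξ a) (π (u * q) k)) := by
    rw [← inner_rep_conj, coeff_op_smul, star_mul]
    simp only [mul_assoc]
  rw [← hq, e3] at e1
  have e1' : ε' * (‖a‖ * (2 * (‖s‖ * ‖k‖)
      + (‖q‖ * ‖h‖ * (‖coeff X (MulOpposite.op u • ξ) 1‖ + 1) + 1)) + ‖q‖ * ‖h‖) ≤ ε' * C := by
    have := hαa a ha
    rw [hC]
    gcongr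
  have e2' : ‖a‖ * R ^ 2 * (τ * (2 * ‖s‖ + τ)) ≤ ε / 2 := by
    refine le_trans ?_ hτ2
    rw [hsn]
    calc ‖a‖ * R ^ 2 * (τ * (2 * √‖b‖ + τ)) ≤ α * R ^ 2 * (τ * (2 * √‖b‖ + 1)) := by
          have := hαa a ha
          gcongr
      _ = τ * D := by rw [hD]; ring
      _ ≤ τ * (D + 1) := by gcongr; linarith
  have := norm_sub_le_norm_sub_add_norm_sub
    (inner ℂ h (π (star ((2 : ℝ) • (s - r * s)) * ψ a * ((2 : ℝ) • (s - r * s))) k))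
    (inner ℂ (π (u * q) h) (π (coeff X ξ a) (π (u * q) k))) (inner ℂ h (π (coeff X ξ a) k))
  linarith

end CutDown

open Filter Topology

/-! ### Convergence in the σ-weak topology. -/

section SigmaWeak

variable {H : Type x} [NormedAddCommGroup H] [InnerProductSpace ℂ H] [CompleteSpace H]

lemma tendsto_sigmaWeak_iff {α : Type*} {l : Filter α} {f : α → H →L[ℂ] H} {T : H →L[ℂ] H} :
    Tendsto f l (@nhds _ (sigmaWeak H) T) ↔ ∀ s t : ℕ → H, Summable (fun n => ‖s n‖ ^ 2) →
      Summable (fun n => ‖t n‖ ^ 2) →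
      Tendsto (fun i => ∑' n, inner ℂ (s n) (f i (t n))) l (𝓝 (∑' n, inner ℂ (s n) (T (t n)))) := by
  rw [sigmaWeak, nhds_iInf, tendsto_iInf]
  constructor
  · intro h s t hs ht
    have := h ⟨(s, t), hs, ht⟩
    rwa [nhds_induced, tendsto_comap_iff] at this
  · rintro h ⟨⟨s, t⟩, hs, ht⟩
    rw [nhds_induced, tendsto_comap_iff]
    exact h s t hs ht

lemma tendsto_inner_of_tendsto_sigmaWeak {α : Type*} {l : Filter α} {f : α → H →L[ℂ] H}
    {T : H →L[ℂ] H} (h : Tendsto f l (@nhds _ (sigmaWeak H) T)) (s t : H) :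
    Tendsto (fun i => inner ℂ s (f i t)) l (𝓝 (inner ℂ s (T t))) := by
  have hsum : ∀ s : H, Summable (fun n => ‖(Pi.single 0 s : ℕ → H) n‖ ^ 2) := fun s =>
    summable_of_ne_finset_zero (s := {0}) fun n hn => by
      rw [Finset.mem_singleton] at hn
      simp [Pi.single_eq_of_ne hn]
  have := tendsto_sigmaWeak_iff.mp h _ _ (hsum s) (hsum t)
  have e : ∀ S : H →L[ℂ] H,
      ∑' n, inner ℂ ((Pi.single 0 s : ℕ → H) n) (S ((Pi.single 0 t : ℕ → H) n))
        = inner ℂ s (S t) := by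
    intro S
    rw [tsum_eq_single 0 fun n hn => by simp [Pi.single_eq_of_ne hn]]
    simp
  simpa only [e] using this

/-- Dominated convergence for the series defining a σ-weak functional, with summable bound `C ‖s n‖
‖t n‖`. -/
lemma tendsto_sigmaWeak_of_bounded {α : Type*} {l : Filter α} {f : α → H →L[ℂ] H}
    {T : H →L[ℂ] H} {C : ℝ} (hC : ∀ i s t, ‖inner ℂ s (f i t)‖ ≤ C * (‖s‖ * ‖t‖))
    (h : ∀ s t, Tendsto (fun i => inner ℂ s (f i t)) l (𝓝 (inner ℂ s (T t)))) :
    Tendsto f l (@nhds _ (sigmaWeak H) T) := by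
  refine tendsto_sigmaWeak_iff.mpr fun s t hs ht => ?_
  refine tendsto_tsum_of_dominated_convergence (bound := fun n => C * (‖s n‖ * ‖t n‖))
    (Summable.mul_left _ ?_) (fun n => h _ _) (Eventually.of_forall fun i n => hC i _ _)
  refine Summable.of_nonneg_of_le (fun n => by positivity) (fun n => ?_) (hs.add ht)
  nlinarith [sq_nonneg (‖s n‖ - ‖t n‖), sq_nonneg ‖s n‖, sq_nonneg ‖t n‖]

end SigmaWeak

/-! ### Weak containment and dominated σ-weak nets. -/

section Equivalence

variable {A : Type u} {B : Type v} [CStarAlgebra A] [NonUnitalCStarAlgebra B]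
  [PartialOrder B] [StarOrderedRing B]
  {H : Type x} [NormedAddCommGroup H] [InnerProductSpace ℂ H] [CompleteSpace H]
  {X : Corr.{u, v, w} A B} {Y : Corr.{u, v, y} A B} {π : B →⋆ₙₐ[ℂ] (H →L[ℂ] H)}

/-- Strong approximation is applied to the regularized vector `ξ₀` at the vectors `π(q)h`, with `1`
added to `F`; the cutdown then returns to `ξ`. -/
theorem WeaklyContained.exists_dominated_weak_approx (hXY : WeaklyContained π X Y)
    (hπ : Nondegenerate π) (ξ : X.carrier) (F : Finset A) (G : Finset H) {ε : ℝ} (hε : 0 < ε) :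
    ∃ ψ ∈ coeffHull Y, ψ 1 ≤ coeff X ξ 1 ∧ ∀ a ∈ F, ∀ h ∈ G, ∀ k ∈ G,
      ‖inner ℂ h (π (ψ a) k) - inner ℂ h (π (coeff X ξ a) k)‖ < ε := by
  classical
  have hR : ∀ h ∈ G, ‖h‖ ≤ ∑ h ∈ G, ‖h‖ := fun h hh =>
    Finset.single_le_sum (f := fun h : H => ‖h‖) (fun _ _ => norm_nonneg _) hh
  obtain ⟨ξ₀, q, ε', hε', hcut⟩ := exists_cutdown π Y ξ F
    (R := ∑ h ∈ G, ‖h‖) (Finset.sum_nonneg fun _ _ => norm_nonneg _) hε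
  obtain ⟨ψ, hψ, hψF⟩ := hXY.strong_approx hπ ξ₀ (insert 1 F) (G.image fun h => π q h) hε'
  obtain ⟨ψ', hψ', h1, h2⟩ := hcut ψ hψ
  refine ⟨ψ', hψ', h1, fun a ha h hh k hk => h2 a ha h k (hR h hh) (hR k hk) ?_ ?_ ?_⟩
  · exact (hψF _ (Finset.mem_insert_self _ _) _ (Finset.mem_image_of_mem _ hh)).le
  · exact (hψF _ (Finset.mem_insert_self _ _) _ (Finset.mem_image_of_mem _ hk)).le
  · exact (hψF _ (Finset.mem_insert_of_mem ha) _ (Finset.mem_image_of_mem _ hk)).le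

theorem WeaklyContained.exists_dominated_net (hXY : WeaklyContained π X Y)
    (hπ : Nondegenerate π) (ξ : X.carrier) :
    ∃ (ι : Type (max u v x)) (_ : Preorder ι) (_ : IsDirectedOrder ι)
      (_ : Nonempty ι) (ψ : ι → A → B),
      (∀ i, ψ i ∈ coeffHull Y ∧ ψ i 1 ≤ coeff X ξ 1) ∧
      ∀ a : A, Tendsto (fun i => π (ψ i a)) atTop (@nhds _ (sigmaWeak H) (π (coeff X ξ a))) := by
  classical
  -- The lift only places the index set in the universe prescribed by the statement.
  let ι := ULift.{v} (Finset A × Finset H × ℕ)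
  have : ∀ i : ι, ∃ ψ ∈ coeffHull Y, ψ 1 ≤ coeff X ξ 1 ∧ ∀ a ∈ i.down.1, ∀ h ∈ i.down.2.1,
      ∀ k ∈ i.down.2.1, ‖inner ℂ h (π (ψ a) k) - inner ℂ h (π (coeff X ξ a) k)‖
        < 1 / ((i.down.2.2 : ℝ) + 1) := fun i =>
    hXY.exists_dominated_weak_approx hπ ξ _ _ (by positivity)
  choose ψ hψ hψ1 hψa using this
  have hdir : IsDirectedOrder ι := ⟨fun i j => by
    obtain ⟨k, h1, h2⟩ := exists_ge_ge i.down j.down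
    exact ⟨⟨k⟩, h1, h2⟩⟩
  refine ⟨ι, inferInstance, hdir, ⟨⟨∅, ∅, 0⟩⟩, ψ, fun i => ⟨hψ i, hψ1 i⟩, fun a => ?_⟩
  refine tendsto_sigmaWeak_of_bounded (C := ‖a‖ * ‖coeff X ξ 1‖)
    (fun i h k => norm_inner_coeffHull_le_of_le (hψ i) (hψ1 i) a h k) fun h k => ?_
  rw [tendsto_iff_norm_sub_tendsto_zero, Metric.tendsto_atTop]
  intro ε hε
  obtain ⟨n, hn⟩ := exists_nat_one_div_lt hε
  refine ⟨⟨{a}, {h, k}, n⟩, fun i hi => ?_⟩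
  obtain ⟨h1, h2, h3⟩ : ({a} : Finset A) ⊆ i.down.1 ∧ ({h, k} : Finset H) ⊆ i.down.2.1 ∧
    n ≤ i.down.2.2 := hi
  rw [dist_zero_right, norm_norm]
  refine (hψa i a (h1 (by simp)) h (h2 (by simp)) k (h2 (by simp))).trans (lt_of_le_of_lt ?_ hn)
  have : (n : ℝ) ≤ i.down.2.2 := by exact_mod_cast h3
  gcongr

theorem weaklyContained_of_forall_exists_net
    (h : ∀ ξ : X.carrier, ∃ (ι : Type (max u v x)) (_ : Preorder ι) (_ : IsDirectedOrder ι)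
        (_ : Nonempty ι) (ψ : ι → A → B), (∀ i, ψ i ∈ coeffHull Y) ∧
        ∀ a : A, Tendsto (fun i => π (ψ i a)) atTop (@nhds _ (sigmaWeak H) (π (coeff X ξ a)))) :
    WeaklyContained π X Y := by
  refine weaklyContained_of_weak_approx fun ξ F G ε hε => ?_
  obtain ⟨ι, _, _, _, ψ, hψ, ht⟩ := h ξ
  have : ∀ᶠ i in atTop, ∀ a ∈ F, ∀ s ∈ G, ∀ t ∈ G,
      ‖inner ℂ s (π (ψ i a) t) - inner ℂ s (π (coeff X ξ a) t)‖ < ε := by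
    rw [Filter.eventually_all_finset]
    intro a _
    rw [Filter.eventually_all_finset]
    intro s _
    rw [Filter.eventually_all_finset]
    intro t _
    have := tendsto_inner_of_tendsto_sigmaWeak (ht a) s t
    exact (tendsto_iff_norm_sub_tendsto_zero.mp this).eventually (gt_mem_nhds hε)
  obtain ⟨i, hi⟩ := this.exists
  exact ⟨ψ i, hψ i, hi⟩

end Equivalence

open UniformSpace

/-! ### Elementary tensors in `X ⊗_φ C`. -/

section BaseTensor

variable {A : Type u} {B : Type v} [CStarAlgebra A] [NonUnitalCStarAlgebra B]
  [PartialOrder B] [StarOrderedRing B]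
  {C : Type x} [NonUnitalCStarAlgebra C] [PartialOrder C] [StarOrderedRing C]

variable (X : Corr.{u, v, w} A B) (φ : B →⋆ₙₐ[ℂ] C) in
/-- The elementary tensor `ξ ⊗ c` in `X ⊗_φ C`. -/
def baseVec : X.carrier →ₗ[ℂ] C →ₗ[ℂ] (baseChange X φ).carrier :=
  (TensorProduct.mk ℂ X.carrier C).compr₂
    ((Completion.toComplL : PreBase X φ →L[ℂ] BaseChange X φ) :
      PreBase X φ →ₗ[ℂ] BaseChange X φ)

variable {X : Corr.{u, v, w} A B} {φ : B →⋆ₙₐ[ℂ] C}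

lemma rinner_baseVec (ξ η : X.carrier) (c d : C) :
    rinner C (baseVec X φ ξ c) (baseVec X φ η d) = star c * (φ (rinner B ξ η) * d) :=
  congrArg MulOpposite.unop
    (baseChange_inner_coe (X := X) (φ := φ) (ξ ⊗ₜ[ℂ] c) (η ⊗ₜ[ℂ] d))

lemma act_baseVec (a : A) (ξ : X.carrier) (c : C) :
    (baseChange X φ).act a (baseVec X φ ξ c) = baseVec X φ (X.act a ξ) c :=
  baseActL_coe (X := X) (φ := φ) a (ξ ⊗ₜ[ℂ] c)

lemma coeff_baseVec (ξ : X.carrier) (c : C) (a : A) :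
    coeff (baseChange X φ) (baseVec X φ ξ c) a = star c * φ (coeff X ξ a) * c := by
  rw [coeff, act_baseVec, rinner_baseVec, mul_assoc]
  rfl

lemma baseChange_mem_of_forall_baseVec_mem {S : Submodule ℂ (baseChange X φ).carrier}
    (hS : IsClosed (S : Set (baseChange X φ).carrier))
    (h : ∀ ξ c, baseVec X φ ξ c ∈ S) (z : (baseChange X φ).carrier) : z ∈ S := by
  refine Completion.induction_on (α := PreBase X φ) (p := fun z => z ∈ S) z hS fun s => ?_
  have key : ∀ s : X.carrier ⊗[ℂ] C, Completion.coe' (α := PreBase X φ) s ∈ S := by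
    intro s
    induction s with
    | zero =>
      have : ((0 : PreBase X φ) : BaseChange X φ) ∈ S := by
        rw [Completion.coe_zero]; exact S.zero_mem
      exact this
    | tmul ξ k => exact h ξ k
    | add s t hs ht =>
      have := Completion.coe_add (α := PreBase X φ) s t
      exact this ▸ S.add_mem hs ht
  exact key s

lemma conj_mem_coeffHull_baseChange {ψ : A → B} (hψ : ψ ∈ coeffHull X) (c : C) :
    (fun a => star c * φ (ψ a) * c) ∈ coeffHull (baseChange X φ) := by
  obtain ⟨n, η, rfl⟩ := mem_coeffHull_iff.mp hψ
  refine mem_coeffHull_iff.mpr ⟨n, fun i => baseVec X φ (η i) c, ?_⟩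
  ext a
  simp [coeff_baseVec, Finset.mul_sum, Finset.sum_mul]

lemma dense_span_vec_baseVec {K : Type*} [NormedAddCommGroup K] [InnerProductSpace ℂ K]
    [CompleteSpace K] (σ : C →⋆ₙₐ[ℂ] (K →L[ℂ] K)) :
    Dense (Submodule.span ℂ {z | ∃ ξ c k, vec (baseChange X φ) σ (baseVec X φ ξ c) k = z} :
      Set (IntTensor (baseChange X φ) σ)) := by
  set S := (Submodule.span ℂ
    {z | ∃ ξ c k, vec (baseChange X φ) σ (baseVec X φ ξ c) k = z}).topologicalClosure with hS
  have hcl : IsClosed (S : Set (IntTensor (baseChange X φ) σ)) :=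
    Submodule.isClosed_topologicalClosure _
  intro z
  refine mem_of_forall_vec_mem hcl (fun ζ k => ?_) z
  refine baseChange_mem_of_forall_baseVec_mem
    (S := S.comap ((vec (baseChange X φ) σ).flip k)) (hcl.preimage (continuous_vec_left k))
    (fun ξ c => ?_) ζ
  exact Submodule.le_topologicalClosure _ (Submodule.subset_span ⟨ξ, c, k, rfl⟩)

lemma continuous_coeff_baseChange (a : A) :
    Continuous fun ζ : (baseChange X φ).carrier => coeff (baseChange X φ) ζ a :=
  MulOpposite.continuous_unop.comp
    (continuous_baseChange_inner' continuous_id (baseActL X φ a).continuous)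

end BaseTensor

/-! ### Normal faithful representations and compactness. -/

section Normal

variable {H : Type x} [NormedAddCommGroup H] [InnerProductSpace ℂ H] [CompleteSpace H]
  {M : VonNeumannAlgebra H}

/-- The identity representation of a von Neumann algebra. -/
def VN.idRep (M : VonNeumannAlgebra H) : VN M →⋆ₙₐ[ℂ] (H →L[ℂ] H) :=
  (VN.incl M).toNonUnitalStarAlgHom

lemma VN.idRep_apply (m : VN M) : VN.idRep M m = VN.incl M m := rfl

lemma VN.isFaithfulNormal_idRep : IsFaithfulNormal (VN.idRep M) where
  nondegenerate := fun h => subset_closure <| Submodule.subset_span ⟨1, h, by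
    rw [VN.idRep_apply, map_one]; rfl⟩
  injective := Subtype.val_injective
  normal := continuous_induced_dom

/-- Ultrafilter limits of bounded families in a von Neumann algebra. -/
lemma VN.exists_ultrafilter_limit {α : Type*} (U : Ultrafilter α) {m : α → VN M} {C : ℝ}
    (hC : ∀ i s t, ‖inner ℂ s (VN.incl M (m i) t)‖ ≤ C * (‖s‖ * ‖t‖)) :
    ∃ m' : VN M, ∀ s t, Tendsto (fun i => inner ℂ s (VN.incl M (m i) t)) U
      (𝓝 (inner ℂ s (VN.incl M m' t))) := by
  -- Each matrix coefficient stays in a compact disc, so it converges along the ultrafilter. The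
  -- limits form a bounded sesquilinear form, hence come from an operator.
  have hlim : ∀ s t : H, ∃ z : ℂ, ‖z‖ ≤ C * (‖s‖ * ‖t‖) ∧
      Tendsto (fun i => inner ℂ s (VN.incl M (m i) t)) U (𝓝 z) := by
    intro s t
    obtain ⟨z, hz, hz'⟩ := isCompact_iff_ultrafilter_le_nhds.mp
      (isCompact_closedBall (0 : ℂ) (C * (‖s‖ * ‖t‖)))
      (U.map fun i => inner ℂ s (VN.incl M (m i) t))
      (by
        rw [Ultrafilter.coe_map, le_principal_iff]
        exact mem_map.mpr (Filter.univ_mem' fun i => by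
          simpa using hC i s t))
    exact ⟨z, by simpa using hz, hz'⟩
  choose L hL hLt using hlim
  let f : H →ₗ⋆[ℂ] H →ₗ[ℂ] ℂ := LinearMap.mk₂'ₛₗ (starRingEnd ℂ) (RingHom.id ℂ) L
    (fun s s' t => tendsto_nhds_unique (hLt (s + s') t)
      (by simpa only [inner_add_left] using (hLt s t).add (hLt s' t)))
    (fun c s t => tendsto_nhds_unique (hLt (c • s) t)
      (by simpa only [inner_smul_left, smul_eq_mul] using (hLt s t).const_mul (starRingEnd ℂ c)))
    (fun s t t' => tendsto_nhds_unique (hLt s (t + t'))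
      (by simpa only [inner_add_right, map_add] using (hLt s t).add (hLt s t')))
    (fun c s t => tendsto_nhds_unique (hLt s (c • t))
      (by simpa only [inner_smul_right, map_smul, RingHom.id_apply, smul_eq_mul]
        using (hLt s t).const_mul c))
  let g : H →L⋆[ℂ] H →L[ℂ] ℂ := LinearMap.mkContinuous₂ f C fun s t =>
    (hL s t).trans_eq (mul_assoc _ _ _).symm
  let T : H →L[ℂ] H := ContinuousLinearMap.adjoint (InnerProductSpace.continuousLinearMapOfBilin g)
  have hT : ∀ s t, inner ℂ s (T t) = L s t := by
    intro s t
    rw [ContinuousLinearMap.adjoint_inner_right, InnerProductSpace.continuousLinearMapOfBilin_apply]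
    rfl
  -- Commuting with the commutant of `M` is preserved by weak limits, and `M` is its own
  -- bicommutant.
  have hmem : T ∈ M := by
    have : T ∈ (M : Set (H →L[ℂ] H)).centralizer.centralizer := by
      intro S hS
      ext t
      refine ext_inner_left ℂ fun s => ?_
      rw [mul_apply_eq_comp, mul_apply_eq_comp, hT, ← ContinuousLinearMap.adjoint_inner_left, hT]
      refine tendsto_nhds_unique (hLt (ContinuousLinearMap.adjoint S s) t) ?_
      refine (hLt s (S t)).congr fun i => ?_
      rw [ContinuousLinearMap.adjoint_inner_left]
      exact congrArg (inner ℂ s) congr($(hS _ (m i).2) t)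
    rw [M.centralizer_centralizer] at this
    exact this
  refine ⟨⟨T, hmem⟩, fun s t => ?_⟩
  have : inner ℂ s (VN.incl M ⟨T, hmem⟩ t) = L s t := hT s t
  rw [this]
  exact hLt s t

lemma tendsto_sigmaWeak_of_normal {K : Type*} [NormedAddCommGroup K] [InnerProductSpace ℂ K]
    [CompleteSpace K] {σ : VN M →⋆ₙₐ[ℂ] (K →L[ℂ] K)} (hσ : IsFaithfulNormal σ)
    {α : Type*} {l : Filter α} {m : α → VN M} {m₀ : VN M}
    (h : Tendsto (fun i => VN.incl M (m i)) l (@nhds _ (sigmaWeak H) (VN.incl M m₀))) :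
    Tendsto (fun i => σ (m i)) l (@nhds _ (sigmaWeak K) (σ m₀)) := by
  have h1 : Tendsto m l (@nhds _ (VN.sigmaWeak M) m₀) := by
    rw [@nhds_induced _ _ (sigmaWeak H), tendsto_comap_iff]
    exact h
  exact ((@Continuous.tendsto _ _ (VN.sigmaWeak M) (sigmaWeak K) _ hσ.normal m₀)).comp h1

/-- A faithful normal representation reflects weak convergence of bounded families. -/
lemma tendsto_inner_of_tendsto_faithful {K : Type*} [NormedAddCommGroup K]
    [InnerProductSpace ℂ K] [CompleteSpace K] {σ : VN M →⋆ₙₐ[ℂ] (K →L[ℂ] K)}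
    (hσ : IsFaithfulNormal σ) {α : Type*} {l : Filter α} {m : α → VN M} {m₀ : VN M} {C : ℝ}
    (hC : ∀ i s t, ‖inner ℂ s (VN.incl M (m i) t)‖ ≤ C * (‖s‖ * ‖t‖))
    (h : ∀ s t, Tendsto (fun i => inner ℂ s (σ (m i) t)) l (𝓝 (inner ℂ s (σ m₀ t)))) (s t : H) :
    Tendsto (fun i => inner ℂ s (VN.incl M (m i) t)) l (𝓝 (inner ℂ s (VN.incl M m₀ t))) := by
  rw [tendsto_iff_ultrafilter]
  intro U hU
  obtain ⟨m', hm'⟩ := VN.exists_ultrafilter_limit U hC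
  have h1 := tendsto_sigmaWeak_of_normal hσ (tendsto_sigmaWeak_of_bounded hC hm')
  -- By normality the images under `σ` converge both to `σ m'` and to `σ m₀`; injectivity identifies
  -- every ultrafilter limit with `m₀`.
  have h2 : m' = m₀ := by
    refine hσ.injective ?_
    ext b
    refine ext_inner_left ℂ fun a => ?_
    exact tendsto_nhds_unique (tendsto_inner_of_tendsto_sigmaWeak h1 a b)
      ((h a b).mono_left hU)
  rw [← h2]
  exact hm' s t

end Normal

/-! ### Passage between `π` and representations of `π(B)''`. -/

section BaseChangeEquivalence

variable {A : Type u} {B : Type v} [CStarAlgebra A] [NonUnitalCStarAlgebra B]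
  [PartialOrder B] [StarOrderedRing B]
  {H : Type x} [NormedAddCommGroup H] [InnerProductSpace ℂ H] [CompleteSpace H]
  {X : Corr.{u, v, w} A B} {Y : Corr.{u, v, y} A B} {π : B →⋆ₙₐ[ℂ] (H →L[ℂ] H)}

lemma incl_toBicommutant (b : B) : VN.incl (bicommutant π) (toBicommutant π b) = π b := rfl

lemma add_mem_coeffHull {ψ ψ' : A → B} (h : ψ ∈ coeffHull Y) (h' : ψ' ∈ coeffHull Y) :
    ψ + ψ' ∈ coeffHull Y := by
  have h2 := (convex_convexHull ℝ (Set.range (coeff Y))) h h' (a := 1 / 2) (b := 1 / 2)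
    (by norm_num) (by norm_num) (by norm_num)
  have h3 := smul_mem_coeffHull (Y := Y) h2 (t := 2) (by norm_num)
  rwa [smul_add, smul_smul, smul_smul, mul_one_div_cancel two_ne_zero, one_smul, one_smul] at h3

/-- The vectors `(ξ ⊗ m) ⊗ k` are total, and their coefficients are `m* Ω_ξ(a) m`. Conjugating the
net for `ξ` by `m` stays in the hull for `Y ⊗_B M`, and normality of `σ` carries its σ-weak
convergence to `K`. -/
theorem weaklyContained_baseChange {K : Type*} [NormedAddCommGroup K] [InnerProductSpace ℂ K]
    [CompleteSpace K] {σ : VN (bicommutant π) →⋆ₙₐ[ℂ] (K →L[ℂ] K)} (hσ : IsFaithfulNormal σ)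
    (h : ∀ ξ : X.carrier, ∃ (ι : Type (max u v x)) (_ : Preorder ι) (_ : IsDirectedOrder ι)
        (_ : Nonempty ι) (ψ : ι → A → B), (∀ i, ψ i ∈ coeffHull Y) ∧
        ∀ a : A, Tendsto (fun i => π (ψ i a)) atTop (@nhds _ (sigmaWeak H) (π (coeff X ξ a)))) :
    WeaklyContained σ (baseChange X (toBicommutant π)) (baseChange Y (toBicommutant π)) := by
  refine weaklyContained_of_total (dense_span_vec_baseVec σ) ?_
  rintro _ ⟨ξ, m, k, rfl⟩
  obtain ⟨ι, _, _, _, ψ, hψ, ht⟩ := h ξ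
  refine exists_vec_approx_of_tendsto (l := atTop)
    (fun i => conj_mem_coeffHull_baseChange (hψ i) m)
    (fun a T => inner_tensorOp_vec a T (baseVec X (toBicommutant π) ξ m) k k) fun a k' => ?_
  simp only [coeff_baseVec, inner_rep_conj]
  have h1 : Tendsto (fun i => VN.incl _ (toBicommutant π (ψ i a))) atTop
      (@nhds _ (sigmaWeak H) (VN.incl _ (toBicommutant π (coeff X ξ a)))) := ht a
  exact tendsto_inner_of_tendsto_sigmaWeak (tendsto_sigmaWeak_of_normal hσ h1) _ _

/-- The map `η ⊗ m ↦ (η ⊗ m h_i)_i` sends algebraic tensors into the closed subspace generated by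
the tuples `(η ⊗ h_i)_i`, by the double commutant theorem. Matrix coefficients at the `h_i` are
continuous functions of the tuple, so a single `η ∈ Y` approximates all of them. -/
lemma coeff_baseChange_mem_closure (hπ : Nondegenerate π) {ι : Type*} [Fintype ι] (h : ι → H)
    (ζ : (baseChange Y (toBicommutant π)).carrier) :
    (fun p : A × ι × ι => inner ℂ (h p.2.1)
        (VN.incl _ (coeff (baseChange Y (toBicommutant π)) ζ p.1) (h p.2.2)))
      ∈ closure (Set.range fun (η : Y.carrier) (p : A × ι × ι) =>
          inner ℂ (h p.2.1) (π (coeff Y η p.1) (h p.2.2))) := by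
  refine Completion.induction_on (α := PreBase Y (toBicommutant π))
    (p := fun ζ : (baseChange Y (toBicommutant π)).carrier => (fun p : A × ι × ι =>
      inner ℂ (h p.2.1) (VN.incl (bicommutant π)
        (coeff (baseChange Y (toBicommutant π)) ζ p.1) (h p.2.2)))
      ∈ closure (Set.range fun (η : Y.carrier) (p : A × ι × ι) =>
          inner ℂ (h p.2.1) (π (coeff Y η p.1) (h p.2.2)))) ζ ?_ fun s => ?_
  · refine isClosed_closure.preimage (continuous_pi fun p => ?_)
    have h1 : Continuous (VN.incl (bicommutant π)) := continuous_subtype_val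
    exact continuous_const.inner (((ContinuousLinearMap.apply ℂ H (h p.2.2)).continuous).comp
      (h1.comp (continuous_coeff_baseChange p.1)))
  · let ev : ι → Y.carrier ⊗[ℂ] VN (bicommutant π) →ₗ[ℂ] IntTensor Y π := fun i =>
      TensorProduct.lift ((vec Y π).compl₂
        ((ContinuousLinearMap.apply ℂ H (h i)).toLinearMap ∘ₗ
          (VN.incl (bicommutant π)).toLinearMap))
    have hev : ∀ i η m, ev i (η ⊗ₜ m) = vec Y π η (VN.incl (bicommutant π) m (h i)) :=
      fun _ _ _ => rfl
    have hmem : ∀ s, (fun i => ev i s) ∈ vecSubmodule Y π h := by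
      intro s
      induction s with
      | zero =>
        simp only [map_zero]
        exact (vecSubmodule Y π h).zero_mem
      | add s t hs ht =>
        simp only [map_add]
        exact (vecSubmodule Y π h).add_mem hs ht
      | tmul η m =>
        simp only [hev]
        exact vec_mem_closure (mem_closure_of_mem_bicommutant hπ m h) η
    have hin : ∀ (a : A) (i j : ι) (s t : Y.carrier ⊗[ℂ] VN (bicommutant π)),
        inner ℂ (ev i s) (tensorOp Y π a 1 (ev j t)) = inner ℂ (h i) (VN.incl (bicommutant π)
          (intForm (mulForm _) (mulEnd (toBicommutant π)) s
            (TensorProduct.map (Y.act a) LinearMap.id t)) (h j)) := by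
      intro a i j s t
      induction s with
      | zero => simp
      | add s₁ s₂ h₁ h₂ =>
        simp only [map_add, inner_add_left, h₁, h₂, LinearMap.add_apply, add_apply,
          inner_add_right]
      | tmul η m =>
        induction t with
        | zero => simp
        | add t₁ t₂ h₁ h₂ => simp only [map_add, inner_add_right, h₁, h₂, add_apply]
        | tmul η' m' =>
          rw [hev, hev, tensorOp_vec, inner_vec, TensorProduct.map_tmul, intForm_tmul,
            mulForm_apply, mulEnd_apply, map_mul, map_star, map_mul, incl_toBicommutant,
            mul_apply_eq_comp, mul_apply_eq_comp, ContinuousLinearMap.star_eq_adjoint,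
            ContinuousLinearMap.adjoint_inner_right]
          rfl
    have hco : ∀ a, coeff (baseChange Y (toBicommutant π))
        (Completion.coe' (α := PreBase Y (toBicommutant π)) s) a
        = baseForm Y (toBicommutant π) s (baseAct Y (toBicommutant π) a s) := by
      intro a
      have e1 : (baseChange Y (toBicommutant π)).act a
          (Completion.coe' (α := PreBase Y (toBicommutant π)) s)
          = Completion.coe' (α := PreBase Y (toBicommutant π))
            (baseAct Y (toBicommutant π) a s) := baseActL_coe a s
      exact (congrArg (rinner (VN (bicommutant π)) _) e1).trans
        (congrArg MulOpposite.unop (baseChange_inner_coe s _))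
    have hfin := map_mem_closure (f := fun (z : ι → IntTensor Y π) (p : A × ι × ι) =>
      inner ℂ (z p.2.1) (tensorOp Y π p.1 1 (z p.2.2))) (by fun_prop) (hmem s)
      (t := Set.range fun (η : Y.carrier) (p : A × ι × ι) =>
          inner ℂ (h p.2.1) (π (coeff Y η p.1) (h p.2.2))) (by
        rintro _ ⟨η, rfl⟩
        refine ⟨η, ?_⟩
        ext p
        exact (inner_tensorOp_vec p.1 1 η (h p.2.1) (h p.2.2)).symm)
    convert hfin using 1
    ext p
    exact (congrArg (fun m => inner ℂ (h p.2.1) (VN.incl (bicommutant π) m (h p.2.2)))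
      (hco p.1)).trans
      (hin p.1 p.2.1 p.2.2 s s).symm

lemma exists_weak_approx_of_mem_coeffHull_baseChange (hπ : Nondegenerate π)
    {ψ : A → VN (bicommutant π)} (hψ : ψ ∈ coeffHull (baseChange Y (toBicommutant π)))
    (F : Finset A) (G : Finset H) {ε : ℝ} (hε : 0 < ε) :
    ∃ ψ' ∈ coeffHull Y, ∀ a ∈ F, ∀ s ∈ G, ∀ t ∈ G,
      ‖inner ℂ s (π (ψ' a) t) - inner ℂ s (VN.incl _ (ψ a) t)‖ < ε := by
  -- `F_Y` is closed under addition, so its weak closure is too; this handles sums of coefficients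
  -- of `Y ⊗_B M` at once.
  let S : AddSubmonoid (A × G × G → ℂ) :=
    { carrier := (fun (ψ' : A → B) (p : A × G × G) =>
        (inner ℂ (p.2.1 : H) (π (ψ' p.1) (p.2.2 : H)) : ℂ)) '' coeffHull Y
      zero_mem' := ⟨0, zero_mem_coeffHull, by ext; simp⟩
      add_mem' := by
        rintro _ _ ⟨ψ₁, h₁, rfl⟩ ⟨ψ₂, h₂, rfl⟩
        exact ⟨ψ₁ + ψ₂, add_mem_coeffHull h₁ h₂, by ext; simp⟩ }
  have hmem : (fun p : A × G × G => (inner ℂ (p.2.1 : H) (VN.incl _ (ψ p.1) (p.2.2 : H)) : ℂ))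
      ∈ S.topologicalClosure := by
    obtain ⟨n, ζ, rfl⟩ := mem_coeffHull_iff.mp hψ
    have e : (fun p : A × G × G => (inner ℂ (p.2.1 : H) (VN.incl (bicommutant π)
        ((∑ i, coeff (baseChange Y (toBicommutant π)) (ζ i)) p.1) (p.2.2 : H)) : ℂ))
        = ∑ i, fun p : A × G × G => (inner ℂ (p.2.1 : H) (VN.incl (bicommutant π)
          (coeff (baseChange Y (toBicommutant π)) (ζ i) p.1) (p.2.2 : H)) : ℂ) := by
      ext p
      simp [Finset.sum_apply, map_sum, sum_apply]
    rw [e]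
    refine sum_mem fun i _ => ?_
    refine closure_mono ?_ (coeff_baseChange_mem_closure hπ (fun g : G => (g : H)) (ζ i))
    rintro _ ⟨η, rfl⟩
    exact ⟨coeff Y η, coeff_mem_coeffHull η, rfl⟩
  have hev : ∀ᶠ f in 𝓝 (fun p : A × G × G =>
      (inner ℂ (p.2.1 : H) (VN.incl _ (ψ p.1) (p.2.2 : H)) : ℂ)), ∀ a ∈ F, ∀ s t : G,
      ‖f (a, s, t) - inner ℂ (s : H) (VN.incl _ (ψ a) (t : H))‖ < ε := by
    rw [Filter.eventually_all_finset]
    intro a _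
    rw [Filter.eventually_all]
    intro s
    rw [Filter.eventually_all]
    intro t
    have hc : Continuous fun f : A × G × G → ℂ =>
      ‖f (a, s, t) - inner ℂ (s : H) (VN.incl _ (ψ a) (t : H))‖ := by fun_prop
    refine hc.continuousAt.eventually (gt_mem_nhds ?_)
    simpa using hε
  obtain ⟨_, ⟨ψ', hψ', rfl⟩, h2⟩ :=
    ((mem_closure_iff_frequently.mp hmem).and_eventually hev).exists
  exact ⟨ψ', hψ', fun a ha s hs t ht => h2 a ha ⟨s, hs⟩ ⟨t, ht⟩⟩

/-- The coefficient of `ξ ⊗ 1` is `Ω_ξ`, viewed in `M`. Approximating it in `K` by dominated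
elements of the hull for `Y ⊗_B M`, reflecting the convergence to `H`, and replacing these by
elements of `F_Y` costs `ε/2` twice. -/
theorem weaklyContained_of_baseChange (hπ : Nondegenerate π) {K : Type x} [NormedAddCommGroup K]
    [InnerProductSpace ℂ K] [CompleteSpace K] {σ : VN (bicommutant π) →⋆ₙₐ[ℂ] (K →L[ℂ] K)}
    (hσ : IsFaithfulNormal σ)
    (h : WeaklyContained σ (baseChange X (toBicommutant π)) (baseChange Y (toBicommutant π))) :
    WeaklyContained π X Y := by
  refine weaklyContained_of_weak_approx fun ξ F G ε hε => ?_
  obtain ⟨ι, _, _, _, ψ, hψ, ht⟩ :=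
    h.exists_dominated_net hσ.nondegenerate (baseVec X (toBicommutant π) ξ 1)
  have ht' : ∀ a s t, Tendsto (fun i => inner ℂ s (VN.incl _ (ψ i a) t)) atTop
      (𝓝 (inner ℂ s (π (coeff X ξ a) t))) := by
    intro a s t
    -- Domination at `1` supplies the uniform bound that the reflection to `H` needs.
    have := tendsto_inner_of_tendsto_faithful hσ
      (fun i s t => norm_inner_coeffHull_le_of_le (π := VN.idRep (bicommutant π))
        (hψ i).1 (hψ i).2 a s t)
      (fun s t => tendsto_inner_of_tendsto_sigmaWeak (ht a) s t) s t
    rw [coeff_baseVec, star_one, one_mul, mul_one] at this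
    exact this
  have hev : ∀ᶠ i in atTop, ∀ a ∈ F, ∀ s ∈ G, ∀ t ∈ G,
      ‖inner ℂ s (VN.incl _ (ψ i a) t) - inner ℂ s (π (coeff X ξ a) t)‖ < ε / 2 := by
    rw [Filter.eventually_all_finset]
    intro a _
    rw [Filter.eventually_all_finset]
    intro s _
    rw [Filter.eventually_all_finset]
    intro t _
    exact (tendsto_iff_norm_sub_tendsto_zero.mp (ht' a s t)).eventually (gt_mem_nhds (half_pos hε))
  obtain ⟨i, hi⟩ := hev.exists
  obtain ⟨ψ', hψ', hψa⟩ :=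
    exists_weak_approx_of_mem_coeffHull_baseChange hπ (hψ i).1 F G (half_pos hε)
  refine ⟨ψ', hψ', fun a ha s hs t ht => ?_⟩
  have h1 := norm_sub_le_norm_sub_add_norm_sub (inner ℂ s (π (ψ' a) t))
    (inner ℂ s (VN.incl _ (ψ i a) t)) (inner ℂ s (π (coeff X ξ a) t))
  have h2 := hi a ha s hs t ht
  have h3 := hψa a ha s hs t ht
  linarith

end BaseChangeEquivalence

/-! ### Decomposition of functionals and GNS vectors. -/

section PositiveFunctionals

variable {B : Type v} [NonUnitalCStarAlgebra B] [PartialOrder B] [StarOrderedRing B]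

/-- A bounded real functional is dominated on the positive cone by a positive one. -/
lemma exists_nonneg_dominating (f : B →ₗ[ℝ] ℝ) {C : ℝ} (hC : 0 ≤ C) (hf : ∀ b, f b ≤ C * ‖b‖) :
    ∃ g : B →ₗ[ℝ] ℝ, ∀ k, 0 ≤ k → 0 ≤ g k ∧ f k ≤ g k := by
  let P := {k : B // 0 ≤ k}
  -- `N` is the infimum of `C‖x + k + l‖ - f(k)` over `k, l ≥ 0`. A functional `g ≤ N` satisfies
  -- `g(-k) ≤ -f(k)` and `g(-k) ≤ 0`, by cancelling `-k` with either positive term. The infimum is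
  -- finite since `‖k‖ ≤ ‖k + l‖`.
  let N : B → ℝ := fun x => ⨅ p : P × P, (C * ‖x + (p.1.1 + p.2.1)‖ - f p.1.1)
  have hne : Nonempty (P × P) := ⟨⟨0, le_rfl⟩, ⟨0, le_rfl⟩⟩
  have hlow : ∀ (x : B) (p : P × P), -(C * ‖x‖) ≤ C * ‖x + (p.1.1 + p.2.1)‖ - f p.1.1 := by
    rintro x ⟨⟨k, hk⟩, ⟨l, hl⟩⟩
    have h1 : ‖k‖ ≤ ‖k + l‖ :=
      CStarAlgebra.norm_le_norm_of_nonneg_of_le hk (le_add_of_nonneg_right hl)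
    have h2 : ‖k + l‖ ≤ ‖x + (k + l)‖ + ‖x‖ := by
      have := norm_sub_le (x + (k + l)) x
      rwa [add_sub_cancel_left] at this
    have h3 := hf k
    have h4 : C * ‖k‖ ≤ C * (‖x + (k + l)‖ + ‖x‖) := by gcongr; exact h1.trans h2
    simp only
    linarith
  have hbdd : ∀ x, BddBelow (Set.range fun p : P × P => C * ‖x + (p.1.1 + p.2.1)‖ - f p.1.1) :=
    fun x => ⟨_, by rintro _ ⟨p, rfl⟩; exact hlow x p⟩
  have hle : ∀ (x k l : B), 0 ≤ k → 0 ≤ l → N x ≤ C * ‖x + (k + l)‖ - f k := fun x k l hk hl =>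
    ciInf_le (hbdd x) (⟨k, hk⟩, ⟨l, hl⟩)
  have hsm : ∀ c : ℝ, 0 < c → ∀ x, N (c • x) ≤ c * N x := by
    intro c hc x
    rw [Real.mul_iInf_of_nonneg hc.le]
    refine le_ciInf fun p => ?_
    refine (hle (c • x) (c • p.1.1) (c • p.2.1) (smul_nonneg hc.le p.1.2)
      (smul_nonneg hc.le p.2.2)).trans_eq ?_
    rw [← smul_add, ← smul_add, norm_smul, map_smul, Real.norm_of_nonneg hc.le, smul_eq_mul]
    ring
  -- Hahn–Banach from the zero subspace: only the bound by `N` is wanted.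
  obtain ⟨g, -, hg⟩ := exists_extension_of_le_sublinear (⊥ : B →ₗ.[ℝ] ℝ) N
    (fun c hc x => by
      refine le_antisymm (hsm c hc x) ?_
      have := hsm c⁻¹ (inv_pos.mpr hc) (c • x)
      rw [smul_smul, inv_mul_cancel₀ hc.ne', one_smul] at this
      calc c * N x ≤ c * (c⁻¹ * N (c • x)) := by gcongr
        _ = N (c • x) := by rw [← mul_assoc, mul_inv_cancel₀ hc.ne', one_mul])
    (fun x y => by
      refine le_ciInf_add_ciInf fun p q => ?_
      refine (hle (x + y) (p.1.1 + q.1.1) (p.2.1 + q.2.1) (add_nonneg p.1.2 q.1.2)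
        (add_nonneg p.2.2 q.2.2)).trans ?_
      have h1 : x + y + (p.1.1 + q.1.1 + (p.2.1 + q.2.1))
          = (x + (p.1.1 + p.2.1)) + (y + (q.1.1 + q.2.1)) := by abel
      have h2 := mul_le_mul_of_nonneg_left
        (norm_add_le (x + (p.1.1 + p.2.1)) (y + (q.1.1 + q.2.1))) hC
      rw [h1, map_add]
      linarith)
    (by
      rintro ⟨x, hx⟩
      obtain rfl : x = 0 := (Submodule.mem_bot ℝ).mp hx
      have h1 : (⊥ : B →ₗ.[ℝ] ℝ) ⟨0, hx⟩ = 0 := LinearPMap.map_zero _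
      rw [h1]
      refine le_ciInf fun p => ?_
      have := hlow 0 p
      rwa [norm_zero, mul_zero, neg_zero] at this)
  refine ⟨g, fun k hk => ⟨?_, ?_⟩⟩
  · have h1 := (hg (-k)).trans (hle (-k) 0 k le_rfl hk)
    rw [map_neg, zero_add, neg_add_cancel, norm_zero, map_zero] at h1
    linarith
  · have h1 := (hg (-k)).trans (hle (-k) k 0 hk le_rfl)
    rw [map_neg, add_zero, neg_add_cancel, norm_zero] at h1
    linarith

open scoped ComplexStarModule in
/-- The hermitian complex functional extending a real functional on the self-adjoint part. -/
def hermitianExtension : (B →ₗ[ℝ] ℝ) →+ (B →ₗ[ℂ] ℂ) where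
  toFun g :=
    { toFun := fun x => (g (ℜ x) : ℂ) + Complex.I * g (ℑ x)
      map_add' := fun x y => by
        simp only [map_add, AddSubgroup.coe_add, Complex.ofReal_add]
        ring
      map_smul' := fun c x => by
        simp only [realPart_smul, imaginaryPart_smul, AddSubgroup.coe_add, AddSubgroupClass.coe_sub,
          selfAdjoint.val_smul, map_add, map_sub, map_smul, smul_eq_mul, RingHom.id_apply]
        apply Complex.ext <;> simp }
  map_zero' := by ext; simp
  map_add' f g := by
    ext x
    simp only [LinearMap.add_apply, Complex.ofReal_add, LinearMap.coe_mk, AddHom.coe_mk]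
    ring

open scoped ComplexStarModule in
lemma hermitianExtension_apply (g : B →ₗ[ℝ] ℝ) (x : B) :
    hermitianExtension g x = (g (ℜ x) : ℂ) + Complex.I * g (ℑ x) := rfl

lemma hermitianExtension_of_nonneg (g : B →ₗ[ℝ] ℝ) {x : B} (hx : 0 ≤ x) :
    hermitianExtension g x = g x := by
  have hsa : IsSelfAdjoint x := .of_nonneg hx
  rw [hermitianExtension_apply, hsa.coe_realPart, hsa.imaginaryPart]
  simp

/-- Every bounded functional is a linear combination of positive ones. -/
theorem mem_span_positive (f : B →L[ℂ] ℂ) :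
    (f : B →ₗ[ℂ] ℂ) ∈ Submodule.span ℂ {p : B →ₗ[ℂ] ℂ | ∀ b, 0 ≤ b → 0 ≤ p b} := by
  set S := Submodule.span ℂ {p : B →ₗ[ℂ] ℂ | ∀ b, 0 ≤ b → 0 ≤ p b} with hS
  -- A dominating positive `p` writes `g` on the self-adjoint part as the difference of the positive
  -- functionals `p` and `p - g`.
  have key : ∀ g : B →ₗ[ℝ] ℝ, (∀ b, g b ≤ ‖f‖ * ‖b‖) → hermitianExtension g ∈ S := by
    intro g hg
    obtain ⟨p, hp⟩ := exists_nonneg_dominating g (norm_nonneg f) hg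
    have h1 : hermitianExtension p ∈ S := Submodule.subset_span fun b hb => by
      rw [hermitianExtension_of_nonneg p hb]
      exact_mod_cast (hp b hb).1
    have h2 : hermitianExtension (p - g) ∈ S := Submodule.subset_span fun b hb => by
      rw [hermitianExtension_of_nonneg _ hb, LinearMap.sub_apply]
      exact_mod_cast sub_nonneg.mpr (hp b hb).2
    have : hermitianExtension g = hermitianExtension p - hermitianExtension (p - g) := by
      rw [← map_sub, sub_sub_cancel]
    rw [this]
    exact S.sub_mem h1 h2
  let re : B →ₗ[ℝ] ℝ := Complex.reLm ∘ₗ (f : B →ₗ[ℂ] ℂ).restrictScalars ℝ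
  let im : B →ₗ[ℝ] ℝ := Complex.imLm ∘ₗ (f : B →ₗ[ℂ] ℂ).restrictScalars ℝ
  have hre := key re fun b => (Complex.re_le_norm _).trans (f.le_opNorm b)
  have him := key im fun b => (Complex.im_le_norm _).trans (f.le_opNorm b)
  have : (f : B →ₗ[ℂ] ℂ) = hermitianExtension re + Complex.I • hermitianExtension im := by
    ext x
    have hx : f x = f (realPart x) + Complex.I * f (imaginaryPart x) := by
      nth_rewrite 1 [← realPart_add_I_smul_imaginaryPart x]
      rw [map_add, map_smul, smul_eq_mul]
    rw [LinearMap.add_apply, LinearMap.smul_apply, hermitianExtension_apply,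
      hermitianExtension_apply]
    change f x = ((f (realPart x)).re : ℂ) + Complex.I * ((f (imaginaryPart x)).re : ℂ)
      + Complex.I * (((f (realPart x)).im : ℂ) + Complex.I * ((f (imaginaryPart x)).im : ℂ))
    rw [hx]
    apply Complex.ext <;> simp
    ring
  rw [this]
  exact S.add_mem hre (S.smul_mem _ him)

/-- The cyclic vector of the GNS representation. -/
theorem exists_gns_cyclic_vector (f : B →ₚ[ℂ] ℂ) :
    ∃ Ω : f.GNS, (∀ b, f.gnsNonUnitalStarAlgHom b Ω = (f.toPreGNS b : f.GNS)) ∧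
      ∀ b, inner ℂ Ω (f.gnsNonUnitalStarAlgHom b Ω) = f b := by
  obtain ⟨C, hC⟩ := f.exists_norm_apply_le
  have hcont : Continuous f := by fun_prop
  -- Without a unit the cyclic vector comes from Riesz. Along an approximate unit, `f(e z)` is the
  -- inner product of the class of `e*` with `z`, and the squared norm of that class is `f(e e*) ≤
  -- C`; hence `f` is bounded in the GNS norm.
  have hbound : ∀ z : f.PreGNS, ‖f (f.ofPreGNS z)‖ ≤ √C * ‖z‖ := by
    intro z
    have hau := CStarAlgebra.increasingApproximateUnit B
    have ht : Tendsto (fun e => ‖f (e * f.ofPreGNS z)‖) (CStarAlgebra.approximateUnit B)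
        (𝓝 ‖f (f.ofPreGNS z)‖) :=
      ((hcont.tendsto _).comp (hau.tendsto_mul_right (f.ofPreGNS z))).norm
    refine le_of_tendsto ht (hau.eventually_norm.mono fun e he => ?_)
    have h1 : f (e * f.ofPreGNS z) = inner ℂ (f.toPreGNS (star e)) z := by
      rw [PositiveLinearMap.preGNS_inner_def, PositiveLinearMap.ofPreGNS_toPreGNS, star_star]
    rw [h1]
    refine (norm_inner_le_norm _ _).trans ?_
    gcongr
    rw [PositiveLinearMap.preGNS_norm_def]
    refine Real.sqrt_le_sqrt ((Complex.re_le_norm _).trans ((hC _).trans ?_))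
    rw [PositiveLinearMap.ofPreGNS_toPreGNS, CStarRing.norm_star_mul_self, norm_star]
    exact mul_le_of_le_one_right C.2 (mul_le_one₀ he (norm_nonneg _) he)
  let F₀ : f.PreGNS →L[ℂ] ℂ := LinearMap.mkContinuous
    (f.toLinearMap ∘ₗ (f.ofPreGNS : f.PreGNS →ₗ[ℂ] B)) (√C) hbound
  let F : f.GNS →L[ℂ] ℂ := F₀.extend Completion.toComplL
  have hF : ∀ z : f.PreGNS, F (z : f.GNS) = f (f.ofPreGNS z) := fun z =>
    ContinuousLinearMap.extend_eq F₀ Completion.denseRange_coe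
      (Completion.isUniformInducing_coe f.PreGNS) z
  let Ω : f.GNS := (InnerProductSpace.toDual ℂ f.GNS).symm F
  have hΩ : ∀ z : f.PreGNS, inner ℂ Ω (z : f.GNS) = f (f.ofPreGNS z) := fun z => by
    rw [InnerProductSpace.toDual_symm_apply, hF]
  have hcyc : ∀ b, f.gnsNonUnitalStarAlgHom b Ω = (f.toPreGNS b : f.GNS) := by
    intro b
    refine ext_inner_right ℂ fun z => ?_
    induction z using Completion.induction_on with
    | hp => exact isClosed_eq (by fun_prop) (by fun_prop)
    | ih z =>
      rw [← ContinuousLinearMap.adjoint_inner_right, ← ContinuousLinearMap.star_eq_adjoint,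
        ← map_star, PositiveLinearMap.gnsNonUnitalStarAlgHom_apply_coe, hΩ, Completion.inner_coe,
        PositiveLinearMap.preGNS_inner_def]
      rfl
  refine ⟨Ω, hcyc, fun b => ?_⟩
  rw [hcyc, hΩ, PositiveLinearMap.ofPreGNS_toPreGNS]

end PositiveFunctionals

/-! ### The universal representation. -/

section Universal

variable {B : Type v} [NonUnitalCStarAlgebra B] [PartialOrder B] [StarOrderedRing B]

lemma universalRep_apply_coe (b : B) (z : UnivSpace B) (f : State B) :
    universalRep B b z f = f.1.gnsNonUnitalStarAlgHom b (z f) := rfl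

/-- In each summand the class of `b` is `b` applied to the cyclic vector; such vectors, placed in
one summand, are total. -/
lemma nondegenerate_universalRep : Nondegenerate (universalRep B) := by
  classical
  intro z
  set S := (Submodule.span ℂ
    {h : UnivSpace B | ∃ (b : B) (k : UnivSpace B), universalRep B b k = h}).topologicalClosure
  have hcl : IsClosed (S : Set (UnivSpace B)) := Submodule.isClosed_topologicalClosure _
  have hsingle : ∀ (f : State B) (a : f.1.GNS), lp.single 2 f a ∈ S := by
    intro f a
    obtain ⟨Ω, hΩ, -⟩ := exists_gns_cyclic_vector f.1
    refine Completion.induction_on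
      (p := fun a : f.1.GNS => lp.single (E := fun f : State B => f.1.GNS) 2 f a ∈ S) a
      (hcl.preimage
        (lp.singleContinuousLinearMap ℂ (fun f : State B => f.1.GNS) 2 f).continuous) fun b => ?_
    refine Submodule.le_topologicalClosure _ (Submodule.subset_span
      ⟨f.1.ofPreGNS b, lp.single 2 f Ω, ?_⟩)
    ext g
    rw [universalRep_apply_coe]
    by_cases hg : g = f
    · subst hg
      rw [lp.single_apply_self, lp.single_apply_self, hΩ]
      rfl
    · rw [lp.single_apply_ne _ _ _ hg, lp.single_apply_ne _ _ _ hg, map_zero]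
  exact hcl.mem_of_tendsto (lp.hasSum_single (by simp) z)
    (Eventually.of_forall fun s => S.sum_mem fun f _ => hsingle f _)

/-- A nonzero positive functional is `‖f‖` times a state, so `√‖f‖` times the cyclic vector of that
state's summand represents it. -/
theorem exists_universalRep_vector (f : B →ₚ[ℂ] ℂ) :
    ∃ z : UnivSpace B, ∀ b, inner ℂ z (universalRep B b z) = f b := by
  classical
  let F : B →L[ℂ] ℂ := ⟨f.toLinearMap, by exact (by fun_prop : Continuous f)⟩
  have hF : ∀ b, F b = f b := fun _ => rfl
  rcases eq_or_ne F 0 with h0 | h0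
  · exact ⟨0, fun b => by rw [inner_zero_left, ← hF, h0]; rfl⟩
  have hn : 0 < ‖F‖ := norm_pos_iff.mpr h0
  let p : B →ₚ[ℂ] ℂ := PositiveLinearMap.mk₀ (((‖F‖⁻¹ : ℝ) : ℂ) • f.toLinearMap) fun b hb =>
    mul_nonneg (by exact_mod_cast (inv_pos.mpr hn).le) (f.map_nonneg hb)
  have hp : ∀ b, p b = ((‖F‖⁻¹ : ℝ) : ℂ) * f b := fun _ => rfl
  have hstate : IsLUB ((fun b : B => ‖p b‖) '' Metric.closedBall 0 1) 1 := by
    let G : B →L[ℂ] ℂ := ((‖F‖⁻¹ : ℝ) : ℂ) • F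
    have hG : ‖G‖ = 1 := by
      rw [norm_smul, Complex.norm_real, norm_inv, norm_norm, inv_mul_cancel₀ hn.ne']
    have := G.sSup_unitClosedBall_eq_norm
    rw [hG] at this
    change IsLUB ((fun b : B => ‖G b‖) '' Metric.closedBall 0 1) 1
    have hlub : IsLUB ((fun b : B => ‖G b‖) '' Metric.closedBall 0 1) _ :=
      isLUB_csSup ((Metric.nonempty_closedBall.mpr zero_le_one).image _) ⟨1, by
        rintro _ ⟨b, hb, rfl⟩
        rw [mem_closedBall_zero_iff] at hb
        exact (G.le_opNorm b).trans (by rw [hG, one_mul]; exact hb)⟩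
    rwa [this] at hlub
  let q : State B := ⟨p, hstate⟩
  obtain ⟨Ω, -, hΩ⟩ := exists_gns_cyclic_vector q.1
  refine ⟨((√‖F‖ : ℝ) : ℂ) • lp.single 2 q Ω, fun b => ?_⟩
  rw [map_smul, inner_smul_left, inner_smul_right, lp.inner_single_left, universalRep_apply_coe,
    lp.single_apply_self, hΩ]
  change _ * (_ * (((‖F‖⁻¹ : ℝ) : ℂ) * f b)) = f b
  rw [Complex.conj_ofReal, ← mul_assoc, ← mul_assoc, ← Complex.ofReal_mul, ← Complex.ofReal_mul,
    Real.mul_self_sqrt hn.le, mul_inv_cancel₀ hn.ne', Complex.ofReal_one, one_mul]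

/-- Weak operator convergence in the universal representation is weak convergence. -/
theorem tendsto_of_tendsto_universalRep (f : B →L[ℂ] ℂ) {α : Type*} {l : Filter α} {m : α → B}
    {b : B} (h : ∀ s, Tendsto (fun i => inner ℂ s (universalRep B (m i) s)) l
      (𝓝 (inner ℂ s (universalRep B b s)))) :
    Tendsto (fun i => f (m i)) l (𝓝 (f b)) := by
  have hall : ∀ g ∈ Submodule.span ℂ {p : B →ₗ[ℂ] ℂ | ∀ b, 0 ≤ b → 0 ≤ p b},
      Tendsto (fun i => g (m i)) l (𝓝 (g b)) := by
    intro g hg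
    induction hg using Submodule.span_induction with
    | mem p hp =>
      obtain ⟨z, hz⟩ := exists_universalRep_vector (PositiveLinearMap.mk₀ p hp)
      have := h z
      simp only [hz] at this
      exact this
    | zero => exact tendsto_const_nhds
    | add g g' _ _ hg hg' => exact hg.add hg'
    | smul c g _ hg => exact hg.const_mul c
  exact hall _ (mem_span_positive f)

/-- Applied to a constant net, weak convergence shows that every bounded functional vanishes on the
kernel. -/
lemma injective_universalRep : Function.Injective (universalRep B) := by
  rw [injective_iff_map_eq_zero]
  intro b hb
  refine SeparatingDual.eq_zero_of_forall_dual_eq_zero (R := ℂ) fun f => ?_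
  have := tendsto_of_tendsto_universalRep f (l := (⊤ : Filter Unit)) (m := fun _ => b) (b := 0)
    (fun s => by rw [map_zero, hb]; exact tendsto_const_nhds)
  rw [map_zero] at this
  exact tendsto_nhds_unique tendsto_const_nhds this

lemma norm_universalRep (b : B) : ‖universalRep B b‖ = ‖b‖ :=
  NonUnitalStarAlgHom.norm_map _ injective_universalRep b

end Universal

/-! ### Point-norm approximation over the universal representation. -/

section UniversalEquivalence

variable {A : Type u} {B : Type v} [CStarAlgebra A] [NonUnitalCStarAlgebra B]
  [PartialOrder B] [StarOrderedRing B]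
  {X : Corr.{u, v, w} A B} {Y : Corr.{u, v, y} A B}

/-- A convex set has the same weak and norm closure, here in `B^F`. The net obtained in the
universal representation converges weakly in `B^F`, so no functional separates `Ω_ξ` from `F_Y`. -/
theorem WeaklyContained.exists_norm_approx (hXY : WeaklyContained (universalRep B) X Y)
    (ξ : X.carrier) (F : Finset A) {ε : ℝ} (hε : 0 < ε) :
    ∃ ψ ∈ coeffHull Y, ∀ a ∈ F, ‖ψ a - coeff X ξ a‖ < ε := by
  classical
  let res : (A → B) →ₗ[ℝ] (F → B) := LinearMap.funLeft ℝ B Subtype.val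
  have hconv : Convex ℝ (closure (res '' coeffHull Y)) :=
    ((convex_convexHull ℝ _).linear_image res).closure
  have hmem : res (coeff X ξ) ∈ closure (res '' coeffHull Y) := by
    by_contra hnot
    obtain ⟨f, c, hfc, hcf⟩ :=
      RCLike.geometric_hahn_banach_closed_point (𝕜 := ℂ) hconv isClosed_closure hnot
    obtain ⟨ι, _, _, _, ψ, hψ, ht⟩ :=
      hXY.exists_dominated_net nondegenerate_universalRep ξ
    have hsum : ∀ v : F → B, f v
        = ∑ a, (f ∘L ContinuousLinearMap.single ℂ (fun _ : F => B) a) (v a) := by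
      intro v
      conv_lhs => rw [← Finset.univ_sum_single v]
      rw [map_sum]
      rfl
    have hlim : Tendsto (fun i => f (res (ψ i))) atTop (𝓝 (f (res (coeff X ξ)))) := by
      simp only [hsum]
      refine tendsto_finsetSum _ fun a _ => tendsto_of_tendsto_universalRep _ fun s => ?_
      exact tendsto_inner_of_tendsto_sigmaWeak (ht a.1) s s
    have hle := le_of_tendsto ((Complex.continuous_re.tendsto _).comp hlim)
      (Eventually.of_forall fun i => (hfc _ (subset_closure ⟨_, (hψ i).1, rfl⟩)).le)
    exact absurd hcf (not_lt.mpr hle)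
  obtain ⟨_, ⟨ψ, hψ, rfl⟩, hd⟩ := Metric.mem_closure_iff.mp hmem ε hε
  refine ⟨ψ, hψ, fun a ha => ?_⟩
  have := (dist_pi_lt_iff hε).mp hd ⟨a, ha⟩
  rw [dist_comm, dist_eq_norm] at this
  exact this

/-- Norm approximants of the regularized coefficient satisfy the closeness hypotheses of the cutdown
at all vectors of the unit ball simultaneously. The weak estimates after the cutdown are then
uniform there, which is a norm estimate because the universal representation is isometric. -/
theorem WeaklyContained.exists_dominated_norm_approx
    (hXY : WeaklyContained (universalRep B) X Y) (ξ : X.carrier) (F : Finset A) {ε : ℝ}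
    (hε : 0 < ε) :
    ∃ ψ ∈ coeffHull Y, ψ 1 ≤ coeff X ξ 1 ∧ ∀ a ∈ F, ‖coeff X ξ a - ψ a‖ < ε := by
  classical
  obtain ⟨ξ₀, q, ε', hε', hcut⟩ :=
    exists_cutdown (universalRep B) Y ξ F (R := 1) zero_le_one (half_pos hε)
  -- Dividing by `‖q‖ + 1` absorbs the norm of `π(q)h`, and avoids division by zero when `q = 0`.
  obtain ⟨ψ, hψ, hψF⟩ := hXY.exists_norm_approx ξ₀ (insert 1 F)
    (show 0 < ε' / (‖q‖ + 1) by positivity)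
  obtain ⟨ψ', hψ', h1, h2⟩ := hcut ψ hψ
  refine ⟨ψ', hψ', h1, fun a ha => ?_⟩
  have hclose : ∀ c ∈ insert 1 F, ∀ h : UnivSpace B, ‖h‖ ≤ 1 →
      ‖universalRep B (ψ c) (universalRep B q h)
        - universalRep B (coeff X ξ₀ c) (universalRep B q h)‖ ≤ ε' := by
    intro c hc h hh
    rw [← sub_apply, ← map_sub]
    calc _ ≤ ‖ψ c - coeff X ξ₀ c‖ * ‖universalRep B q h‖ := norm_rep_apply_le _ _
      _ ≤ ‖ψ c - coeff X ξ₀ c‖ * (‖q‖ * ‖h‖) := by gcongr; exact norm_rep_apply_le _ _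
      _ ≤ ε' / (‖q‖ + 1) * ((‖q‖ + 1) * 1) := by
          have := (hψF c hc).le
          gcongr
          linarith
      _ = ε' := by field_simp
  rw [norm_sub_rev, ← norm_universalRep]
  refine lt_of_le_of_lt (ContinuousLinearMap.opNorm_le_of_re_inner_le (half_pos hε).le
    fun x y hx hy => ?_) (half_lt_self hε)
  have h3 := h2 a ha y x hy.le hx.le (hclose 1 (Finset.mem_insert_self _ _) y hy.le)
    (hclose 1 (Finset.mem_insert_self _ _) x hx.le)
    (hclose a (Finset.mem_insert_of_mem ha) x hx.le)
  rw [← inner_sub_right, ← sub_apply, ← map_sub, norm_inner_symm] at h3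
  exact (RCLike.re_le_norm _).trans h3.le

theorem WeaklyContained.exists_dominated_norm_net
    (hXY : WeaklyContained (universalRep B) X Y) (ξ : X.carrier) :
    ∃ (ι : Type (max u v)) (_ : Preorder ι) (_ : IsDirectedOrder ι)
      (_ : Nonempty ι) (ψ : ι → A → B),
      (∀ i, ψ i ∈ coeffHull Y ∧ ψ i 1 ≤ coeff X ξ 1) ∧
      ∀ a : A, Tendsto (fun i => ‖coeff X ξ a - ψ i a‖) atTop (nhds 0) := by
  classical
  let ι := ULift.{v} (Finset A × ℕ)
  have : ∀ i : ι, ∃ ψ ∈ coeffHull Y, ψ 1 ≤ coeff X ξ 1 ∧ ∀ a ∈ i.down.1,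
      ‖coeff X ξ a - ψ a‖ < 1 / ((i.down.2 : ℝ) + 1) := fun i =>
    hXY.exists_dominated_norm_approx ξ _ (by positivity)
  choose ψ hψ hψ1 hψa using this
  have hdir : IsDirectedOrder ι := ⟨fun i j => by
    obtain ⟨k, h1, h2⟩ := exists_ge_ge i.down j.down
    exact ⟨⟨k⟩, h1, h2⟩⟩
  refine ⟨ι, inferInstance, hdir, ⟨⟨∅, 0⟩⟩, ψ, fun i => ⟨hψ i, hψ1 i⟩, fun a => ?_⟩
  have hne : Nonempty ι := ⟨⟨∅, 0⟩⟩
  rw [Metric.tendsto_atTop]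
  intro ε hε
  obtain ⟨n, hn⟩ := exists_nat_one_div_lt hε
  refine ⟨⟨{a}, n⟩, fun i hi => ?_⟩
  obtain ⟨h1, h3⟩ : ({a} : Finset A) ⊆ i.down.1 ∧ n ≤ i.down.2 := hi
  rw [dist_zero_right, norm_norm]
  refine (hψa i a (h1 (by simp))).trans (lt_of_le_of_lt ?_ hn)
  have : (n : ℝ) ≤ i.down.2 := by exact_mod_cast h3
  gcongr

lemma mem_closure_of_tendsto_norm {S : Set (A → B)} {φ : A → B} {ι : Type*} {l : Filter ι}
    [l.NeBot] {ψ : ι → A → B} (hψ : ∀ i, ψ i ∈ S)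
    (ht : ∀ a, Tendsto (fun i => ‖φ a - ψ i a‖) l (𝓝 0)) : φ ∈ closure S := by
  refine mem_closure_of_tendsto (f := ψ) (b := l) (tendsto_pi_nhds.mpr fun a => ?_)
    (Eventually.of_forall hψ)
  rw [tendsto_iff_norm_sub_tendsto_zero]
  simpa only [norm_sub_rev] using ht a

theorem weaklyContained_of_mem_closure
    {H : Type x} [NormedAddCommGroup H] [InnerProductSpace ℂ H] [CompleteSpace H]
    {π : B →⋆ₙₐ[ℂ] (H →L[ℂ] H)} (h : ∀ ξ : X.carrier, coeff X ξ ∈ closure (coeffHull Y)) :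
    WeaklyContained π X Y := by
  refine weaklyContained_of_weak_approx fun ξ F G ε hε => ?_
  have hev : ∀ᶠ ψ in 𝓝 (coeff X ξ), ∀ a ∈ F, ∀ s ∈ G, ∀ t ∈ G,
      ‖inner ℂ s (π (ψ a) t) - inner ℂ s (π (coeff X ξ a) t)‖ < ε := by
    rw [Filter.eventually_all_finset]
    intro a _
    rw [Filter.eventually_all_finset]
    intro s _
    rw [Filter.eventually_all_finset]
    intro t _
    have hπ : Continuous π :=
      AddMonoidHomClass.continuous_of_bound π 1 fun b => by rw [one_mul]; exact norm_rep_le π b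
    have hc : Continuous fun ψ : A → B =>
        ‖inner ℂ s (π (ψ a) t) - inner ℂ s (π (coeff X ξ a) t)‖ := by
      have h1 : Continuous fun ψ : A → B => π (ψ a) := hπ.comp (continuous_apply a)
      fun_prop
    refine hc.continuousAt.eventually (gt_mem_nhds ?_)
    simpa using hε
  obtain ⟨ψ, hψ, h2⟩ := ((mem_closure_iff_frequently.mp (h ξ)).and_eventually hev).exists
  exact ⟨ψ, hψ, h2⟩

end UniversalEquivalence

end CStarCorr

end

/-! ### The two equivalences. -/

open CStarCorr Filter in
theorem mainTheorem2 {A : Type u} {B : Type v} [CStarAlgebra A] [NonUnitalCStarAlgebra B]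
    [PartialOrder B] [StarOrderedRing B] (X : Corr.{u, v, w} A B) (Y : Corr.{u, v, y} A B)
    {H : Type x} [NormedAddCommGroup H] [InnerProductSpace ℂ H] [CompleteSpace H]
    (π : B →⋆ₙₐ[ℂ] (H →L[ℂ] H)) (hπ : Nondegenerate π) :
    List.TFAE [
      WeaklyContained π X Y,
      ∀ ξ : X.carrier, ∃ (ι : Type (max u v x)) (_ : Preorder ι) (_ : IsDirectedOrder ι)
        (_ : Nonempty ι) (ψ : ι → A → B), (∀ i, ψ i ∈ coeffHull Y) ∧
        ∀ a : A, Tendsto (fun i => π (ψ i a)) atTop (@nhds _ (sigmaWeak H) (π (coeff X ξ a))),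
      ∀ ξ : X.carrier, ∃ (ι : Type (max u v x)) (_ : Preorder ι) (_ : IsDirectedOrder ι)
        (_ : Nonempty ι) (ψ : ι → A → B),
        (∀ i, ψ i ∈ coeffHull Y ∧ ψ i 1 ≤ coeff X ξ 1) ∧
        ∀ a : A, Tendsto (fun i => π (ψ i a)) atTop (@nhds _ (sigmaWeak H) (π (coeff X ξ a))),
      VNWeaklyContained (baseChange X (toBicommutant π)) (baseChange Y (toBicommutant π)),
      VNWeaklyContainedSome (baseChange X (toBicommutant π)) (baseChange Y (toBicommutant π))] ∧
    List.TFAE [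
      WeaklyContained (universalRep B) X Y,
      ∀ ξ : X.carrier, coeff X ξ ∈ closure (coeffHull Y),
      ∀ ξ : X.carrier, ∃ (ι : Type (max u v)) (_ : Preorder ι) (_ : IsDirectedOrder ι)
        (_ : Nonempty ι) (ψ : ι → A → B),
        (∀ i, ψ i ∈ coeffHull Y ∧ ψ i 1 ≤ coeff X ξ 1) ∧
        ∀ a : A, Tendsto (fun i => ‖coeff X ξ a - ψ i a‖) atTop (nhds 0)] := by
  constructor
  · tfae_have 1 → 3 := fun h ξ => h.exists_dominated_net hπ ξ
    tfae_have 3 → 2 := fun h ξ => by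
      obtain ⟨ι, i₁, i₂, i₃, ψ, hψ, ht⟩ := h ξ
      exact ⟨ι, i₁, i₂, i₃, ψ, fun i => (hψ i).1, ht⟩
    tfae_have 2 → 1 := weaklyContained_of_forall_exists_net
    tfae_have 2 → 4 := fun h _ _ _ _ _ hσ => weaklyContained_baseChange hσ h
    tfae_have 4 → 5 := fun h => ⟨H, inferInstance, inferInstance, inferInstance, VN.idRep _,
      VN.isFaithfulNormal_idRep, h H _ VN.isFaithfulNormal_idRep⟩
    tfae_have 5 → 1 := by
      rintro ⟨K, _, _, _, σ, hσ, h⟩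
      exact weaklyContained_of_baseChange hπ hσ h
    tfae_finish
  · tfae_have 1 → 3 := fun h ξ => h.exists_dominated_norm_net ξ
    tfae_have 3 → 2 := fun h ξ => by
      obtain ⟨ι, _, _, _, ψ, hψ, ht⟩ := h ξ
      exact mem_closure_of_tendsto_norm (fun i => (hψ i).1) ht
    tfae_have 2 → 1 := weaklyContained_of_mem_closure
    tfae_finish
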